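/- Let $n\ge 1$, let $\Omega\subset\mathbb{R}^n$ be a bounded, connected open set with Lipschitz boundary (for example, a piecewise $C^1$ boundary that is locally the graph of a Lipschitz function), let $\sigma$ be the $(n-1)$-dimensional Hausdorff measure on $\partial\Omega$ and $\mathbf n$ the exterior unit normal, which exists $\sigma$-a.e. Let $Y\subset\mathbb{R}^m$ and $Z\subset\mathbb{R}^{m\times n}$ be closed and convex, $p\in[1,+\infty]$, and let $I$ be an arbitrary, possibly uncountable, index set. Let $L,A_i,B_i,C_i:\Omega\times Y\times Z\to\mathbb{R}$ and $A_{\partial,i},B_{\partial,i},C_{\partial,i}:\partial\Omega\times Y\to\mathbb{R}$ ($i\in I$) be Borel functions. Integrals $\int f$ are understood in $[-\infty,+\infty]$ as $\int f^+-\int f^-$, with value $+\infty$ whenever $\int f^+=+\infty$. *Original problem.* Let $M\in[-\infty,+\infty]$ be the infimum of $\int_\Omega L(x,y(x),Dy(x))\,dx$ over all $y\in W^{1,p}(\Omega;\mathbb{R}^m)$ such that $y(x)\in Y$ and $Dy(x)\in Z$ for a.e. $x\in\Omega$, the trace of $y$ has values in $Y$ $\sigma$-a.e. on $\partial\Omega$,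 and, for every $i\in I$, $$A_i(x,y(x),Dy(x))=0,\quad B_i(x,y(x),Dy(x))\le 0\quad\text{for a.e. }x\in\Omega,$$ $$A_{\partial,i}(x,y(x))=0,\quad B_{\partial,i}(x,y(x))\le 0\quad\text{for }\sigma\text{-a.e. }x\in\partial\Omega,$$ $$\int_\Omega C_i(x,y(x),Dy(x))\,dx\le 0,\quad \int_{\partial\Omega}C_{\partial,i}(x,y(x))\,d\sigma(x)\le 0,$$ where $y$ on $\partial\Omega$ is the Sobolev trace. *Relaxation.* Let $\mathcal{O}^{\mathrm{aff}}_p$ be the set of pairs $(\mu,\mu_\partial)$ of positive Radon measures on $\overline\Omega\times Y\times Z$ and on $\partial\Omega\times Y$ such that $\mu(\overline\Omega\times Y\times Z)=|\Omega|$; both measures have compact support if $p=+\infty$, and $$\int_{\Omega\times Y\times Z}\Big(\|y\|^p+\sum_{k=1}^n\|z_k\|^p\Big)\,d\mu<+\infty,\qquad\int_{\partial\Omega\times Y}\|y\|^p\,d\mu_\partial<+\infty$$ if $p<+\infty$ (here $z_1,\dots,z_n\in\mathbb{R}^m$ are the columns of $z$); $\mathbf n(x)$ exists for $\mu_\partial$-a.e.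 $(x,y)$; and for all $\phi_1\in C^\infty(\mathbb{R}^n)$, $\phi_2\in C^\infty(\mathbb{R}^n;\mathbb{R}^m)$, $$\int_{\Omega\times Y\times Z}\Big[\frac{\partial\phi_1}{\partial x}(x)+y^\top\frac{\partial\phi_2}{\partial x}(x)+\phi_2(x)^\top z\Big]d\mu(x,y,z)=\int_{\partial\Omega\times Y}\big(\phi_1(x)+y^\top\phi_2(x)\big)\mathbf n(x)\,d\mu_\partial(x,y).$$ Let $M_{\mathrm r}^{\mathrm{aff}}\in[-\infty,+\infty]$ be the infimum of $\int_{\Omega\times Y\times Z}L\,d\mu$ over all $(\mu,\mu_\partial)\in\mathcal{O}^{\mathrm{aff}}_p$ such that $\mu$ is concentrated on $\Omega\times Y\times Z$ and, for every $i\in I$, $\mu$ is concentrated on $\{A_i=0,\ B_i\le 0\}$, $\mu_\partial$ is concentrated on $\{A_{\partial,i}=0,\ B_{\partial,i}\le 0\}$, $\int_{\Omega\times Y\times Z} C_i\,d\mu\le 0$ and $\int_{\partial\Omega\times Y} C_{\partial,i}\,d\mu_\partial\le 0$. **Theorem.** Suppose that for all $i\in I$ and $x\in\Omega$, the functions $L(x,\cdot,\cdot)$,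 $B_i(x,\cdot,\cdot)$, $C_i(x,\cdot,\cdot)$ are convex on $Y\times Z$ and $A_i(x,\cdot,\cdot)$ is affine on $Y\times Z$, and that for all $i\in I$ and $x\in\partial\Omega$, $A_{\partial,i}(x,\cdot)$ is affine on $Y$ and $B_{\partial,i}(x,\cdot)$, $C_{\partial,i}(x,\cdot)$ are convex on $Y$. Then $M_{\mathrm r}^{\mathrm{aff}}=M$. -/

import Mathlib

open MeasureTheory Filter Topology Set
open scoped ContDiff ENNReal NNReal

namespace OccRelax

/-- `ℝᵈ` with its Euclidean norm. -/
abbrev Vec (d : ℕ) := EuclideanSpace ℝ (Fin d)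

/-- `m × n` matrices, given by their `n` columns `z = (z₁, …, zₙ)`, `zₖ ∈ ℝᵐ`. -/
abbrev Mat (m n : ℕ) := Fin n → Vec m

/-- The `k`-th standard basis vector of `ℝⁿ`. -/
noncomputable abbrev stdVec {n : ℕ} (k : Fin n) : Vec n := EuclideanSpace.single k (1 : ℝ)

/-! ### Domains, surface measure, exterior normal -/

/-- `Ω` has Lipschitz boundary: near each boundary point, `Ω` is the set of points that lie
strictly below the graph, in some direction `v`, of a Lipschitz function `γ` of the variables
orthogonal to `v`. -/
def HasLipschitzBoundary {n : ℕ} (Ω : Set (Vec n)) : Prop :=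
  ∀ x₀ ∈ frontier Ω, ∃ (v : Vec n) (γ : Vec n → ℝ) (K : ℝ≥0) (r : ℝ),
    ‖v‖ = 1 ∧ LipschitzWith K γ ∧ (∀ (x : Vec n) (t : ℝ), γ (x + t • v) = γ x) ∧ 0 < r ∧
      ∀ x ∈ Metric.ball x₀ r, x ∈ Ω ↔ inner ℝ v x < γ x

/-- The `(n-1)`-dimensional Hausdorff measure (normalised as usual, to agree with Lebesgue measure
on `ℝⁿ⁻¹`) on the boundary of `Ω`. -/
noncomputable def surfaceMeasure {n : ℕ} (Ω : Set (Vec n)) : Measure (Vec n) :=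
  (Measure.euclideanHausdorffMeasure (n - 1)).restrict (frontier Ω)

/-- `ν` is the exterior unit normal of `Ω` at `x`: near `x`, up to an error that is of first order
small, `Ω` is the half space `{y | ⟪y - x, ν⟫ < 0}`. -/
def IsOuterNormal {n : ℕ} (Ω : Set (Vec n)) (x ν : Vec n) : Prop :=
  ‖ν‖ = 1 ∧ ∀ ε > (0 : ℝ), ∀ᶠ y in 𝓝 x,
    (inner ℝ (y - x) ν < -ε * ‖y - x‖ → y ∈ Ω) ∧ (ε * ‖y - x‖ < inner ℝ (y - x) ν → y ∉ Ω)

/-- The exterior unit normal exists at `x` (it does not, for instance, at a corner). -/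
def HasOuterNormal {n : ℕ} (Ω : Set (Vec n)) (x : Vec n) : Prop := ∃ ν, IsOuterNormal Ω x ν

open Classical in
/-- The exterior unit normal `𝐧(x)` (zero where there is none). -/
noncomputable def outerNormal {n : ℕ} (Ω : Set (Vec n)) (x : Vec n) : Vec n :=
  if h : HasOuterNormal Ω x then h.choose else 0

/-! ### Sobolev functions and their traces -/

/-- `z` is the weak derivative of `y` on `Ω`; its `k`-th column is the `k`-th partial
derivative. -/
def IsWeakDeriv {n m : ℕ} (Ω : Set (Vec n)) (y : Vec n → Vec m) (z : Vec n → Mat m n) : Prop :=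
  ∀ φ : Vec n → ℝ, ContDiff ℝ ∞ φ → HasCompactSupport φ → tsupport φ ⊆ Ω → ∀ k : Fin n,
    ∫ x in Ω, fderiv ℝ φ x (stdVec k) • y x = -∫ x in Ω, φ x • z x k

/-- `y ∈ W^{1,p}(Ω; ℝᵐ)` with weak derivative `z`. -/
structure IsSobolev {n m : ℕ} (Ω : Set (Vec n)) (p : ℝ≥0∞) (y : Vec n → Vec m)
    (z : Vec n → Mat m n) : Prop where
  memLp : MemLp y p (volume.restrict Ω)
  memLp_deriv : ∀ k, MemLp (fun x => z x k) p (volume.restrict Ω)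
  weakDeriv : IsWeakDeriv Ω y z

/-- `g ∈ L^p(∂Ω)` is the trace of the function `y ∈ W^{1,p}(Ω)` with weak derivative `z`. The trace
operator is the continuous extension of the restriction map `f ↦ f|_∂Ω` from functions that are
smooth up to the boundary; since `Ω` is bounded, `W^{1,p}(Ω) ⊆ W^{1,1}(Ω)`, and it is enough to
extend by continuity from `W^{1,1}(Ω)` to `L¹(∂Ω)`, for every `p`. -/
def IsTrace {n m : ℕ} (Ω : Set (Vec n)) (p : ℝ≥0∞) (y : Vec n → Vec m) (z : Vec n → Mat m n)
    (g : Vec n → Vec m) : Prop :=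
  MemLp g p (surfaceMeasure Ω) ∧
    ∃ f : ℕ → Vec n → Vec m, (∀ j, ContDiff ℝ ∞ (f j)) ∧
      Tendsto (fun j => eLpNorm (fun x => f j x - y x) 1 (volume.restrict Ω)) atTop (𝓝 0) ∧
      (∀ k, Tendsto (fun j => eLpNorm (fun x => fderiv ℝ (f j) x (stdVec k) - z x k) 1
        (volume.restrict Ω)) atTop (𝓝 0)) ∧
      Tendsto (fun j => eLpNorm (fun x => f j x - g x) 1 (surfaceMeasure Ω)) atTop (𝓝 0)

/-! ### Extended integral -/

open Classical in
/-- The integral of a real function as an extended real number, `∫ f⁺ - ∫ f⁻`. It is `+∞` when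
`∫ f⁺ = +∞` (also if `∫ f⁻ = +∞`), so that an ill-defined integral neither contributes to an
infimum nor satisfies a constraint `∫ f ≤ 0`. -/
noncomputable def extIntegral {α : Type*} [MeasurableSpace α] (μ : Measure α) (f : α → ℝ) : EReal :=
  if ∫⁻ a, ENNReal.ofReal (f a) ∂μ = ⊤ then ⊤
  else ((∫⁻ a, ENNReal.ofReal (f a) ∂μ : ℝ≥0∞) : EReal)
    - ((∫⁻ a, ENNReal.ofReal (-f a) ∂μ : ℝ≥0∞) : EReal)

/-! ### The variational problem -/

/-- The data of the problem. The functions `L`, `A i`, `B i`, `C i` matter only on `Ω × Y × Z`, and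
`A∂ i`, `B∂ i`, `C∂ i` only on `∂Ω × Y`. -/
structure Problem (n m : ℕ) (I : Type*) where
  Ω : Set (Vec n)
  Y : Set (Vec m)
  Z : Set (Mat m n)
  p : ℝ≥0∞
  L : Vec n × Vec m × Mat m n → ℝ
  A : I → Vec n × Vec m × Mat m n → ℝ
  B : I → Vec n × Vec m × Mat m n → ℝ
  C : I → Vec n × Vec m × Mat m n → ℝ
  A_bd : I → Vec n × Vec m → ℝ
  B_bd : I → Vec n × Vec m → ℝ
  C_bd : I → Vec n × Vec m → ℝ

namespace Problem

variable {n m : ℕ} {I : Type*}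

/-- `Ω × Y × Z`. -/
def bulk (P : Problem n m I) : Set (Vec n × Vec m × Mat m n) := P.Ω ×ˢ P.Y ×ˢ P.Z

/-- `∂Ω × Y`. -/
def bdry (P : Problem n m I) : Set (Vec n × Vec m) := frontier P.Ω ×ˢ P.Y

/-- `y ∈ W^{1,p}(Ω; Y)`, with weak derivative `z = Dy` and trace `g = y|_∂Ω`, satisfies the
constraints of the original problem. The values have to lie in the sets on which the data are
defined: `(y, Dy) ∈ Y × Z` a.e. in `Ω`, and `y ∈ Y` a.e. on `∂Ω` (the latter is automatic if `Y` is
closed and convex). -/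
structure Feasible (P : Problem n m I) (y : Vec n → Vec m) (z : Vec n → Mat m n)
    (g : Vec n → Vec m) : Prop where
  sobolev : IsSobolev P.Ω P.p y z
  trace : IsTrace P.Ω P.p y z g
  mem_bulk : ∀ᵐ x ∂volume.restrict P.Ω, y x ∈ P.Y ∧ z x ∈ P.Z
  mem_bdry : ∀ᵐ x ∂surfaceMeasure P.Ω, g x ∈ P.Y
  pointwise : ∀ i, ∀ᵐ x ∂volume.restrict P.Ω,
    P.A i (x, y x, z x) = 0 ∧ P.B i (x, y x, z x) ≤ 0
  pointwise_bdry : ∀ i, ∀ᵐ x ∂surfaceMeasure P.Ω, P.A_bd i (x, g x) = 0 ∧ P.B_bd i (x, g x) ≤ 0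
  integral : ∀ i, extIntegral (volume.restrict P.Ω) (fun x => P.C i (x, y x, z x)) ≤ 0
  integral_bdry : ∀ i, extIntegral (surfaceMeasure P.Ω) (fun x => P.C_bd i (x, g x)) ≤ 0

/-- The infimum `M` of the original problem. -/
noncomputable def M (P : Problem n m I) : EReal :=
  ⨅ (y : Vec n → Vec m) (z : Vec n → Mat m n) (g : Vec n → Vec m) (_ : P.Feasible y z g),
    extIntegral (volume.restrict P.Ω) (fun x => P.L (x, y x, z x))

/-- Affinely relaxed occupation measures: pairs of positive Radon measures on `closure Ω × Y × Z`
and `∂Ω × Y`, here as Borel measures on the ambient Euclidean spaces that vanish off these sets.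
The field `normal_ae` says that the integral of `(φ₁ + yᵀφ₂) 𝐧` is meaningful: `𝐧` is defined
`μb`-almost everywhere. Test functions are smooth up to the boundary of `Ω`. -/
structure IsAffOccupation (P : Problem n m I) (μ : Measure (Vec n × Vec m × Mat m n))
    (μb : Measure (Vec n × Vec m)) : Prop where
  radon : IsFiniteMeasureOnCompacts μ
  radon_bdry : IsFiniteMeasureOnCompacts μb
  carrier : ∀ᵐ w ∂μ, w ∈ closure P.Ω ×ˢ P.Y ×ˢ P.Z
  carrier_bdry : ∀ᵐ w ∂μb, w ∈ P.bdry
  mass : μ univ = volume P.Ω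
  compact_support : P.p = ⊤ → IsCompact μ.support ∧ IsCompact μb.support
  moments : P.p ≠ ⊤ →
    ∫⁻ w in P.bulk, (‖w.2.1‖ₑ ^ P.p.toReal + ∑ k, ‖w.2.2 k‖ₑ ^ P.p.toReal) ∂μ < ⊤ ∧
      ∫⁻ w in P.bdry, ‖w.2‖ₑ ^ P.p.toReal ∂μb < ⊤
  normal_ae : ∀ᵐ w ∂μb, HasOuterNormal P.Ω w.1
  liouville : ∀ (φ₁ : Vec n → ℝ) (φ₂ : Vec n → Vec m), ContDiff ℝ ∞ φ₁ → ContDiff ℝ ∞ φ₂ →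
    ∀ k : Fin n,
      ∫ w in P.bulk, (fderiv ℝ φ₁ w.1 (stdVec k)
          + inner ℝ w.2.1 (fderiv ℝ φ₂ w.1 (stdVec k) : Vec m)
          + inner ℝ (φ₂ w.1) (w.2.2 k)) ∂μ
        = ∫ w in P.bdry, (φ₁ w.1 + inner ℝ w.2 (φ₂ w.1)) * outerNormal P.Ω w.1 k ∂μb

/-- Feasibility for the relaxed problem. The support constraints say that `μ` and `μb` are carried
by `{(x, y, z) ∈ Ω × Y × Z | A i = 0, B i ≤ 0}` and `{(x, y) ∈ ∂Ω × Y | A∂ i = 0, B∂ i ≤ 0}`, for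
each `i`. See `ae_mem_iff_support` below: for continuous constraint functions this is the inclusion
of the topological supports (relative to `Ω × Y × Z` and `∂Ω × Y`) in these sets. -/
structure RelaxedFeasible (P : Problem n m I) (μ : Measure (Vec n × Vec m × Mat m n))
    (μb : Measure (Vec n × Vec m)) : Prop where
  occupation : P.IsAffOccupation μ μb
  carrier_bulk : ∀ᵐ w ∂μ, w ∈ P.bulk
  support : ∀ i, ∀ᵐ w ∂μ, P.A i w = 0 ∧ P.B i w ≤ 0
  support_bdry : ∀ i, ∀ᵐ w ∂μb, P.A_bd i w = 0 ∧ P.B_bd i w ≤ 0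
  integral : ∀ i, extIntegral (μ.restrict P.bulk) (P.C i) ≤ 0
  integral_bdry : ∀ i, extIntegral (μb.restrict P.bdry) (P.C_bd i) ≤ 0

/-- The infimum `M_r^aff` of the relaxation over affinely relaxed occupation measures. -/
noncomputable def MrAff (P : Problem n m I) : EReal :=
  ⨅ (μ : Measure (Vec n × Vec m × Mat m n)) (μb : Measure (Vec n × Vec m))
    (_ : P.RelaxedFeasible μ μb), extIntegral (μ.restrict P.bulk) P.L

end Problem

/-- For a function `f` that is continuous on a set `S` carrying `μ`, and closed `T`: `μ` is carried
by `f ⁻¹' T` if and only if the support of `μ` relative to `S` is contained in `f ⁻¹' T`. -/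
theorem ae_mem_iff_support {X R : Type*} [TopologicalSpace X] [MeasurableSpace X]
    [HereditarilyLindelofSpace X] [TopologicalSpace R] (μ : Measure X) {S : Set X}
    (hS : ∀ᵐ w ∂μ, w ∈ S) {f : X → R} (hf : ContinuousOn f S) {T : Set R} (hT : IsClosed T) :
    (∀ᵐ w ∂μ, f w ∈ T) ↔ μ.support ∩ S ⊆ f ⁻¹' T := by
  constructor
  · rintro h w ⟨hw, hwS⟩
    by_contra hwT
    have h1 : ∀ᶠ v in 𝓝[S] w, f v ∈ Tᶜ := (hf w hwS) (hT.isOpen_compl.mem_nhds hwT)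
    rw [eventually_nhdsWithin_iff] at h1
    have h2 := (Measure.mem_support_iff_forall w).1 hw _ h1
    refine h2.ne' (measure_mono_null ?_ (ae_iff.1 (hS.and h)))
    intro v hv hv'
    exact hv hv'.1 hv'.2
  · intro h
    filter_upwards [Measure.support_mem_ae (μ := μ), hS] with w hw hwS using h ⟨hw, hwS⟩

end OccRelax

namespace OccRelax

/-! ### Barycenters in convex sets that need not be closed -/

/-! The inequality `MrAff ≤ M` is the easy half. A feasible `y` with trace `g` induces the
push-forwards of Lebesgue measure under `x ↦ (x, y x, Dy x)` and of surface measure under `x ↦ (x, g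
x)`; the Liouville equation for this pair is the Gauss–Green formula.

For the converse, a feasible pair `(μ, μb)` is replaced by its fibrewise barycenters. The Liouville
equation with `φ₂ = 0` and `φ₁` supported in `Ω` says that the `x`-marginal of `μ` has zero
gradient; since `Ω` is connected and the total mass is prescribed, this marginal is Lebesgue measure
(`fst_eq`). General `φ₁` and the divergence theorem then show that the `x`-marginal of `μb` and the
surface measure agree after multiplication by the normal, hence agree, because the normal has length
one (`fst_bdry_eq`). So both measures disintegrate over the right base measures. The test functions
`φ₂` see `(y, z)` only linearly, so the equation passes to the conditional means and becomes a
Gauss–Green formula for them: the mean of `z` is the weak derivative of the mean of `y`, and the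
mean of `μb` is its trace. Jensen's inequality in each fibre preserves the constraints and the `L^p`
bounds and does not increase the cost. Every constraint is handled by itself, so the size of `I`
plays no role.

Two points need care. Convex Borel functions on `Y × Z` need not be continuous, and the constraint
sets in the fibres need not be closed; `integral_mem_of_convex` places the barycenter in an
arbitrary convex set of finite dimension, and its application to an epigraph is Jensen's inequality.
Extended integrals are limits of the integrals of the truncations `max f (-k)`, which are still
convex and are integrable.

The analytic core is the divergence theorem on a Lipschitz domain with Hausdorff surface measure: an
area formula for graphs, Fubini below a graph, and a partition of unity. To recognise the trace,
which is defined by smooth approximation, density of smooth functions in `W^{1,1}` and the trace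
inequality are needed as well (`isTrace_of_integral_eq`). -/

/-- With nonempty interior this is Hahn–Banach. Otherwise `C` lies in a proper affine subspace, and
a nonzero functional that kills its direction is constant on `C`, hence on the closure. -/
theorem exists_supporting_functional {F : Type*} [NormedAddCommGroup F] [NormedSpace ℝ F]
    [FiniteDimensional ℝ F] {C : Set F} (hC : Convex ℝ C) {b : F} (hb : b ∈ closure C)
    (hbC : b ∉ C) : ∃ f : StrongDual ℝ F, f ≠ 0 ∧ ∀ a ∈ C, f a ≤ f b := by
  by_cases hi : (interior C).Nonempty
  · exact geometric_hahn_banach_of_nonempty_interior_point hC (fun h => hbC (interior_subset h)) hi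
  · have hspan : affineSpan ℝ C ≠ ⊤ := fun h => hi (hC.interior_nonempty_iff_affineSpan_eq_top.2 h)
    have hne : C.Nonempty := closure_nonempty_iff.1 ⟨b, hb⟩
    obtain ⟨c, hc⟩ := hne
    have hdir : (affineSpan ℝ C).direction < ⊤ := by
      rw [lt_top_iff_ne_top]
      intro h
      exact hspan ((AffineSubspace.direction_eq_top_iff_of_nonempty
        ⟨c, subset_affineSpan ℝ C hc⟩).1 h)
    obtain ⟨f, hf, hker⟩ := Submodule.exists_le_ker_of_lt_top _ hdir
    let g : StrongDual ℝ F := LinearMap.toContinuousLinearMap f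
    have hconst : ∀ a ∈ C, g a = g c := by
      intro a ha
      have : a - c ∈ (affineSpan ℝ C).direction :=
        AffineSubspace.vsub_mem_direction (subset_affineSpan ℝ C ha) (subset_affineSpan ℝ C hc)
      have h2 : f (a - c) = 0 := hker this
      rw [map_sub, sub_eq_zero] at h2
      exact h2
    have hcl : closure C ⊆ {a | g a = g c} :=
      closure_minimal hconst (isClosed_eq g.continuous continuous_const)
    refine ⟨g, ?_, fun a ha => ?_⟩
    · intro h
      apply hf
      ext x
      exact congrArg (fun k : StrongDual ℝ F => k x) h
    · rw [hconst a ha, hcl hb]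

/-- Induction on the dimension. The barycenter `b` lies in the closure of `C`. If it were not in
`C`, a supporting functional `l` at `b` would give `l b - l (f x) ≥ 0` with mean zero, so that `f`
takes its values a.e. in the hyperplane `l = l b`. The induction hypothesis there puts `b` into `C`
after all. -/
theorem integral_mem_of_convex_of_finrank {α : Type*} [MeasurableSpace α] (μ : Measure α)
    [IsProbabilityMeasure μ] (d : ℕ) :
    ∀ (F : Type*) [NormedAddCommGroup F] [NormedSpace ℝ F] [FiniteDimensional ℝ F],
      Module.finrank ℝ F = d → ∀ {C : Set F}, Convex ℝ C → ∀ {f : α → F}, Integrable f μ →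
        (∀ᵐ x ∂μ, f x ∈ C) → ∫ x, f x ∂μ ∈ C := by
  induction d using Nat.strong_induction_on with
  | _ d ih =>
    intro F _ _ _ hd C hC f hf hfC
    by_contra hb
    set b := ∫ x, f x ∂μ with hbdef
    have hbcl : b ∈ closure C :=
      hC.closure.integral_mem isClosed_closure (hfC.mono fun x hx => subset_closure hx) hf
    obtain ⟨l, hl, hlC⟩ := exists_supporting_functional hC hbcl hb
    have hlf : Integrable (fun x => l (f x)) μ := l.integrable_comp hf
    have hint : ∫ x, (l b - l (f x)) ∂μ = 0 := by
      rw [integral_sub (integrable_const _) hlf, l.integral_comp_comm hf]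
      simp [hbdef]
    have hae : ∀ᵐ x ∂μ, l (f x) = l b := by
      have h0 : 0 ≤ᵐ[μ] fun x => l b - l (f x) := by
        filter_upwards [hfC] with x hx
        exact sub_nonneg.2 (hlC _ hx)
      have := (integral_eq_zero_iff_of_nonneg_ae h0 ((integrable_const _).sub hlf)).1 hint
      filter_upwards [this] with x hx
      have : l b - l (f x) = 0 := hx
      linarith
    let K : Submodule ℝ F := LinearMap.ker (l : F →ₗ[ℝ] ℝ)
    -- A linear projection onto the kernel turns `f - b`, which is only a.e. in `K`, into a map with
    -- values in `K`.
    obtain ⟨P, hP⟩ := K.subtype.exists_leftInverse_of_injective (by simp)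
    let P' : F →L[ℝ] K := LinearMap.toContinuousLinearMap P
    have hP' : ∀ v : F, l v = 0 → ((P' v : K) : F) = v := by
      intro v hv
      have := congrArg (fun q : K →ₗ[ℝ] K => ((q ⟨v, hv⟩ : K) : F)) hP
      simpa [P'] using this
    have hlt : Module.finrank ℝ K < d := by
      rw [← hd]
      apply Submodule.finrank_lt
      intro h
      apply hl
      ext x
      have : x ∈ K := by rw [h]; trivial
      exact this
    let C' : Set K := {k | (k : F) + b ∈ C}
    have hC' : Convex ℝ C' := by
      have := (hC.translate_preimage_left b).linear_preimage K.subtype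
      exact this
    have hf' : Integrable (fun x => P' (f x - b)) μ :=
      P'.integrable_comp (hf.sub (integrable_const _))
    have := ih _ hlt K rfl hC' hf' (by
      filter_upwards [hfC, hae] with x hx hx'
      have : l (f x - b) = 0 := by rw [map_sub, hx', sub_self]
      change ((P' (f x - b) : K) : F) + b ∈ C
      rw [hP' _ this]
      simpa using hx)
    have h0 : ∫ x, P' (f x - b) ∂μ = 0 := by
      rw [P'.integral_comp_comm (φ := fun x => f x - b) (hf.sub (integrable_const _)),
        integral_sub hf (integrable_const _)]
      simp [← hbdef]
    rw [h0] at this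
    apply hb
    simpa [C'] using this

/-- The barycenter of a probability measure that is carried by a convex subset of a
finite-dimensional space belongs to this set, even if it is not closed. -/
theorem integral_mem_of_convex {α : Type*} [MeasurableSpace α] {μ : Measure α}
    [IsProbabilityMeasure μ] {F : Type*} [NormedAddCommGroup F] [NormedSpace ℝ F]
    [FiniteDimensional ℝ F] {C : Set F} (hC : Convex ℝ C) {f : α → F} (hf : Integrable f μ)
    (hfC : ∀ᵐ x ∂μ, f x ∈ C) : ∫ x, f x ∂μ ∈ C :=
  integral_mem_of_convex_of_finrank μ _ F rfl hC hf hfC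

/-- Jensen's inequality for a convex function on a convex subset of a finite-dimensional space,
without any continuity. -/
theorem map_integral_le_of_convexOn {α : Type*} [MeasurableSpace α] {μ : Measure α}
    [IsProbabilityMeasure μ] {F : Type*} [NormedAddCommGroup F] [NormedSpace ℝ F]
    [FiniteDimensional ℝ F] {S : Set F} {h : F → ℝ} (hh : ConvexOn ℝ S h) {f : α → F}
    (hf : Integrable f μ) (hfS : ∀ᵐ x ∂μ, f x ∈ S) (hhf : Integrable (fun x => h (f x)) μ) :
    h (∫ x, f x ∂μ) ≤ ∫ x, h (f x) ∂μ := by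
  -- The pair `(f, h ∘ f)` takes its values in the epigraph, which is convex but need not be closed.
  have := integral_mem_of_convex hh.convex_epigraph (hf.prodMk hhf)
    (hfS.mono fun x hx => ⟨hx, le_rfl⟩)
  have h2 := this.2
  rwa [fst_integral (hf.prodMk hhf), snd_integral (hf.prodMk hhf)] at h2

/-! ### The extended integral -/

theorem extIntegral_eq_top {α : Type*} [MeasurableSpace α] {μ : Measure α} {f : α → ℝ}
    (h : ∫⁻ a, ENNReal.ofReal (f a) ∂μ = ⊤) : extIntegral μ f = ⊤ := by
  simp [extIntegral, h]

theorem extIntegral_map {α β : Type*} [MeasurableSpace α] [MeasurableSpace β] {μ : Measure α}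
    {T : α → β} (hT : AEMeasurable T μ) {f : β → ℝ} (hf : AEMeasurable f (μ.map T)) :
    extIntegral (μ.map T) f = extIntegral μ (fun x => f (T x)) := by
  have h1 := lintegral_map' (μ := μ) (g := T) (f := fun a => ENNReal.ofReal (f a))
    hf.ennreal_ofReal hT
  have h2 := lintegral_map' (μ := μ) (g := T) (f := fun a => ENNReal.ofReal (-f a))
    hf.neg.ennreal_ofReal hT
  simp only [extIntegral, h1, h2]

/-- Truncation from below leaves the positive part alone and bounds the negative part by `k`, which
is integrable for a finite measure. -/
theorem integrable_max_neg {α : Type*} [MeasurableSpace α] {μ : Measure α} [IsFiniteMeasure μ]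
    {f : α → ℝ} (hf : AEMeasurable f μ) (hfin : ∫⁻ a, ENNReal.ofReal (f a) ∂μ ≠ ⊤) (k : ℕ) :
    Integrable (fun x => max (f x) (-k : ℝ)) μ := by
  refine ⟨(hf.max aemeasurable_const).aestronglyMeasurable, ?_⟩
  have : ∀ x, ‖max (f x) (-k : ℝ)‖ₑ ≤ ENNReal.ofReal (f x) + ENNReal.ofReal k := by
    intro x
    rw [← ofReal_norm, Real.norm_eq_abs]
    by_cases h : 0 ≤ f x
    · rw [← ENNReal.ofReal_add h (Nat.cast_nonneg k)]
      apply ENNReal.ofReal_le_ofReal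
      have hk : (0 : ℝ) ≤ k := Nat.cast_nonneg k
      rw [abs_le]
      constructor <;> [skip; apply max_le] <;> linarith [le_max_left (f x) (-k : ℝ)]
    · refine le_add_left (ENNReal.ofReal_le_ofReal ?_)
      have hk : (0 : ℝ) ≤ k := Nat.cast_nonneg k
      rw [abs_le]
      constructor <;> [skip; apply max_le] <;> linarith [le_max_right (f x) (-k : ℝ)]
  refine lt_of_le_of_lt (lintegral_mono this) ?_
  rw [lintegral_add_right _ measurable_const]
  refine ENNReal.add_lt_top.2 ⟨hfin.lt_top, ?_⟩
  simp [ENNReal.mul_lt_top_iff]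

/-- The extended integral is the limit of the integrals of the truncations from below. -/
theorem tendsto_integral_max_neg {α : Type*} [MeasurableSpace α] {μ : Measure α}
    [IsFiniteMeasure μ] {f : α → ℝ} (hf : AEMeasurable f μ)
    (hfin : ∫⁻ a, ENNReal.ofReal (f a) ∂μ ≠ ⊤) :
    Tendsto (fun k : ℕ => ((∫ x, max (f x) (-k : ℝ) ∂μ : ℝ) : EReal)) atTop
      (𝓝 (extIntegral μ f)) := by
  set a := ∫⁻ a, ENNReal.ofReal (f a) ∂μ with ha
  have hpos : ∀ k : ℕ, ∀ x, ENNReal.ofReal (max (f x) (-k : ℝ)) = ENNReal.ofReal (f x) := by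
    intro k x
    have hk : (0 : ℝ) ≤ k := Nat.cast_nonneg k
    rcases le_total (f x) (-k : ℝ) with h | h
    · rw [max_eq_right h, ENNReal.ofReal_of_nonpos (by linarith),
        ENNReal.ofReal_of_nonpos (by linarith)]
    · rw [max_eq_left h]
  set b : ℕ → ℝ≥0∞ := fun k => ∫⁻ x, ENNReal.ofReal (-max (f x) (-k : ℝ)) ∂μ with hb
  have hbfin : ∀ k, b k ≠ ⊤ := fun k =>
    ((integrable_max_neg hf hfin k).neg).lintegral_lt_top.ne
  have hlim : Tendsto b atTop (𝓝 (∫⁻ x, ENNReal.ofReal (-f x) ∂μ)) := by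
    refine lintegral_tendsto_of_tendsto_of_monotone
      (fun k => (hf.max aemeasurable_const).neg.ennreal_ofReal) ?_ ?_
    · refine Eventually.of_forall fun x i j hij => ENNReal.ofReal_le_ofReal ?_
      have : (i : ℝ) ≤ j := by exact_mod_cast hij
      exact neg_le_neg (max_le_max le_rfl (by linarith))
    · refine Eventually.of_forall fun x => ?_
      refine tendsto_const_nhds.congr' ?_
      filter_upwards [eventually_ge_atTop ⌈|f x|⌉₊] with k hk
      have h1 : |f x| ≤ k := (Nat.le_ceil _).trans (by exact_mod_cast hk)
      rw [max_eq_left (by linarith [neg_abs_le (f x)])]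
  have hexp : ∀ k : ℕ, ((∫ x, max (f x) (-k : ℝ) ∂μ : ℝ) : EReal)
      = (a : EReal) + -(b k : EReal) := by
    intro k
    rw [integral_eq_lintegral_pos_part_sub_lintegral_neg_part (integrable_max_neg hf hfin k)]
    simp only [hpos]
    rw [EReal.coe_sub, ← ha, EReal.coe_ennreal_toReal hfin, EReal.coe_ennreal_toReal (hbfin k),
      sub_eq_add_neg]
  simp only [hexp]
  rw [extIntegral, if_neg hfin, sub_eq_add_neg]
  have hneg : Tendsto (fun k => -(b k : EReal)) atTop
      (𝓝 (-((∫⁻ x, ENNReal.ofReal (-f x) ∂μ : ℝ≥0∞) : EReal))) :=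
    (continuous_neg.tendsto _).comp ((continuous_coe_ennreal_ereal.tendsto _).comp hlim)
  refine (EReal.continuousAt_add (p := (_, _)) (Or.inl ?_) (Or.inl ?_)).tendsto.comp
    (tendsto_const_nhds.prodMk_nhds hneg)
  · exact EReal.coe_ennreal_eq_top_iff.not.2 hfin
  · exact EReal.coe_ennreal_ne_bot _

/-- Comparison of extended integrals through the truncations from below. -/
theorem extIntegral_le_extIntegral {α β : Type*} [MeasurableSpace α] [MeasurableSpace β]
    {μ : Measure α} {ν : Measure β} [IsFiniteMeasure μ] [IsFiniteMeasure ν] {f : α → ℝ}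
    {g : β → ℝ} (hf : AEMeasurable f μ) (hg : AEMeasurable g ν)
    (hfin : ∫⁻ a, ENNReal.ofReal (g a) ∂ν ≠ ⊤ → ∫⁻ a, ENNReal.ofReal (f a) ∂μ ≠ ⊤)
    (h : ∫⁻ a, ENNReal.ofReal (g a) ∂ν ≠ ⊤ → ∀ k : ℕ,
      ∫ x, max (f x) (-k : ℝ) ∂μ ≤ ∫ x, max (g x) (-k : ℝ) ∂ν) :
    extIntegral μ f ≤ extIntegral ν g := by
  by_cases hgt : ∫⁻ a, ENNReal.ofReal (g a) ∂ν = ⊤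
  · rw [extIntegral_eq_top hgt]
    exact le_top
  · exact le_of_tendsto_of_tendsto' (tendsto_integral_max_neg hf (hfin hgt))
      (tendsto_integral_max_neg hg hgt) fun k => EReal.coe_le_coe_iff.2 (h hgt k)

/-! ### Disintegration and Jensen's inequality -/

theorem aemeasurable_of_measurable_domRestrict {γ : Type*} [MeasurableSpace γ] {ν : Measure γ}
    {S : Set γ} (hS : MeasurableSet S) {F : γ → ℝ} (hF : Measurable (S.domRestrict F))
    (hν : ∀ᵐ w ∂ν, w ∈ S) : AEMeasurable F ν := by
  have := aemeasurable_restrict_of_measurable_subtype (μ := ν) hS hF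
  rwa [Measure.restrict_eq_self_of_ae_mem hν] at this

section Disintegration

variable {α β : Type*} [MeasurableSpace α] [NormedAddCommGroup β] [NormedSpace ℝ β]
  [FiniteDimensional ℝ β] [MeasurableSpace β] [BorelSpace β] [StandardBorelSpace β]
  {μ : Measure (α × β)} [IsFiniteMeasure μ]

/-- The conditional mean of the second component given the first one. -/
noncomputable def condMean (μ : Measure (α × β)) [IsFiniteMeasure μ] (x : α) : β :=
  ∫ b, b ∂μ.condKernel x

omit [NormedSpace ℝ β] [FiniteDimensional ℝ β] [BorelSpace β] in
theorem ae_ae_condKernel {p : α × β → Prop} (h : ∀ᵐ w ∂μ, p w) :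
    ∀ᵐ x ∂μ.fst, ∀ᵐ b ∂μ.condKernel x, p (x, b) := by
  rw [← μ.disintegrate μ.condKernel] at h
  exact Measure.ae_ae_of_ae_compProd h

omit [BorelSpace β] in
-- The predicate needs neither measurability nor closed fibres: almost every conditional measure is
-- carried by the convex fibre, and so contains its barycenter there.
theorem condMean_mem (hint : Integrable (fun w : α × β => w.2) μ) {p : α × β → Prop}
    (hp : ∀ᵐ w ∂μ, p w) (hconv : ∀ᵐ x ∂μ.fst, Convex ℝ {b | p (x, b)}) :
    ∀ᵐ x ∂μ.fst, p (x, condMean μ x) := by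
  filter_upwards [ae_ae_condKernel hp, hconv, hint.condKernel_ae] with x hx hc hi
  exact integral_mem_of_convex hc hi hx

omit [FiniteDimensional ℝ β] [BorelSpace β] in
theorem aemeasurable_condMean [BorelSpace β] (hint : Integrable (fun w : α × β => w.2) μ) :
    AEMeasurable (condMean μ) μ.fst :=
  hint.1.integral_condKernel.aemeasurable

omit [FiniteDimensional ℝ β] in
theorem aemeasurable_comp_condMean (hint : Integrable (fun w : α × β => w.2) μ)
    {S : Set (α × β)} (hS : MeasurableSet S) {F : α × β → ℝ} (hF : Measurable (S.domRestrict F))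
    (hSx : ∀ᵐ x ∂μ.fst, (x, condMean μ x) ∈ S) :
    AEMeasurable (fun x => F (x, condMean μ x)) μ.fst := by
  have hT : AEMeasurable (fun x => (x, condMean μ x)) μ.fst :=
    aemeasurable_id.prodMk (aemeasurable_condMean hint)
  refine AEMeasurable.comp_aemeasurable (g := F) ?_ hT
  exact aemeasurable_of_measurable_domRestrict hS hF ((ae_map_iff hT hS).2 hSx)

/-- Jensen's inequality for the extended integral and the conditional mean. -/
theorem extIntegral_condMean_le (hint : Integrable (fun w : α × β => w.2) μ)
    {S : Set (α × β)} (hS : MeasurableSet S) {F : α × β → ℝ} (hF : Measurable (S.domRestrict F))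
    (hμS : ∀ᵐ w ∂μ, w ∈ S)
    (hconv : ∀ᵐ x ∂μ.fst, ConvexOn ℝ {b | (x, b) ∈ S} (fun b => F (x, b))) :
    extIntegral μ.fst (fun x => F (x, condMean μ x)) ≤ extIntegral μ F := by
  have hSx : ∀ᵐ x ∂μ.fst, (x, condMean μ x) ∈ S :=
    condMean_mem hint hμS (hconv.mono fun x hx => hx.1)
  have hFm : AEMeasurable F μ := aemeasurable_of_measurable_domRestrict hS hF hμS
  have hfm := aemeasurable_comp_condMean hint hS hF hSx
  have key : ∫⁻ a, ENNReal.ofReal (F a) ∂μ ≠ ⊤ → ∀ k : ℕ, ∀ᵐ x ∂μ.fst,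
      max (F (x, condMean μ x)) (-k : ℝ)
        ≤ ∫ b, max (F (x, b)) (-k : ℝ) ∂μ.condKernel x := by
    intro hfin k
    have hI := integrable_max_neg hFm hfin k
    filter_upwards [hconv, ae_ae_condKernel hμS, hint.condKernel_ae, hI.condKernel_ae]
      with x hc hx hi hFi
    -- A maximum with a constant is still convex, so Jensen applies to each truncation.
    have hc' : ConvexOn ℝ {b | (x, b) ∈ S} (fun b => max (F (x, b)) (-k : ℝ)) :=
      hc.sup (convexOn_const _ hc.1)
    exact map_integral_le_of_convexOn hc' hi hx hFi
  have hfin' : ∫⁻ a, ENNReal.ofReal (F a) ∂μ ≠ ⊤ →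
      ∫⁻ x, ENNReal.ofReal (F (x, condMean μ x)) ∂μ.fst ≠ ⊤ := by
    intro hfin
    -- The truncation at level `0` is the positive part; its fibre means are integrable and dominate
    -- the positive part of `F` at the conditional mean.
    have hI := (integrable_max_neg hFm hfin 0).integral_condKernel
    refine ne_top_of_le_ne_top hI.lintegral_lt_top.ne (lintegral_mono_ae ?_)
    filter_upwards [key hfin 0] with x hx
    exact ENNReal.ofReal_le_ofReal ((le_max_left _ _).trans hx)
  refine extIntegral_le_extIntegral hfm hFm hfin' fun hfin k => ?_
  have hI := integrable_max_neg hFm hfin k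
  rw [← Measure.integral_condKernel hI]
  exact integral_mono_ae (integrable_max_neg hfm (hfin' hfin) k) hI.integral_condKernel
    (key hfin k)

/-- Jensen for `‖·‖ ^ p`, obtained from the monotonicity of `L^p` norms in `p` for the conditional
probability measures. -/
theorem lintegral_condMean_rpow_le {E : Type*} [NormedAddCommGroup E] [NormedSpace ℝ E]
    [MeasurableSpace E] [BorelSpace E] [FiniteDimensional ℝ E]
    (hint : Integrable (fun w : α × β => w.2) μ) (l : β →L[ℝ] E) {p : ℝ} (hp : 1 ≤ p) :
    ∫⁻ x, ‖l (condMean μ x)‖ₑ ^ p ∂μ.fst ≤ ∫⁻ w, ‖l w.2‖ₑ ^ p ∂μ := by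
  have hm : Measurable fun w : α × β => ‖l w.2‖ₑ ^ p :=
    (l.continuous.measurable.comp measurable_snd).enorm.pow_const p
  rw [← Measure.lintegral_condKernel hm]
  refine lintegral_mono_ae ?_
  filter_upwards [hint.condKernel_ae] with x hx
  have h1 : ‖l (condMean μ x)‖ₑ ≤ ∫⁻ b, ‖l b‖ₑ ∂μ.condKernel x := by
    rw [condMean, ← l.integral_comp_comm hx]
    exact enorm_integral_le_lintegral_enorm _
  have h2 := eLpNorm'_le_eLpNorm'_of_exponent_le (μ := μ.condKernel x) (f := fun b => l b)
    zero_lt_one hp l.continuous.aestronglyMeasurable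
  simp only [eLpNorm', ENNReal.rpow_one, div_one] at h2
  calc ‖l (condMean μ x)‖ₑ ^ p ≤ ((∫⁻ b, ‖l b‖ₑ ^ p ∂μ.condKernel x) ^ (1 / p)) ^ p :=
        ENNReal.rpow_le_rpow (h1.trans h2) (by linarith)
    _ = ∫⁻ b, ‖l b‖ₑ ^ p ∂μ.condKernel x := by
        rw [← ENNReal.rpow_mul, one_div, inv_mul_cancel₀ (by linarith), ENNReal.rpow_one]

end Disintegration

/-! ### The area formula for Lipschitz graphs -/

/-- The cover is made disjoint, so that the local bounds add up. -/
theorem measure_le_of_countable_cover {X ι : Type*} [MeasurableSpace X] [Countable ι]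
    {ν η : Measure X} {c : ℝ≥0∞} {T : ι → Set X} (hT : ∀ i, MeasurableSet (T i))
    (hcov : ν (⋃ i, T i)ᶜ = 0)
    (h : ∀ i, ∀ S, MeasurableSet S → S ⊆ T i → ν S ≤ c * η S) : ν ≤ c • η := by
  rw [Measure.le_iff]
  intro s hs
  rcases isEmpty_or_nonempty ι with hι | hι
  · have : ν univ = 0 := by simpa using hcov
    rw [measure_mono_null (subset_univ s) this]
    exact zero_le
  obtain ⟨e, he⟩ := exists_surjective_nat ι
  let D : ℕ → Set X := disjointed (fun n => T (e n))
  have hDm : ∀ n, MeasurableSet (D n) := fun n => MeasurableSet.disjointed (fun k => hT (e k)) n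
  have hDd : Pairwise (Function.onFun Disjoint D) := disjoint_disjointed _
  have hDu : ⋃ n, D n = ⋃ i, T i := by
    rw [iUnion_disjointed]
    exact he.iUnion_comp T
  calc ν s ≤ ν ((⋃ n, s ∩ D n) ∪ (⋃ i, T i)ᶜ) := by
        apply measure_mono
        rw [← inter_iUnion, hDu]
        intro x hx
        by_cases hx' : x ∈ ⋃ i, T i
        · exact Or.inl ⟨hx, hx'⟩
        · exact Or.inr hx'
    _ ≤ ν (⋃ n, s ∩ D n) + 0 := by rw [← hcov]; exact measure_union_le _ _
    _ = ∑' n, ν (s ∩ D n) := by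
        rw [add_zero, measure_iUnion (fun i j hij => (hDd hij).mono inter_subset_right
          inter_subset_right) (fun n => hs.inter (hDm n))]
    _ ≤ ∑' n, c * η (s ∩ D n) := ENNReal.tsum_le_tsum fun n =>
        h (e n) _ (hs.inter (hDm n)) (inter_subset_right.trans (disjointed_subset _ n))
    _ = c * η (⋃ n, s ∩ D n) := by
        rw [ENNReal.tsum_mul_left, measure_iUnion (fun i j hij => (hDd hij).mono inter_subset_right
          inter_subset_right) (fun n => hs.inter (hDm n))]
    _ ≤ c * η s := by gcongr; exact iUnion_subset fun n => inter_subset_left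

/-- On `S` the map `f` factors through `g`, since `g x = g y` forces `f x = f y`, and the factor `q`
is `K`-Lipschitz on `g '' S`. This compares two parametrised images without inverting either. -/
theorem euclideanHausdorffMeasure_image_le_of_dist_le {X Y Z : Type*} [Nonempty X]
    [MetricSpace Y] [MeasurableSpace Y] [BorelSpace Y] [MetricSpace Z] [MeasurableSpace Z]
    [BorelSpace Z] {f : X → Y} {g : X → Z} {S : Set X} {K : ℝ≥0} (d : ℕ)
    (h : ∀ x ∈ S, ∀ y ∈ S, dist (f x) (f y) ≤ K * dist (g x) (g y)) :
    Measure.euclideanHausdorffMeasure d (f '' S)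
      ≤ (K : ℝ≥0∞) ^ d * Measure.euclideanHausdorffMeasure d (g '' S) := by
  let q : Z → Y := fun z => f (Function.invFunOn g S z)
  have hinv : ∀ x ∈ S, Function.invFunOn g S (g x) ∈ S ∧ g (Function.invFunOn g S (g x)) = g x :=
    fun x hx => Function.invFunOn_pos ⟨x, hx, rfl⟩
  have hq : ∀ x ∈ S, q (g x) = f x := by
    intro x hx
    obtain ⟨h1, h2⟩ := hinv x hx
    have := h _ h1 _ hx
    rw [h2, dist_self, mul_zero] at this
    exact dist_le_zero.1 this
  have hL : LipschitzOnWith K q (g '' S) := by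
    apply LipschitzOnWith.of_dist_le_mul
    rintro _ ⟨x, hx, rfl⟩ _ ⟨y, hy, rfl⟩
    rw [hq x hx, hq y hy]
    exact h x hx y hy
  have him : q '' (g '' S) = f '' S := by
    rw [image_image]
    exact image_congr hq
  have := hL.hausdorffMeasure_image_le (d := d) (Nat.cast_nonneg d)
  rw [him, ENNReal.rpow_natCast] at this
  simp only [Measure.euclideanHausdorffMeasure_def, Measure.smul_apply, ENNReal.smul_def,
    smul_eq_mul]
  rw [mul_left_comm]
  gcongr

/-- The function `t ↦ √(1 + t²)` is 1-Lipschitz and at least 1, so an additive error `δ` in the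
slope costs a factor `1 + δ` in the area density. -/
theorem sqrt_one_add_sq_le {s t δ : ℝ} (hs : 0 ≤ s) (ht : 0 ≤ t) (hδ : 0 ≤ δ) (h : s ≤ t + δ) :
    √(1 + s ^ 2) ≤ (1 + δ) * √(1 + t ^ 2) := by
  have h1 : 1 ≤ √(1 + t ^ 2) := Real.one_le_sqrt.2 (by nlinarith)
  have h2 : t ≤ √(1 + t ^ 2) := Real.le_sqrt_of_sq_le (by linarith)
  have h3 := Real.sq_sqrt (show 0 ≤ 1 + t ^ 2 by positivity)
  rw [Real.sqrt_le_left (by positivity)]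
  nlinarith [mul_nonneg hδ (sub_nonneg.2 h2), mul_nonneg hδ (sub_nonneg.2 h1),
    mul_nonneg (mul_nonneg hδ hδ) (sub_nonneg.2 h1)]

section Graph

variable {E V : Type*} [NormedAddCommGroup E] [InnerProductSpace ℝ E] [FiniteDimensional ℝ E]
  [MeasurableSpace E] [BorelSpace E]
  [NormedAddCommGroup V] [InnerProductSpace ℝ V] [FiniteDimensional ℝ V]
  [MeasurableSpace V] [BorelSpace V]

/-- The point over `w` of the graph of `γ` in the direction `v`. -/
def graphPoint (ι : E →ₗᵢ[ℝ] V) (v : V) (γ : E → ℝ) (w : E) : V := ι w + γ w • v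

variable {ι : E →ₗᵢ[ℝ] V} {v : V} (hv : ‖v‖ = 1) (hιv : ∀ w, inner ℝ v (ι w) = 0)

omit [FiniteDimensional ℝ E] [MeasurableSpace E] [BorelSpace E] [FiniteDimensional ℝ V]
  [MeasurableSpace V] [BorelSpace V] in
include hv hιv in
theorem inner_add_smul_graph (w w' : E) (t t' : ℝ) :
    inner ℝ (ι w + t • v) (ι w' + t' • v) = inner ℝ w w' + t * t' := by
  have h1 : inner ℝ (ι w) v = 0 := by rw [real_inner_comm]; exact hιv w
  simp [inner_add_left, inner_add_right, inner_smul_left, inner_smul_right, h1, hιv, hv]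
  ring

omit [FiniteDimensional ℝ E] [MeasurableSpace E] [BorelSpace E] [FiniteDimensional ℝ V]
  [MeasurableSpace V] [BorelSpace V] in
include hv hιv in
theorem norm_le_norm_add_smul (w : E) (t : ℝ) : ‖w‖ ≤ ‖ι w + t • v‖ := by
  have := inner_add_smul_graph hv hιv w w t t
  rw [real_inner_self_eq_norm_sq, real_inner_self_eq_norm_sq] at this
  exact le_of_sq_le_sq (by nlinarith) (norm_nonneg _)

omit [MeasurableSpace E] [BorelSpace E] [MeasurableSpace V] [BorelSpace V] in
include hv hιv in
-- With `r` the Riesz vector of `a`, the Gram operator `A* A` is the transvection `x ↦ x + a(x) r`,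
-- whose determinant is `1 + a(r) = 1 + ‖a‖²`.
theorem normDet_graph (a : StrongDual ℝ E) :
    (ι.toLinearMap + (a : E →ₗ[ℝ] ℝ).smulRight v).normDet = √(1 + ‖a‖ ^ 2) := by
  set A := ι.toLinearMap + (a : E →ₗ[ℝ] ℝ).smulRight v with hA
  have : CompleteSpace E := FiniteDimensional.complete ℝ E
  let r : E := (InnerProductSpace.toDual ℝ E).symm a
  have hr : ∀ x, inner ℝ r x = a x := fun x => by simp [r]
  have hAx : ∀ x, A x = ι x + a x • v := fun x => by simp [hA]
  have hadj : A.adjoint ∘ₗ A = LinearMap.transvection (a : E →ₗ[ℝ] ℝ) r := by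
    ext x
    refine ext_inner_right ℝ fun y => ?_
    rw [LinearMap.comp_apply, LinearMap.adjoint_inner_left, hAx, hAx,
      inner_add_smul_graph hv hιv, LinearMap.transvection.apply]
    simp [inner_add_left, inner_smul_left, hr]
  have h1 : A.normDet ^ 2 = 1 + ‖a‖ ^ 2 := by
    have h2 := A.normDet_sq
    rw [hadj, LinearMap.transvection.det] at h2
    have h3 : a r = ‖a‖ ^ 2 := by
      rw [← hr, real_inner_self_eq_norm_sq]
      simp [r]
    simpa [h3] using h2
  rw [← h1, Real.sqrt_sq A.normDet_nonneg]

variable {γ : E → ℝ} {K : ℝ≥0} (hγ : LipschitzWith K γ)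

omit [FiniteDimensional ℝ E] [MeasurableSpace E] [BorelSpace E] [FiniteDimensional ℝ V]
  [MeasurableSpace V] [BorelSpace V] in
include hv hγ in
theorem lipschitzWith_graphPoint : LipschitzWith (1 + K) (graphPoint ι v γ) := by
  apply LipschitzWith.of_dist_le_mul
  intro x y
  have h1 := hγ.dist_le_mul x y
  rw [dist_eq_norm, dist_eq_norm] at *
  have : graphPoint ι v γ x - graphPoint ι v γ y = ι (x - y) + (γ x - γ y) • v := by
    simp only [graphPoint, map_sub, sub_smul]; abel
  rw [this]
  calc ‖ι (x - y) + (γ x - γ y) • v‖ ≤ ‖ι (x - y)‖ + ‖(γ x - γ y) • v‖ := norm_add_le _ _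
    _ = ‖x - y‖ + ‖γ x - γ y‖ := by rw [ι.norm_map, norm_smul, hv, mul_one]
    _ ≤ ‖x - y‖ + K * ‖x - y‖ := by gcongr
    _ = _ := by push_cast; ring

omit [FiniteDimensional ℝ E] [MeasurableSpace E] [BorelSpace E] [FiniteDimensional ℝ V]
  [MeasurableSpace V] [BorelSpace V] in
include hv hιv in
theorem dist_le_dist_graphPoint (x y : E) :
    dist x y ≤ dist (graphPoint ι v γ x) (graphPoint ι v γ y) := by
  rw [dist_eq_norm, dist_eq_norm]
  have : graphPoint ι v γ x - graphPoint ι v γ y = ι (x - y) + (γ x - γ y) • v := by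
    simp only [graphPoint, map_sub, sub_smul]; abel
  rw [this]
  exact norm_le_norm_add_smul hv hιv _ _

omit [MeasurableSpace E] [BorelSpace E] [FiniteDimensional ℝ V] [MeasurableSpace V]
  [BorelSpace V] in
include hv hιv hγ in
theorem isClosedEmbedding_graphPoint : IsClosedEmbedding (graphPoint ι v γ) := by
  have : CompleteSpace E := FiniteDimensional.complete ℝ E
  have : AntilipschitzWith 1 (graphPoint ι v γ) := by
    apply AntilipschitzWith.of_le_mul_dist
    intro x y
    simpa using dist_le_dist_graphPoint hv hιv x y
  exact this.isClosedEmbedding (lipschitzWith_graphPoint hv hγ).uniformContinuous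

include hv hιv in
/-- On a set where `γ` is approximated by the linear form `A` up to `δ`, the measure of the graph
is that of a linear image, up to a factor close to one. -/
theorem euclideanHausdorffMeasure_graph_approx {A : StrongDual ℝ E} {δ : ℝ≥0} {S : Set E}
    (hA : ApproximatesLinearOn γ A S δ) :
    Measure.euclideanHausdorffMeasure (Module.finrank ℝ E) (graphPoint ι v γ '' S)
        ≤ ((1 + δ : ℝ≥0) : ℝ≥0∞) ^ Module.finrank ℝ E
          * (ENNReal.ofReal √(1 + ‖A‖ ^ 2) * volume S) ∧
      ENNReal.ofReal √(1 + ‖A‖ ^ 2) * volume S ≤ ((1 + δ : ℝ≥0) : ℝ≥0∞) ^ Module.finrank ℝ E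
        * Measure.euclideanHausdorffMeasure (Module.finrank ℝ E) (graphPoint ι v γ '' S) := by
  set L := ι.toLinearMap + (A : E →ₗ[ℝ] ℝ).smulRight v with hL
  have hvol : Measure.euclideanHausdorffMeasure (Module.finrank ℝ E) (L '' S)
      = ENNReal.ofReal √(1 + ‖A‖ ^ 2) * volume S := by
    rw [L.euclideanHausdorffMeasure_image_eq_normDet_mul_volume, hL, normDet_graph hv hιv]
  rw [← hvol]
  have hLx : ∀ x y, L x - L y = ι (x - y) + A (x - y) • v := fun x y => by
    rw [← map_sub]; simp [hL]
  have hG : ∀ x y, graphPoint ι v γ x - graphPoint ι v γ y = ι (x - y) + (γ x - γ y) • v := by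
    intro x y
    simp only [graphPoint, map_sub, sub_smul]; abel
  have hdiff : ∀ x ∈ S, ∀ y ∈ S, ‖(graphPoint ι v γ x - graphPoint ι v γ y) - (L x - L y)‖
      ≤ δ * ‖x - y‖ := by
    intro x hx y hy
    rw [hG, hLx, add_sub_add_left_eq_sub, ← sub_smul, norm_smul, hv, mul_one]
    exact hA x hx y hy
  constructor
  · refine euclideanHausdorffMeasure_image_le_of_dist_le _ fun x hx y hy => ?_
    rw [dist_eq_norm, dist_eq_norm]
    -- Neither the graph map nor its linear model shrinks distances, so the error `δ ‖x - y‖` is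
    -- relative to either image distance.
    have h1 : ‖x - y‖ ≤ ‖L x - L y‖ := by rw [hLx]; exact norm_le_norm_add_smul hv hιv _ _
    have h2 := hdiff x hx y hy
    have h3 := norm_le_norm_add_norm_sub (L x - L y) (graphPoint ι v γ x - graphPoint ι v γ y)
    rw [norm_sub_rev] at h2
    push_cast
    nlinarith [mul_le_mul_of_nonneg_left h1 δ.2, norm_sub_rev (L x - L y)
      (graphPoint ι v γ x - graphPoint ι v γ y)]
  · refine euclideanHausdorffMeasure_image_le_of_dist_le _ fun x hx y hy => ?_
    rw [dist_eq_norm, dist_eq_norm]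
    have h1 : ‖x - y‖ ≤ ‖graphPoint ι v γ x - graphPoint ι v γ y‖ := by
      rw [hG]; exact norm_le_norm_add_smul hv hιv _ _
    have h2 := hdiff x hx y hy
    have h3 := norm_le_norm_add_norm_sub (graphPoint ι v γ x - graphPoint ι v γ y) (L x - L y)
    push_cast
    nlinarith [mul_le_mul_of_nonneg_left h1 δ.2, norm_sub_rev (L x - L y)
      (graphPoint ι v γ x - graphPoint ι v γ y)]

/-- Two approximations must hold with the same `A`: of `γ`, to compare Hausdorff measures, and of
its derivative, to compare densities. The points of differentiability are therefore first sorted by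
the position of the derivative. -/
theorem exists_cover_approximatesLinearOn (γ : E → ℝ) {δ : ℝ≥0} (hδ : 0 < δ) :
    ∃ T : ℕ × ℕ → Set E, (∀ i, MeasurableSet (T i)) ∧ (⋃ i, T i) = {w | DifferentiableAt ℝ γ w} ∧
      ∀ i, (T i).Nonempty → ∃ A : StrongDual ℝ E, ApproximatesLinearOn γ A (T i) δ ∧
        ∀ w ∈ T i, dist (fderiv ℝ γ w) A ≤ δ := by
  have : CompleteSpace E := FiniteDimensional.complete ℝ E
  have : ProperSpace (StrongDual ℝ E) := FiniteDimensional.proper ℝ _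
  let a := TopologicalSpace.denseSeq (StrongDual ℝ E)
  -- Radius `δ / 2`: any two derivatives in the same piece are then within `δ`.
  let s : ℕ → Set E := fun m =>
    {w | DifferentiableAt ℝ γ w} ∩ {w | dist (fderiv ℝ γ w) (a m) < δ / 2}
  have hsm : ∀ m, MeasurableSet (s m) := fun m =>
    (measurableSet_of_differentiableAt ℝ γ).inter
      (measurableSet_lt ((measurable_fderiv ℝ γ).dist measurable_const) measurable_const)
  have hex : ∀ m, ∃ (t : ℕ → Set E) (A : ℕ → E →L[ℝ] ℝ), (∀ n, IsClosed (t n)) ∧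
      (s m ⊆ ⋃ n, t n) ∧ (∀ n, ApproximatesLinearOn γ (A n) (s m ∩ t n) δ) ∧
      ((s m).Nonempty → ∀ n, ∃ y ∈ s m, A n = fderiv ℝ γ y) := fun m =>
    exists_closed_cover_approximatesLinearOn_of_hasFDerivWithinAt γ (s m) (fderiv ℝ γ)
      (fun x hx => hx.1.hasFDerivAt.hasFDerivWithinAt) (fun _ => δ) (fun _ => hδ.ne')
  choose t A htc hcov hA hy using hex
  refine ⟨fun i => s i.1 ∩ t i.1 i.2, fun i => (hsm _).inter (htc _ _).measurableSet, ?_, ?_⟩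
  · apply Subset.antisymm
    · exact iUnion_subset fun i x hx => hx.1.1
    · intro x hx
      obtain ⟨m, hm⟩ := (TopologicalSpace.denseRange_denseSeq (StrongDual ℝ E)).exists_dist_lt
        (fderiv ℝ γ x) (show (0 : ℝ) < δ / 2 by positivity)
      have hxs : x ∈ s m := ⟨hx, hm⟩
      obtain ⟨n, hn⟩ := mem_iUnion.1 (hcov m hxs)
      exact mem_iUnion.2 ⟨(m, n), hxs, hn⟩
  · rintro ⟨m, n⟩ ⟨x, hx⟩
    refine ⟨A m n, hA m n, fun w hw => ?_⟩
    obtain ⟨y, hys, hyA⟩ := hy m ⟨x, hx.1⟩ n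
    rw [hyA]
    have h1 : dist (fderiv ℝ γ w) (a m) < δ / 2 := hw.1.2
    have h2 : dist (fderiv ℝ γ y) (a m) < δ / 2 := hys.2
    linarith [dist_triangle_right (fderiv ℝ γ w) (fderiv ℝ γ y) (a m)]

theorem le_of_forall_le_one_add_pow_smul {X : Type*} [MeasurableSpace X] {ν η : Measure X} (d : ℕ)
    (h : ∀ δ : ℝ≥0, 0 < δ → ν ≤ (((1 + δ : ℝ≥0) : ℝ≥0∞) ^ d) • η) : ν ≤ η := by
  rw [Measure.le_iff]
  intro s _
  have hlim : Tendsto (fun δ : ℝ≥0 => (((1 + δ : ℝ≥0) : ℝ≥0∞) ^ d) * η s) (𝓝[>] 0)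
      (𝓝 ((((1 + 0 : ℝ≥0) : ℝ≥0∞) ^ d) * η s)) := by
    refine (ENNReal.Tendsto.mul_const ?_ (Or.inl (by simp))).mono_left nhdsWithin_le_nhds
    have hc : Continuous fun δ : ℝ≥0 => (((1 + δ) ^ d : ℝ≥0) : ℝ≥0∞) := by fun_prop
    simpa [ENNReal.coe_pow] using hc.tendsto 0
  rw [add_zero, ENNReal.coe_one, one_pow, one_mul] at hlim
  refine ge_of_tendsto hlim ?_
  filter_upwards [self_mem_nhdsWithin] with δ hδ
  exact Measure.le_iff'.1 (h δ hδ) s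

include hv hιv hγ in
/-- The area formula for the graph of a Lipschitz function. -/
theorem comap_graphPoint_euclideanHausdorffMeasure :
    (Measure.euclideanHausdorffMeasure (Module.finrank ℝ E)).comap (graphPoint ι v γ)
      = volume.withDensity fun w => ENNReal.ofReal √(1 + ‖fderiv ℝ γ w‖ ^ 2) := by
  have : CompleteSpace E := FiniteDimensional.complete ℝ E
  have hemb := (isClosedEmbedding_graphPoint hv hιv hγ).measurableEmbedding
  set ν := (Measure.euclideanHausdorffMeasure (Module.finrank ℝ E)).comap (graphPoint ι v γ)
    with hνdef
  set η := (volume : Measure E).withDensity fun w => ENNReal.ofReal √(1 + ‖fderiv ℝ γ w‖ ^ 2)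
    with hηdef
  set d := Module.finrank ℝ E with hd
  have hν : ∀ s, ν s = Measure.euclideanHausdorffMeasure d (graphPoint ι v γ '' s) :=
    fun s => hemb.comap_apply _ s
  have hD : (volume : Measure E) {w | DifferentiableAt ℝ γ w}ᶜ = 0 := hγ.ae_differentiableAt
  have hηD : η {w | DifferentiableAt ℝ γ w}ᶜ = 0 := withDensity_absolutelyContinuous _ _ hD
  -- By Rademacher the exceptional set is null, and so is its Lipschitz image.
  have hνD : ν {w | DifferentiableAt ℝ γ w}ᶜ = 0 := by
    rw [hν]
    have h1 := euclideanHausdorffMeasure_image_le_of_dist_le (f := graphPoint ι v γ)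
      (g := (id : E → E)) (S := {w | DifferentiableAt ℝ γ w}ᶜ) (K := 1 + K) d
      (fun x _ y _ => (lipschitzWith_graphPoint hv hγ).dist_le_mul x y)
    rw [image_id, hd, InnerProductSpace.euclideanHausdorffMeasure_eq_volume, hD, mul_zero] at h1
    exact le_antisymm h1 zero_le
  -- The power `d` comes from the comparison of Hausdorff measures, the additional factor from the
  -- comparison of densities.
  have key : ∀ δ : ℝ≥0, 0 < δ → ν ≤ (((1 + δ : ℝ≥0) : ℝ≥0∞) ^ (d + 1)) • η ∧
      η ≤ (((1 + δ : ℝ≥0) : ℝ≥0∞) ^ (d + 1)) • ν := by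
    intro δ hδ
    obtain ⟨T, hTm, hTu, hT⟩ := exists_cover_approximatesLinearOn γ hδ
    have hJ : ∀ i S, MeasurableSet S → S ⊆ T i →
        ν S ≤ (((1 + δ : ℝ≥0) : ℝ≥0∞) ^ (d + 1)) * η S ∧
        η S ≤ (((1 + δ : ℝ≥0) : ℝ≥0∞) ^ (d + 1)) * ν S := by
      intro i S hS hST
      rcases (T i).eq_empty_or_nonempty with he | hne
      · have : S = ∅ := subset_empty_iff.1 (he ▸ hST)
        simp [this]
      obtain ⟨A, hA, hAd⟩ := hT i hne
      obtain ⟨h1, h2⟩ := euclideanHausdorffMeasure_graph_approx hv hιv (hA.mono_set hST)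
      rw [← hd, ← hν] at h1 h2
      have hc : ((1 + δ : ℝ≥0) : ℝ≥0∞) = ENNReal.ofReal (1 + δ) := by
        rw [← ENNReal.ofReal_coe_nnreal]; push_cast; rfl
      have hup : ENNReal.ofReal √(1 + ‖A‖ ^ 2) * volume S ≤ ((1 + δ : ℝ≥0) : ℝ≥0∞) * η S := by
        rw [hηdef, withDensity_apply _ hS, ← lintegral_const_mul' _ _ ENNReal.coe_ne_top,
          ← setLIntegral_const]
        refine setLIntegral_mono' hS fun w hw => ?_
        rw [hc, ← ENNReal.ofReal_mul (by positivity)]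
        refine ENNReal.ofReal_le_ofReal (sqrt_one_add_sq_le (norm_nonneg _) (norm_nonneg _) δ.2 ?_)
        have := hAd w (hST hw)
        rw [dist_comm, dist_eq_norm] at this
        exact (norm_le_norm_add_norm_sub' _ _).trans (add_le_add le_rfl this)
      have hlow : η S ≤ ((1 + δ : ℝ≥0) : ℝ≥0∞) * (ENNReal.ofReal √(1 + ‖A‖ ^ 2) * volume S) := by
        rw [hηdef, withDensity_apply _ hS, ← mul_assoc, ← setLIntegral_const]
        refine setLIntegral_mono' hS fun w hw => ?_
        rw [hc, ← ENNReal.ofReal_mul (by positivity)]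
        refine ENNReal.ofReal_le_ofReal (sqrt_one_add_sq_le (norm_nonneg _) (norm_nonneg _) δ.2 ?_)
        have := hAd w (hST hw)
        rw [dist_eq_norm] at this
        exact (norm_le_norm_add_norm_sub' _ _).trans (add_le_add le_rfl this)
      constructor
      · calc ν S ≤ _ := h1
          _ ≤ ((1 + δ : ℝ≥0) : ℝ≥0∞) ^ d * (((1 + δ : ℝ≥0) : ℝ≥0∞) * η S) := by gcongr
          _ = _ := by rw [pow_succ, mul_assoc]
      · calc η S ≤ _ := hlow
          _ ≤ ((1 + δ : ℝ≥0) : ℝ≥0∞) * (((1 + δ : ℝ≥0) : ℝ≥0∞) ^ d * ν S) := by gcongr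
          _ = _ := by rw [pow_succ', mul_assoc]
    exact ⟨measure_le_of_countable_cover hTm (by rw [hTu]; exact hνD) fun i S hS hST =>
        (hJ i S hS hST).1,
      measure_le_of_countable_cover hTm (by rw [hTu]; exact hηD) fun i S hS hST =>
        (hJ i S hS hST).2⟩
  exact le_antisymm (le_of_forall_le_one_add_pow_smul _ fun δ hδ => (key δ hδ).1)
    (le_of_forall_le_one_add_pow_smul _ fun δ hδ => (key δ hδ).2)

end Graph

/-! ### The divergence theorem under a Lipschitz graph -/

section Graph

variable {E V : Type*} [NormedAddCommGroup E] [InnerProductSpace ℝ E] [FiniteDimensional ℝ E]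
  [MeasurableSpace E] [BorelSpace E]
  [NormedAddCommGroup V] [InnerProductSpace ℝ V] [FiniteDimensional ℝ V]
  [MeasurableSpace V] [BorelSpace V]
variable {ι : E →ₗᵢ[ℝ] V} {v : V} (hv : ‖v‖ = 1) (hιv : ∀ w, inner ℝ v (ι w) = 0)
  (hdim : Module.finrank ℝ V = Module.finrank ℝ E + 1)

/-- The isometry `(w, t) ↦ ι w + t v`. -/
noncomputable def graphIsometry (ι : E →ₗᵢ[ℝ] V) {v : V} (hv : ‖v‖ = 1)
    (hιv : ∀ w, inner ℝ v (ι w) = 0) : WithLp 2 (E × ℝ) →ₗᵢ[ℝ] V where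
  toFun q := ι q.fst + q.snd • v
  map_add' q q' := by simp [add_smul]; abel
  map_smul' c q := by simp [mul_smul]
  norm_map' q := by
    change ‖ι q.fst + q.snd • v‖ = ‖q‖
    have h1 := inner_add_smul_graph hv hιv q.fst q.fst q.snd q.snd
    rw [real_inner_self_eq_norm_sq, real_inner_self_eq_norm_sq] at h1
    have h2 := WithLp.prod_norm_sq_eq_of_L2 q
    rw [← sq_eq_sq₀ (norm_nonneg _) (norm_nonneg _), h1, h2, Real.norm_eq_abs, sq_abs]
    ring

include hv hιv hdim

theorem measurePreserving_add_smul :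
    MeasurePreserving (fun q : E × ℝ => ι q.1 + q.2 • v) (volume.prod volume) volume := by
  have hd : Module.finrank ℝ (WithLp 2 (E × ℝ)) = Module.finrank ℝ V := by
    rw [(WithLp.linearEquiv 2 ℝ (E × ℝ)).finrank_eq, hdim]
    simp
  have h1 := ((graphIsometry ι hv hιv).toLinearIsometryEquiv hd).measurePreserving
  exact h1.comp (WithLp.volume_preserving_toLp E ℝ)

omit [MeasurableSpace E] [BorelSpace E] [MeasurableSpace V] [BorelSpace V] in
theorem exists_eq_add_smul (x : V) : ∃ (w : E) (t : ℝ), x = ι w + t • v := by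
  have hd : Module.finrank ℝ (WithLp 2 (E × ℝ)) = Module.finrank ℝ V := by
    rw [(WithLp.linearEquiv 2 ℝ (E × ℝ)).finrank_eq, hdim]
    simp
  obtain ⟨q, hq⟩ := ((graphIsometry ι hv hιv).toLinearIsometryEquiv hd).surjective x
  exact ⟨q.fst, q.snd, hq.symm⟩

variable {γ : E → ℝ} {K : ℝ≥0} (hγ : LipschitzWith K γ)

include hγ in
-- The shear `(w, t) ↦ (w, γ w + t)` preserves volume, and so does the isometry `(w, t) ↦ ι w + t
-- v`. It straightens the region below the graph to `t < 0`, although `γ` is only Lipschitz.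
theorem measurePreserving_graphPoint_add_smul :
    MeasurePreserving (fun q : E × ℝ => graphPoint ι v γ q.1 + q.2 • v) (volume.prod volume)
      volume := by
  have h1 : MeasurePreserving (fun q : E × ℝ => (q.1, γ q.1 + q.2)) (volume.prod volume)
      (volume.prod volume) := by
    refine MeasurePreserving.skew_product (g := fun w t => γ w + t)
      (MeasurePreserving.id _) ?_ ?_
    · exact ((hγ.continuous.comp continuous_fst).add continuous_snd).measurable
    · exact Eventually.of_forall fun w => (measurePreserving_add_left volume (γ w)).map_eq
  have h2 := (measurePreserving_add_smul hv hιv hdim).comp h1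
  convert h2 using 1
  ext q
  simp [graphPoint, add_smul, add_assoc]

omit hdim [FiniteDimensional ℝ V] [MeasurableSpace V] [BorelSpace V] in
include hγ in
-- By Rademacher and the chain rule the integrand is a.e. the derivative in direction `e` of a
-- compactly supported Lipschitz function on `E`, and such derivatives integrate to zero.
theorem integral_fderiv_graphPoint_add_smul {φ : V → ℝ} (hφ : ContDiff ℝ 1 φ)
    (hφc : HasCompactSupport φ) (e : E) (t : ℝ) :
    ∫ w, fderiv ℝ φ (graphPoint ι v γ w + t • v) (ι e + fderiv ℝ γ w e • v) = 0 := by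
  set f : E → ℝ := fun w => φ (graphPoint ι v γ w + t • v) with hf
  obtain ⟨D, hD⟩ := ContDiff.lipschitzWith_of_hasCompactSupport hφc hφ one_ne_zero
  have hfL : LipschitzWith (D * ((1 + K) + 0)) f :=
    hD.comp ((lipschitzWith_graphPoint hv hγ).add (LipschitzWith.const (t • v)))
  have hfc : HasCompactSupport f := by
    have := (Homeomorph.addRight (t • v)).isClosedEmbedding.comp
      (isClosedEmbedding_graphPoint hv hιv hγ)
    exact hφc.comp_isClosedEmbedding this
  have h0 : ∫ w, lineDeriv ℝ f w e = 0 := by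
    have h1 := LipschitzWith.integral_lineDeriv_mul_eq (μ := (volume : Measure E))
      (LipschitzWith.const (1 : ℝ)) hfL hfc (-e)
    simpa [lineDeriv] using h1.symm
  rw [← h0]
  refine integral_congr_ae ?_
  filter_upwards [hγ.ae_differentiableAt (μ := (volume : Measure E))] with w hw
  have h1 : HasFDerivAt (fun w => graphPoint ι v γ w + t • v)
      (ι.toContinuousLinearMap + (fderiv ℝ γ w).smulRight v) w :=
    (ι.toContinuousLinearMap.hasFDerivAt.add (hw.hasFDerivAt.smul_const v)).add_const _
  have h2 := ((hφ.differentiable one_ne_zero _).hasFDerivAt.comp w h1).hasLineDerivAt e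
  refine Eq.trans ?_ h2.lineDeriv.symm
  simp

include hγ in
theorem setIntegral_hypograph_eq {U : Set V} (hU : MeasurableSet U)
    (hUγ : ∀ w (t : ℝ), graphPoint ι v γ w + t • v ∈ U ↔ t < 0) {F : V → ℝ} (hF : Integrable F) :
    Integrable (fun q : E × ℝ => F (graphPoint ι v γ q.1 + q.2 • v))
        ((volume : Measure E).prod (volume.restrict (Iio 0))) ∧
      ∫ x in U, F x = ∫ q, F (graphPoint ι v γ q.1 + q.2 • v)
        ∂((volume : Measure E).prod (volume.restrict (Iio (0 : ℝ)))) := by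
  have hΨ := measurePreserving_graphPoint_add_smul hv hιv hdim hγ
  have hprod : (volume : Measure E).prod (volume.restrict (Iio (0 : ℝ)))
      = (volume.prod volume).restrict (univ ×ˢ Iio (0 : ℝ)) := by
    rw [← Measure.prod_restrict, Measure.restrict_univ]
  have hpre : (fun q : E × ℝ => graphPoint ι v γ q.1 + q.2 • v) ⁻¹' U = univ ×ˢ Iio (0 : ℝ) := by
    ext q
    simp [hUγ]
  have hΨU := hΨ.restrict_preimage hU
  rw [hpre, ← hprod] at hΨU
  refine ⟨hΨU.integrable_comp_of_integrable hF.restrict, ?_⟩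
  rw [← hΨU.map_eq, integral_map hΨU.aemeasurable]
  rw [hΨU.map_eq]
  exact hF.aestronglyMeasurable.restrict

include hγ in
/-- The divergence theorem on the region below a Lipschitz graph. -/
theorem setIntegral_hypograph_fderiv {U : Set V} (hU : MeasurableSet U)
    (hUγ : ∀ w (t : ℝ), graphPoint ι v γ w + t • v ∈ U ↔ t < 0) {φ : V → ℝ} (hφ : ContDiff ℝ 1 φ)
    (hφc : HasCompactSupport φ) (e : E) (c : ℝ) :
    ∫ x in U, fderiv ℝ φ x (ι e + c • v)
      = ∫ w, (c - fderiv ℝ γ w e) * φ (graphPoint ι v γ w) := by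
  have hcont : ∀ u, Continuous fun x => fderiv ℝ φ x u := fun u =>
    (hφ.continuous_fderiv one_ne_zero).clm_apply continuous_const
  have hint : ∀ u, Integrable (fun x => fderiv ℝ φ x u) := fun u =>
    (hcont u).integrable_of_hasCompactSupport (hφc.fderiv_apply (𝕜 := ℝ) u)
  obtain ⟨hIv, hUv⟩ := setIntegral_hypograph_eq hv hιv hdim hγ hU hUγ (hint v)
  obtain ⟨hIe, hUe⟩ := setIntegral_hypograph_eq hv hιv hdim hγ hU hUγ (hint (ι e))
  have hclosed : ∀ w, IsClosedEmbedding fun t : ℝ => graphPoint ι v γ w + t • v := by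
    intro w
    have hv0 : v ≠ 0 := by rintro rfl; simp at hv
    exact (Homeomorph.addLeft (graphPoint ι v γ w)).isClosedEmbedding.comp
      (isClosedEmbedding_smul_left hv0)
  -- The fundamental theorem of calculus on each vertical half line.
  have hline : ∀ w, ∫ t in Iio (0 : ℝ), fderiv ℝ φ (graphPoint ι v γ w + t • v) v
      = φ (graphPoint ι v γ w) := by
    intro w
    set g : ℝ → ℝ := fun t => φ (graphPoint ι v γ w + t • v) with hg
    have hgd : ∀ t, HasDerivAt g (fderiv ℝ φ (graphPoint ι v γ w + t • v) v) t := by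
      intro t
      have h1 : HasDerivAt (fun t : ℝ => graphPoint ι v γ w + t • v) v t := by
        simpa using ((hasDerivAt_id t).smul_const v).const_add (graphPoint ι v γ w)
      exact (hφ.differentiable one_ne_zero _).hasFDerivAt.comp_hasDerivAt t h1
    have hg1 : ContDiff ℝ 1 g := hφ.comp (by fun_prop)
    have hgc : HasCompactSupport g := hφc.comp_isClosedEmbedding (hclosed w)
    have h2 := hgc.integral_Iic_deriv_eq hg1 0
    rw [← integral_Iic_eq_integral_Iio]
    simp only [fun t => ((hgd t).deriv).symm, h2]
    simp [hg]
  have hdγ : ∀ w, ‖fderiv ℝ γ w e‖ ≤ K * ‖e‖ := fun w =>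
    ((fderiv ℝ γ w).le_opNorm e).trans (by gcongr; exact norm_fderiv_le_of_lipschitz ℝ hγ)
  have hmγ : Measurable fun w => fderiv ℝ γ w e := measurable_fderiv_apply_const ℝ γ e
  have hIγ : Integrable (fun q : E × ℝ =>
      fderiv ℝ γ q.1 e * fderiv ℝ φ (graphPoint ι v γ q.1 + q.2 • v) v)
      ((volume : Measure E).prod (volume.restrict (Iio 0))) :=
    hIv.bdd_mul (hmγ.comp measurable_fst).aestronglyMeasurable
      (Eventually.of_forall fun q => hdγ q.1)
  -- Integrated first along the translated graphs `t = const`, tangential derivatives vanish. This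
  -- trades the derivative along `ι e` for `-fderiv ℝ γ w e` times the vertical derivative.
  have hzero : ∫ q : E × ℝ, (fderiv ℝ φ (graphPoint ι v γ q.1 + q.2 • v) (ι e)
      + fderiv ℝ γ q.1 e * fderiv ℝ φ (graphPoint ι v γ q.1 + q.2 • v) v)
      ∂((volume : Measure E).prod (volume.restrict (Iio (0 : ℝ)))) = 0 := by
    refine (integral_prod_symm _ (hIe.add hIγ)).trans ?_
    refine integral_eq_zero_of_ae (Eventually.of_forall fun t => ?_)
    simpa using integral_fderiv_graphPoint_add_smul hv hιv hγ hφ hφc e t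
  rw [integral_add hIe hIγ] at hzero
  have h3 : ∫ q : E × ℝ, fderiv ℝ γ q.1 e * fderiv ℝ φ (graphPoint ι v γ q.1 + q.2 • v) v
      ∂((volume : Measure E).prod (volume.restrict (Iio (0 : ℝ))))
      = ∫ w, fderiv ℝ γ w e * φ (graphPoint ι v γ w) := by
    rw [integral_prod _ hIγ]
    refine integral_congr_ae (Eventually.of_forall fun w => ?_)
    simp only [integral_const_mul, hline]
  have h4 : ∫ q : E × ℝ, fderiv ℝ φ (graphPoint ι v γ q.1 + q.2 • v) v
      ∂((volume : Measure E).prod (volume.restrict (Iio (0 : ℝ))))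
      = ∫ w, φ (graphPoint ι v γ w) := by
    rw [integral_prod _ hIv]
    exact integral_congr_ae (Eventually.of_forall hline)
  have hφG : Integrable fun w => φ (graphPoint ι v γ w) :=
    (hφ.continuous.comp (isClosedEmbedding_graphPoint hv hιv hγ).continuous
      ).integrable_of_hasCompactSupport
      (hφc.comp_isClosedEmbedding (isClosedEmbedding_graphPoint hv hιv hγ))
  have hφγ : Integrable fun w => fderiv ℝ γ w e * φ (graphPoint ι v γ w) :=
    hφG.bdd_mul hmγ.aestronglyMeasurable (Eventually.of_forall hdγ)
  simp only [map_add, map_smul, smul_eq_mul]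
  rw [integral_add (hint _).restrict ((hint _).restrict.const_mul c), integral_const_mul, hUe, hUv,
    h4]
  simp only [sub_mul]
  rw [integral_sub (hφG.const_mul c) hφγ, integral_const_mul, ← h3]
  linarith

end Graph

/-! ### Exterior normals -/

/-- For two different normals, a small step in the direction `d = ν' - ν` enters `Ω` according to
`ν` and leaves it according to `ν'`. -/
theorem IsOuterNormal.unique {n : ℕ} {Ω : Set (Vec n)} {x ν ν' : Vec n}
    (h : IsOuterNormal Ω x ν) (h' : IsOuterNormal Ω x ν') : ν = ν' := by
  by_contra hne
  have hlt : inner ℝ ν ν' < 1 := (inner_lt_one_iff_real_of_norm_eq_one h.1 h'.1).2 hne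
  set d : Vec n := ν' - ν with hd
  have hd1 : inner ℝ d ν = inner ℝ ν ν' - 1 := by
    rw [hd, inner_sub_left, real_inner_self_eq_norm_sq, h.1, real_inner_comm]; ring
  have hd2 : inner ℝ d ν' = 1 - inner ℝ ν ν' := by
    rw [hd, inner_sub_left, real_inner_self_eq_norm_sq, h'.1]; ring
  have hd0 : 0 < ‖d‖ := norm_pos_iff.2 (sub_ne_zero.2 (Ne.symm hne))
  -- Chosen such that `ε ‖d‖` is half of `⟪d, ν'⟫ = -⟪d, ν⟫`.
  set ε := (1 - inner ℝ ν ν') / (2 * ‖d‖) with hε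
  have hε0 : 0 < ε := div_pos (by linarith) (by linarith)
  have hεd : ε * ‖d‖ = (1 - inner ℝ ν ν') / 2 := by
    rw [hε]; field_simp
  have hlim : Tendsto (fun t : ℝ => x + t • d) (𝓝[>] 0) (𝓝 x) := by
    have : Continuous fun t : ℝ => x + t • d := by fun_prop
    simpa using (this.tendsto 0).mono_left nhdsWithin_le_nhds
  obtain ⟨t, ⟨h1, h2⟩, ht⟩ := (((hlim.eventually (h.2 ε hε0)).and
    (hlim.eventually (h'.2 ε hε0))).and self_mem_nhdsWithin).exists
  have ht : 0 < t := ht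
  have h1 := h1.1
  have h2 := h2.2
  simp only [add_sub_cancel_left, inner_smul_left, norm_smul, Real.norm_eq_abs, abs_of_pos ht,
    hd1, hd2, RCLike.conj_to_real] at h1 h2
  refine h2 (by nlinarith) (h1 (by nlinarith))

theorem IsOuterNormal.outerNormal_eq {n : ℕ} {Ω : Set (Vec n)} {x ν : Vec n}
    (h : IsOuterNormal Ω x ν) : outerNormal Ω x = ν := by
  have hex : HasOuterNormal Ω x := ⟨ν, h⟩
  rw [outerNormal, dif_pos hex]
  exact hex.choose_spec.unique h

theorem HasOuterNormal.isOuterNormal {n : ℕ} {Ω : Set (Vec n)} {x : Vec n}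
    (h : HasOuterNormal Ω x) : IsOuterNormal Ω x (outerNormal Ω x) := by
  obtain ⟨ν, hν⟩ := h
  rwa [hν.outerNormal_eq]

theorem norm_outerNormal_le {n : ℕ} (Ω : Set (Vec n)) (x : Vec n) : ‖outerNormal Ω x‖ ≤ 1 := by
  by_cases h : HasOuterNormal Ω x
  · exact h.isOuterNormal.1.le
  · simp [outerNormal, h]

/-- Outside a thin double cone about the tangent plane, the linear term decides the sign of `f`. -/
theorem isOuterNormal_of_hasFDerivAt {n : ℕ} {Ω : Set (Vec n)} {f : Vec n → ℝ} {x N : Vec n}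
    (hf : HasFDerivAt f (innerSL ℝ N) x) (hx : f x = 0) (hN : N ≠ 0)
    (hΩ : ∀ᶠ y in 𝓝 x, (y ∈ Ω ↔ f y < 0)) : IsOuterNormal Ω x (‖N‖⁻¹ • N) := by
  have hN0 : 0 < ‖N‖ := norm_pos_iff.2 hN
  refine ⟨by rw [norm_smul, norm_inv, norm_norm, inv_mul_cancel₀ hN0.ne'], fun ε hε => ?_⟩
  have hc : 0 < ε * ‖N‖ := mul_pos hε hN0
  filter_upwards [hΩ, hf.isLittleO.def hc] with y hy hlo
  rw [hx, sub_zero, innerSL_apply_apply, Real.norm_eq_abs, abs_le] at hlo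
  have hinner : inner ℝ (y - x) (‖N‖⁻¹ • N) = ‖N‖⁻¹ * inner ℝ N (y - x) := by
    rw [inner_smul_right, real_inner_comm]
  have hmul : ‖N‖ * (‖N‖⁻¹ * inner ℝ N (y - x)) = inner ℝ N (y - x) := by
    rw [← mul_assoc, mul_inv_cancel₀ hN0.ne', one_mul]
  rw [hinner]
  constructor
  · intro h
    rw [hy]
    have := mul_lt_mul_of_pos_left h hN0
    rw [hmul] at this
    nlinarith [hlo.2]
  · intro h
    rw [hy, not_lt]
    have := mul_lt_mul_of_pos_left h hN0
    rw [hmul] at this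
    nlinarith [hlo.1]

/-! ### The boundary in a chart -/

section Chart

variable {n : ℕ} {Ω : Set (Vec n)} {E : Type*} [NormedAddCommGroup E] [InnerProductSpace ℝ E]
  [FiniteDimensional ℝ E] [MeasurableSpace E] [BorelSpace E] {ι : E →ₗᵢ[ℝ] Vec n} {v : Vec n}
  (hv : ‖v‖ = 1) (hιv : ∀ w, inner ℝ v (ι w) = 0) (hdim : n = Module.finrank ℝ E + 1)
  {γ : Vec n → ℝ} {K : ℝ≥0} (hγ : LipschitzWith K γ)
  (hinv : ∀ (x : Vec n) (t : ℝ), γ (x + t • v) = γ x) {x₀ : Vec n} {r : ℝ}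
  (hΩ : ∀ x ∈ Metric.ball x₀ r, x ∈ Ω ↔ inner ℝ v x < γ x)

local notation "𝔤" => graphPoint ι v (γ ∘ ι)

omit [FiniteDimensional ℝ E] [MeasurableSpace E] [BorelSpace E] in
include hinv in
theorem apply_graphPoint_add_smul (w : E) (t : ℝ) : γ (𝔤 w + t • v) = γ (ι w) := by
  rw [hinv, graphPoint, hinv]

omit [FiniteDimensional ℝ E] [MeasurableSpace E] [BorelSpace E] in
include hv hιv in
theorem inner_graphPoint_add_smul (w : E) (t : ℝ) :
    inner ℝ v (𝔤 w + t • v) = γ (ι w) + t := by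
  simp [graphPoint, inner_add_right, inner_smul_right, hιv, hv]

omit [MeasurableSpace E] [BorelSpace E] in
include hv hιv hdim hinv in
theorem mem_range_graphPoint_iff (x : Vec n) : x ∈ range 𝔤 ↔ inner ℝ v x = γ x := by
  constructor
  · rintro ⟨w, rfl⟩
    have h1 := inner_graphPoint_add_smul hv hιv (γ := γ) w 0
    have h2 := apply_graphPoint_add_smul (ι := ι) hinv w 0
    rw [zero_smul, add_zero] at h1 h2
    rw [h1, h2, add_zero]
  · intro h
    obtain ⟨w, t, rfl⟩ := exists_eq_add_smul hv hιv (by simpa using hdim) x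
    refine ⟨w, ?_⟩
    have h3 : inner ℝ v (ι w + t • v) = t := by
      simp [inner_add_right, inner_smul_right, hιv, hv]
    rw [h3, hinv] at h
    rw [graphPoint, Function.comp_apply, ← h]

include hv hγ hinv hΩ in
theorem mem_frontier_iff_of_chart {x : Vec n} (hx : x ∈ Metric.ball x₀ r) :
    x ∈ frontier Ω ↔ inner ℝ v x = γ x := by
  have hnhds : ∀ᶠ y in 𝓝 x, (y ∈ Ω ↔ inner ℝ v y < γ y) :=
    eventually_of_mem (Metric.isOpen_ball.mem_nhds hx) hΩ
  have hcv : Continuous fun y : Vec n => inner ℝ v y := by fun_prop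
  constructor
  · intro hf
    by_contra hne
    rcases lt_or_gt_of_ne hne with hlt | hgt
    · apply hf.2
      rw [mem_interior_iff_mem_nhds]
      filter_upwards [hnhds, hcv.continuousAt.eventually_lt hγ.continuous.continuousAt hlt]
        with y hy hy' using hy.2 hy'
    · have : ∀ᶠ y in 𝓝 x, y ∉ Ω := by
        filter_upwards [hnhds, hγ.continuous.continuousAt.eventually_lt hcv.continuousAt hgt]
          with y hy hy' h using (hy.1 h).not_gt hy'
      obtain ⟨y, hy, hy'⟩ := ((mem_closure_iff_frequently.1 hf.1).and_eventually this).exists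
      exact hy' hy
  · intro heq
    have hx' : x ∉ Ω := fun h => ((hΩ x hx).1 h).ne heq
    refine ⟨?_, fun h => hx' (interior_subset h)⟩
    have hlim : Tendsto (fun t : ℝ => x + t • v) (𝓝[<] 0) (𝓝 x) := by
      have : Continuous fun t : ℝ => x + t • v := by fun_prop
      simpa using (this.tendsto 0).mono_left nhdsWithin_le_nhds
    refine mem_closure_of_tendsto hlim ?_
    filter_upwards [hlim.eventually hnhds, self_mem_nhdsWithin] with t ht ht0
    have ht0 : t < 0 := ht0
    rw [ht, hinv, inner_add_right, inner_smul_right, real_inner_self_eq_norm_sq, hv]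
    linarith

include hv hιv hdim hγ hinv hΩ in
-- Inside the ball the frontier is the graph, so the area formula applies. The density is the length
-- of `graphNormal`, which will cancel the normalisation of the normal in the divergence theorem.
theorem surfaceMeasure_restrict_ball_eq :
    (surfaceMeasure Ω).restrict (Metric.ball x₀ r)
      = (((volume : Measure E).withDensity fun w =>
          ENNReal.ofReal √(1 + ‖fderiv ℝ (γ ∘ ι) w‖ ^ 2)).map 𝔤).restrict (Metric.ball x₀ r) := by
  have hγι : LipschitzWith (K * 1) (γ ∘ ι) := hγ.comp ι.lipschitz
  have hemb := (isClosedEmbedding_graphPoint hv hιv hγι).measurableEmbedding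
  have hd : n - 1 = Module.finrank ℝ E := by omega
  rw [← comap_graphPoint_euclideanHausdorffMeasure hv hιv hγι, hemb.map_comap, surfaceMeasure, hd,
    Measure.restrict_restrict Metric.isOpen_ball.measurableSet,
    Measure.restrict_restrict Metric.isOpen_ball.measurableSet]
  congr 1
  ext x
  refine and_congr_right fun hx => ?_
  rw [mem_frontier_iff_of_chart hv hγ hinv hΩ hx, mem_range_graphPoint_iff hv hιv hdim hinv]

/-- A (not normalised) exterior normal of the region below the graph. -/
noncomputable def graphNormal (ι : E →ₗᵢ[ℝ] Vec n) (v : Vec n) (γ : Vec n → ℝ) (w : E) : Vec n :=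
  v - ι ((InnerProductSpace.toDual ℝ E).symm (fderiv ℝ (γ ∘ ι) w))

omit [MeasurableSpace E] [BorelSpace E] in
include hv hιv in
theorem inner_graphNormal (w e : E) (c : ℝ) :
    inner ℝ (graphNormal ι v γ w) (ι e + c • v) = c - fderiv ℝ (γ ∘ ι) w e := by
  have h1 := inner_add_smul_graph hv hιv
    (-(InnerProductSpace.toDual ℝ E).symm (fderiv ℝ (γ ∘ ι) w)) e 1 c
  have h2 : graphNormal ι v γ w
      = ι (-(InnerProductSpace.toDual ℝ E).symm (fderiv ℝ (γ ∘ ι) w)) + (1 : ℝ) • v := by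
    rw [graphNormal, map_neg, one_smul]; abel
  rw [h2, h1, inner_neg_left, InnerProductSpace.toDual_symm_apply]
  ring

omit [MeasurableSpace E] [BorelSpace E] in
include hv hιv in
theorem norm_graphNormal (w : E) :
    ‖graphNormal ι v γ w‖ = √(1 + ‖fderiv ℝ (γ ∘ ι) w‖ ^ 2) := by
  set g := (InnerProductSpace.toDual ℝ E).symm (fderiv ℝ (γ ∘ ι) w) with hg
  have h2 : graphNormal ι v γ w = ι (-g) + (1 : ℝ) • v := by
    rw [graphNormal, map_neg, one_smul]; abel
  have h1 := inner_add_smul_graph hv hιv (-g) (-g) 1 1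
  rw [← h2, real_inner_self_eq_norm_sq, real_inner_self_eq_norm_sq, norm_neg, hg,
    LinearIsometryEquiv.norm_map] at h1
  rw [← Real.sqrt_sq (norm_nonneg (graphNormal ι v γ w)), h1]
  congr 1; ring

omit [MeasurableSpace E] [BorelSpace E] in
include hv hιv hdim hinv hΩ in
-- Near the point, `Ω` is the set where `⟪v, x⟫ - γ x` is negative, and `graphNormal` is the
-- gradient of this function. The adjoint of `ι` recovers the parameter `w`, because `γ` does not
-- depend on the `v` component.
theorem isOuterNormal_graphPoint {w : E} (hw : DifferentiableAt ℝ (γ ∘ ι) w)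
    (hball : 𝔤 w ∈ Metric.ball x₀ r) :
    IsOuterNormal Ω (𝔤 w) (‖graphNormal ι v γ w‖⁻¹ • graphNormal ι v γ w) := by
  have : CompleteSpace E := FiniteDimensional.complete ℝ E
  let π : Vec n →L[ℝ] E := ι.toContinuousLinearMap.adjoint
  have hπ : ∀ (w : E) (t : ℝ), π (ι w + t • v) = w := by
    intro w t
    refine ext_inner_right ℝ fun e => ?_
    have := inner_add_smul_graph hv hιv w e t 0
    rw [ContinuousLinearMap.adjoint_inner_left]
    simpa using this
  have hγπ : ∀ x, γ x = (γ ∘ ι) (π x) := by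
    intro x
    obtain ⟨w, t, rfl⟩ := exists_eq_add_smul hv hιv (by simpa using hdim) x
    rw [hπ, hinv, Function.comp_apply]
  have hN : ‖graphNormal ι v γ w‖ ≠ 0 := by
    rw [norm_graphNormal hv hιv]
    positivity
  refine isOuterNormal_of_hasFDerivAt (f := fun x => inner ℝ v x - γ x) ?_ ?_
    (norm_ne_zero_iff.1 hN) ?_
  · have hγd : HasFDerivAt γ ((fderiv ℝ (γ ∘ ι) w).comp π) (𝔤 w) := by
      have h1 : HasFDerivAt (γ ∘ ι) (fderiv ℝ (γ ∘ ι) w) (π (𝔤 w)) := by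
        rw [graphPoint, hπ]; exact hw.hasFDerivAt
      have h2 := h1.comp (𝔤 w) π.hasFDerivAt
      exact h2.congr_of_eventuallyEq (Eventually.of_forall hγπ)
    have hd := (innerSL ℝ v).hasFDerivAt (x := 𝔤 w) |>.sub hγd
    refine (hd.congr_fderiv ?_)
    ext x
    obtain ⟨e, c, hx⟩ := exists_eq_add_smul hv hιv (by simpa using hdim) x
    rw [innerSL_apply_apply, hx, inner_graphNormal hv hιv]
    simp only [sub_apply, ContinuousLinearMap.comp_apply, innerSL_apply_apply,
      hπ]
    simp [inner_add_right, inner_smul_right, hιv, hv]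
  · exact sub_eq_zero.2 ((mem_range_graphPoint_iff hv hιv hdim hinv _).1 ⟨w, rfl⟩)
  · filter_upwards [Metric.isOpen_ball.mem_nhds hball] with y hy
    rw [hΩ y hy, sub_neg]

include hv hιv hdim hγ hinv hΩ in
theorem ae_restrict_ball_hasOuterNormal :
    ∀ᵐ x ∂(surfaceMeasure Ω).restrict (Metric.ball x₀ r), HasOuterNormal Ω x := by
  have hγι : LipschitzWith (K * 1) (γ ∘ ι) := hγ.comp ι.lipschitz
  have hemb := (isClosedEmbedding_graphPoint hv hιv hγι).measurableEmbedding
  rw [surfaceMeasure_restrict_ball_eq hv hιv hdim hγ hinv hΩ,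
    ae_restrict_iff' Metric.isOpen_ball.measurableSet, hemb.ae_map_iff]
  refine (withDensity_absolutelyContinuous _ _).ae_le ?_
  filter_upwards [hγι.ae_differentiableAt (μ := (volume : Measure E))] with w hw hball
  exact ⟨_, isOuterNormal_graphPoint hv hιv hdim hinv hΩ hw hball⟩

include hv hιv hdim hγ hinv hΩ in
theorem surfaceMeasure_ball_lt_top : surfaceMeasure Ω (Metric.ball x₀ r) < ⊤ := by
  have hγι : LipschitzWith (K * 1) (γ ∘ ι) := hγ.comp ι.lipschitz
  have hemb := (isClosedEmbedding_graphPoint hv hιv hγι).measurableEmbedding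
  have h := congrArg (fun m : Measure (Vec n) => m univ)
    (surfaceMeasure_restrict_ball_eq hv hιv hdim hγ hinv hΩ)
  simp only [Measure.restrict_apply_univ] at h
  rw [h, hemb.map_apply, withDensity_apply _ (hemb.measurable Metric.isOpen_ball.measurableSet)]
  have hbdd : Bornology.IsBounded (𝔤 ⁻¹' Metric.ball x₀ r) := by
    have : AntilipschitzWith 1 𝔤 := by
      apply AntilipschitzWith.of_le_mul_dist
      intro x y
      simpa using dist_le_dist_graphPoint hv hιv x y
    exact this.isBounded_preimage Metric.isBounded_ball
  calc ∫⁻ w in 𝔤 ⁻¹' Metric.ball x₀ r, ENNReal.ofReal √(1 + ‖fderiv ℝ (γ ∘ ι) w‖ ^ 2)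
      ≤ ∫⁻ w in 𝔤 ⁻¹' Metric.ball x₀ r, ENNReal.ofReal √(1 + (K * 1 : ℝ≥0) ^ 2) := by
        refine lintegral_mono fun w => ENNReal.ofReal_le_ofReal (Real.sqrt_le_sqrt ?_)
        have := norm_fderiv_le_of_lipschitz ℝ hγι (x₀ := w)
        gcongr
    _ < ⊤ := by
        rw [setLIntegral_const]
        exact ENNReal.mul_lt_top ENNReal.ofReal_lt_top hbdd.measure_lt_top

include hv hιv hdim hγ hinv hΩ in
theorem setIntegral_fderiv_of_tsupport_subset_ball (hΩo : IsOpen Ω) {φ : Vec n → ℝ}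
    (hφ : ContDiff ℝ 1 φ) (hφc : HasCompactSupport φ) (hφs : tsupport φ ⊆ Metric.ball x₀ r)
    (u : Vec n) :
    ∫ x in Ω, fderiv ℝ φ x u = ∫ x, φ x * inner ℝ (outerNormal Ω x) u ∂surfaceMeasure Ω := by
  have hγι : LipschitzWith (K * 1) (γ ∘ ι) := hγ.comp ι.lipschitz
  have hemb := (isClosedEmbedding_graphPoint hv hιv hγι).measurableEmbedding
  have hU : IsOpen {x | inner ℝ v x < γ x} := isOpen_lt (by fun_prop) hγ.continuous
  have hφ0 : ∀ x, x ∉ Metric.ball x₀ r → φ x = 0 := fun x hx =>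
    image_eq_zero_of_notMem_tsupport fun h => hx (hφs h)
  have hdφ0 : ∀ x, x ∉ Metric.ball x₀ r → fderiv ℝ φ x = 0 := fun x hx =>
    image_eq_zero_of_notMem_tsupport fun h => hx (hφs (tsupport_fderiv_subset ℝ h))
  -- The support condition allows `Ω` to be replaced by the whole region below the graph.
  have h1 : ∫ x in Ω, fderiv ℝ φ x u = ∫ x in {x | inner ℝ v x < γ x}, fderiv ℝ φ x u := by
    rw [← integral_indicator hΩo.measurableSet, ← integral_indicator hU.measurableSet]
    congr 1
    ext x
    by_cases hx : x ∈ Metric.ball x₀ r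
    · by_cases hxΩ : x ∈ Ω
      · have hxU : x ∈ {x | inner ℝ v x < γ x} := (hΩ x hx).1 hxΩ
        rw [indicator_of_mem hxΩ, indicator_of_mem hxU]
      · have hxU : x ∉ {x | inner ℝ v x < γ x} := fun h => hxΩ ((hΩ x hx).2 h)
        rw [indicator_of_notMem hxΩ, indicator_of_notMem hxU]
    · simp [indicator, hdφ0 x hx]
  obtain ⟨e, c, rfl⟩ := exists_eq_add_smul hv hιv (by simpa using hdim) u
  have h2 : ∫ x, φ x * inner ℝ (outerNormal Ω x) (ι e + c • v) ∂surfaceMeasure Ω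
      = ∫ x in Metric.ball x₀ r, φ x * inner ℝ (outerNormal Ω x) (ι e + c • v)
        ∂surfaceMeasure Ω :=
    (setIntegral_eq_integral_of_forall_compl_eq_zero fun x hx => by rw [hφ0 x hx, zero_mul]).symm
  have hmeas : Measurable fun w => ENNReal.ofReal √(1 + ‖fderiv ℝ (γ ∘ ι) w‖ ^ 2) :=
    ((((measurable_fderiv ℝ (γ ∘ ι)).norm.pow_const 2).const_add 1).sqrt).ennreal_ofReal
  rw [h1, setIntegral_hypograph_fderiv hv hιv (by simpa using hdim) hγι hU.measurableSet ?_ hφ hφc,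
    h2, surfaceMeasure_restrict_ball_eq hv hιv hdim hγ hinv hΩ,
    setIntegral_eq_integral_of_forall_compl_eq_zero (fun x hx => by rw [hφ0 x hx, zero_mul]),
    hemb.integral_map, integral_withDensity_eq_integral_toReal_smul hmeas
      (Eventually.of_forall fun _ => ENNReal.ofReal_lt_top)]
  · refine integral_congr_ae ?_
    filter_upwards [hγι.ae_differentiableAt (μ := (volume : Measure E))] with w hw
    by_cases hball : 𝔤 w ∈ Metric.ball x₀ r
    · have hN := norm_graphNormal hv hιv (γ := γ) w
      have hN0 : √(1 + ‖fderiv ℝ (γ ∘ ι) w‖ ^ 2) ≠ 0 := by positivity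
      rw [(isOuterNormal_graphPoint hv hιv hdim hinv hΩ hw hball).outerNormal_eq, hN,
        ENNReal.toReal_ofReal (Real.sqrt_nonneg _), real_inner_smul_left,
        inner_graphNormal hv hιv, smul_eq_mul]
      field_simp
    · simp [hφ0 _ hball]
  · intro w t
    change inner ℝ v _ < γ _ ↔ _
    rw [inner_graphPoint_add_smul hv hιv, apply_graphPoint_add_smul hinv]
    constructor <;> intro h <;> linarith

end Chart

theorem exists_chart {n : ℕ} {Ω : Set (Vec n)} (hΩo : IsOpen Ω) (hΩl : HasLipschitzBoundary Ω)
    {x₀ : Vec n} (hx₀ : x₀ ∈ frontier Ω) : ∃ r > 0,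
      (∀ᵐ x ∂(surfaceMeasure Ω).restrict (Metric.ball x₀ r), HasOuterNormal Ω x) ∧
      surfaceMeasure Ω (Metric.ball x₀ r) < ⊤ ∧
      ∀ φ : Vec n → ℝ, ContDiff ℝ 1 φ → HasCompactSupport φ → tsupport φ ⊆ Metric.ball x₀ r →
        ∀ u, ∫ x in Ω, fderiv ℝ φ x u
          = ∫ x, φ x * inner ℝ (outerNormal Ω x) u ∂surfaceMeasure Ω := by
  obtain ⟨v, γ, K, r, hv, hγ, hinv, hr, hΩ⟩ := hΩl x₀ hx₀
  have hιv : ∀ w : (ℝ ∙ v)ᗮ, inner ℝ v ((ℝ ∙ v)ᗮ.subtypeₗᵢ w) = 0 := fun w =>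
    Submodule.mem_orthogonal_singleton_iff_inner_right.1 w.2
  have hdim : n = Module.finrank ℝ (ℝ ∙ v)ᗮ + 1 := by
    have h1 := (ℝ ∙ v).finrank_add_finrank_orthogonal
    rw [finrank_span_singleton (by rintro rfl; simp at hv), finrank_euclideanSpace_fin] at h1
    omega
  exact ⟨r, hr, ae_restrict_ball_hasOuterNormal hv hιv hdim hγ hinv hΩ,
    surfaceMeasure_ball_lt_top hv hιv hdim hγ hinv hΩ, fun φ hφ hφc hφs u =>
    setIntegral_fderiv_of_tsupport_subset_ball hv hιv hdim hγ hinv hΩ hΩo hφ hφc hφs u⟩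

/-! ### The divergence theorem on a bounded Lipschitz domain -/

open scoped Manifold in
/-- A finite smooth partition of unity on a compact set, subordinate to given balls. -/
theorem exists_smooth_partition {n : ℕ} {S : Set (Vec n)} (hS : IsCompact S) {r : Vec n → ℝ}
    (hr : ∀ x ∈ S, 0 < r x) :
    ∃ (J : Type) (_ : Fintype J) (c : J → Vec n) (χ : J → Vec n → ℝ), (∀ j, c j ∈ S) ∧
      (∀ j, ContDiff ℝ ∞ (χ j)) ∧ (∀ j, HasCompactSupport (χ j)) ∧
      (∀ j, tsupport (χ j) ⊆ Metric.ball (c j) (r (c j))) ∧ (∀ j x, 0 ≤ χ j x) ∧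
      (∀ j x, χ j x ≤ 1) ∧ ∀ x ∈ S, ∑ j, χ j x = 1 := by
  obtain ⟨t, htS, ht⟩ := hS.elim_nhds_subcover (fun x => Metric.ball x (r x))
    fun x hx => Metric.ball_mem_nhds x (hr x hx)
  obtain ⟨f, hf⟩ := SmoothPartitionOfUnity.exists_isSubordinate 𝓘(ℝ, Vec n) hS.isClosed
    (fun j : Fin t.card => Metric.ball ((t.equivFin.symm j : t) : Vec n) (r (t.equivFin.symm j : t)))
    (fun _ => Metric.isOpen_ball) (by
      intro x hx
      obtain ⟨y, hy, hxy⟩ := mem_iUnion₂.1 (ht hx)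
      exact mem_iUnion.2 ⟨t.equivFin ⟨y, hy⟩, by simpa using hxy⟩)
  refine ⟨Fin t.card, inferInstance, fun j => (t.equivFin.symm j : t), fun j => f j,
    fun j => htS _ (t.equivFin.symm j).2, fun j => (f j).contMDiff.contDiff, fun j => ?_,
    fun j => hf j, fun j x => f.nonneg j x, fun j x => f.le_one j x, fun x hx => ?_⟩
  · exact HasCompactSupport.of_support_subset_isCompact
      (isCompact_closedBall ((t.equivFin.symm j : t) : Vec n) (r (t.equivFin.symm j : t)))
      ((subset_tsupport _).trans ((hf j).trans Metric.ball_subset_closedBall))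
  · rw [← finsum_eq_sum_of_fintype]
    exact f.sum_eq_one hx

theorem integral_fderiv_eq_zero {n : ℕ} {φ : Vec n → ℝ} (hφ : ContDiff ℝ 1 φ)
    (hφc : HasCompactSupport φ) (u : Vec n) : ∫ x, fderiv ℝ φ x u = 0 := by
  obtain ⟨D, hD⟩ := ContDiff.lipschitzWith_of_hasCompactSupport hφc hφ one_ne_zero
  have h1 := LipschitzWith.integral_lineDeriv_mul_eq (μ := (volume : Measure (Vec n)))
    (LipschitzWith.const (1 : ℝ)) hD hφc (-u)
  have h2 : ∫ x, lineDeriv ℝ φ x u = 0 := by simpa [lineDeriv] using h1.symm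
  rw [← h2]
  refine integral_congr_ae (Eventually.of_forall fun x => ?_)
  exact ((hφ.differentiable one_ne_zero x).lineDeriv_eq_fderiv (v := u)).symm

theorem setIntegral_fderiv_eq_zero {n : ℕ} {Ω : Set (Vec n)} {φ : Vec n → ℝ}
    (hφ : ContDiff ℝ 1 φ) (hφc : HasCompactSupport φ) (hφs : tsupport φ ⊆ Ω) (u : Vec n) :
    ∫ x in Ω, fderiv ℝ φ x u = 0 := by
  rw [setIntegral_eq_integral_of_forall_compl_eq_zero, integral_fderiv_eq_zero hφ hφc]
  intro x hx
  rw [image_eq_zero_of_notMem_tsupport fun h => hx (hφs (tsupport_fderiv_subset ℝ h))]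
  rfl

section Domain

variable {n : ℕ} {Ω : Set (Vec n)} (hΩo : IsOpen Ω) (hΩb : Bornology.IsBounded Ω)
  (hΩl : HasLipschitzBoundary Ω)

theorem isCompact_frontier_of_isBounded (hΩb : Bornology.IsBounded Ω) :
    IsCompact (frontier Ω) :=
  Metric.isCompact_of_isClosed_isBounded isClosed_frontier
    (hΩb.closure.subset frontier_subset_closure)

theorem surfaceMeasure_compl_frontier : surfaceMeasure Ω (frontier Ω)ᶜ = 0 := by
  rw [surfaceMeasure, Measure.restrict_apply isClosed_frontier.measurableSet.compl]
  simp

include hΩo hΩb hΩl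

/-- Finitely many charts cover the compact frontier, and each carries finite area. -/
theorem surfaceMeasure_univ_lt_top : surfaceMeasure Ω univ < ⊤ := by
  have hex : ∀ x : Vec n, ∃ r > 0, x ∈ frontier Ω → surfaceMeasure Ω (Metric.ball x r) < ⊤ := by
    intro x
    by_cases hx : x ∈ frontier Ω
    · obtain ⟨r, hr, -, h, -⟩ := exists_chart hΩo hΩl hx
      exact ⟨r, hr, fun _ => h⟩
    · exact ⟨1, one_pos, fun h => absurd h hx⟩
  choose r hr h using hex
  obtain ⟨t, htS, ht⟩ := (isCompact_frontier_of_isBounded hΩb).elim_nhds_subcover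
    (fun x => Metric.ball x (r x)) fun x _ => Metric.ball_mem_nhds x (hr x)
  rw [← measure_add_measure_compl isClosed_frontier.measurableSet,
    surfaceMeasure_compl_frontier, add_zero]
  refine (measure_mono ht).trans_lt ?_
  exact measure_biUnion_lt_top t.finite_toSet fun x hx => h x (htS x hx)

theorem ae_hasOuterNormal : ∀ᵐ x ∂surfaceMeasure Ω, HasOuterNormal Ω x := by
  have hex : ∀ x : Vec n, ∃ r > 0, x ∈ frontier Ω →
      ∀ᵐ x ∂(surfaceMeasure Ω).restrict (Metric.ball x r), HasOuterNormal Ω x := by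
    intro x
    by_cases hx : x ∈ frontier Ω
    · obtain ⟨r, hr, h, -⟩ := exists_chart hΩo hΩl hx
      exact ⟨r, hr, fun _ => h⟩
    · exact ⟨1, one_pos, fun h => absurd h hx⟩
  choose r hr h using hex
  obtain ⟨t, htS, ht⟩ := (isCompact_frontier_of_isBounded hΩb).elim_nhds_subcover
    (fun x => Metric.ball x (r x)) fun x _ => Metric.ball_mem_nhds x (hr x)
  have h1 : ∀ᵐ x ∂surfaceMeasure Ω, ∀ y ∈ t, x ∈ Metric.ball y (r y) → HasOuterNormal Ω x :=
    (ae_ball_iff t.countable_toSet).2 fun y hy =>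
      (ae_restrict_iff' Metric.isOpen_ball.measurableSet).1 (h y (htS y hy))
  have h2 : ∀ᵐ x ∂surfaceMeasure Ω, x ∈ frontier Ω := surfaceMeasure_compl_frontier
  filter_upwards [h1, h2] with x hx hxf
  obtain ⟨y, hy, hxy⟩ := mem_iUnion₂.1 (ht hxf)
  exact hx y hy hxy

end Domain

/-! ### Measurability of the exterior normal -/

/-- The mean position, seen from `x`, of the points of `Ω` in the ball of radius `s`. -/
noncomputable def blowUpMoment {n : ℕ} (Ω : Set (Vec n)) (s : ℝ) (x : Vec n) : Vec n :=
  ∫ y in Metric.ball (0 : Vec n) 1, (Ω.indicator (fun _ => (1 : ℝ)) (x + s • y)) • y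

theorem measurable_blowUpMoment {n : ℕ} {Ω : Set (Vec n)} (hΩ : MeasurableSet Ω) (s : ℝ) :
    Measurable (blowUpMoment Ω s) := by
  have h : Measurable fun q : Vec n × Vec n =>
      (Ω.indicator (fun _ => (1 : ℝ)) (q.1 + s • q.2)) • q.2 := by
    have h1 : Measurable fun q : Vec n × Vec n => q.1 + s • q.2 := by fun_prop
    exact (((measurable_const (a := (1 : ℝ))).indicator hΩ).comp h1).smul measurable_snd
  exact (h.stronglyMeasurable.integral_prod_right).measurable

theorem measure_inner_eq_zero {n : ℕ} {ν : Vec n} (hν : ν ≠ 0) :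
    volume {y : Vec n | inner ℝ y ν = 0} = 0 := by
  have h := Measure.addHaar_submodule (volume : Measure (Vec n)) (ℝ ∙ ν)ᗮ (by
    intro h
    have : ν ∈ (ℝ ∙ ν)ᗮ := by rw [h]; trivial
    exact hν (inner_self_eq_zero.1 (Submodule.mem_orthogonal_singleton_iff_inner_right.1 this)))
  convert h using 2
  ext y
  rw [SetLike.mem_coe, Submodule.mem_orthogonal_singleton_iff_inner_left]
  rfl

/-- The blow-ups of `Ω` at `x` converge to the half space pointwise off the hyperplane `⟪y, ν⟫ = 0`,
which is null; dominated convergence does the rest. -/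
theorem tendsto_blowUpMoment {n : ℕ} {Ω : Set (Vec n)} (hΩ : MeasurableSet Ω) {x ν : Vec n}
    (h : IsOuterNormal Ω x ν) :
    Tendsto (fun j : ℕ => blowUpMoment Ω (1 / ((j : ℝ) + 1)) x) atTop
      (𝓝 (∫ y in Metric.ball (0 : Vec n) 1,
        ({y : Vec n | inner ℝ y ν < 0}.indicator (fun _ => (1 : ℝ)) y) • y)) := by
  have hν0 : ν ≠ 0 := by rintro rfl; simpa using h.1
  refine tendsto_integral_of_dominated_convergence (fun _ => 1) (fun j => ?_) ?_ (fun j => ?_) ?_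
  · have h1 : Measurable fun y : Vec n => x + (1 / ((j : ℝ) + 1)) • y := by fun_prop
    exact ((((measurable_const (a := (1 : ℝ))).indicator hΩ).comp h1).smul
      measurable_id).aestronglyMeasurable
  · exact integrableOn_const (Metric.isBounded_ball.measure_lt_top.ne) (by simp)
  · filter_upwards [ae_restrict_mem Metric.isOpen_ball.measurableSet] with y hy
    rw [norm_smul]
    have h1 : ‖y‖ ≤ 1 := (mem_ball_zero_iff.1 hy).le
    have h2 : ‖Ω.indicator (fun _ => (1 : ℝ)) (x + (1 / ((j : ℝ) + 1)) • y)‖ ≤ 1 :=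
      (norm_indicator_le_norm_self _ _).trans (by simp)
    nlinarith [norm_nonneg y, norm_nonneg (Ω.indicator (fun _ => (1 : ℝ))
      (x + (1 / ((j : ℝ) + 1)) • y))]
  · have hne : ∀ᵐ y ∂(volume : Measure (Vec n)).restrict (Metric.ball 0 1), inner ℝ y ν ≠ 0 :=
      ae_restrict_of_ae (ae_iff.2 (by simpa using measure_inner_eq_zero hν0))
    filter_upwards [hne] with y hy
    have hy0 : y ≠ 0 := by rintro rfl; simp at hy
    have hlim : Tendsto (fun j : ℕ => x + (1 / ((j : ℝ) + 1)) • y) atTop (𝓝 x) := by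
      simpa using (tendsto_one_div_add_atTop_nhds_zero_nat (𝕜 := ℝ)).smul_const y |>.const_add x
    refine Tendsto.smul_const ?_ y
    refine tendsto_const_nhds.congr' ?_
    have hε : 0 < |inner ℝ y ν| / (2 * ‖y‖) :=
      div_pos (abs_pos.2 hy) (mul_pos two_pos (norm_pos_iff.2 hy0))
    have hεy : |inner ℝ y ν| / (2 * ‖y‖) * ‖y‖ = |inner ℝ y ν| / 2 := by
      have := norm_ne_zero_iff.2 hy0
      field_simp
    filter_upwards [hlim.eventually (h.2 _ hε)] with j hj
    have hs : 0 < 1 / ((j : ℝ) + 1) := by positivity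
    rw [add_sub_cancel_left, real_inner_smul_left, norm_smul, Real.norm_eq_abs, abs_of_pos hs] at hj
    rcases lt_or_gt_of_ne hy with hlt | hgt
    · have h1 : x + (1 / ((j : ℝ) + 1)) • y ∈ Ω := by
        apply hj.1
        rw [abs_of_neg hlt] at hεy ⊢
        nlinarith [mul_neg_of_pos_of_neg hs hlt]
      have h2 : y ∈ {y : Vec n | inner ℝ y ν < 0} := hlt
      rw [indicator_of_mem h1, indicator_of_mem h2]
    · have h1 : x + (1 / ((j : ℝ) + 1)) • y ∉ Ω := by
        apply hj.2
        rw [abs_of_pos hgt] at hεy ⊢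
        nlinarith [mul_pos hs hgt]
      have h2 : y ∉ {y : Vec n | inner ℝ y ν < 0} := fun h => lt_asymm h hgt
      rw [indicator_of_notMem h1, indicator_of_notMem h2]

/-- The reflection that fixes the line of `ν` preserves the half ball, so the moment lies on this
line. Its component along `ν` is negative because the half ball has positive volume. -/
theorem halfBall_moment_eq {n : ℕ} {ν : Vec n} (hν : ‖ν‖ = 1) :
    ∃ c : ℝ, 0 < c ∧ ∫ y in Metric.ball (0 : Vec n) 1,
      ({y : Vec n | inner ℝ y ν < 0}.indicator (fun _ => (1 : ℝ)) y) • y = -c • ν := by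
  have hν0 : ν ≠ 0 := by rintro rfl; simp at hν
  set H : Set (Vec n) := {y : Vec n | inner ℝ y ν < 0} with hH
  have hHo : IsOpen H := isOpen_lt (by fun_prop) continuous_const
  set F : Vec n → Vec n := fun y => (H.indicator (fun _ => (1 : ℝ)) y) • y with hF
  have hFi : IntegrableOn F (Metric.ball 0 1) := by
    refine Integrable.mono' (g := fun _ => (1 : ℝ))
      (integrableOn_const (Metric.isBounded_ball.measure_lt_top.ne) (by simp))
      (((measurable_const (a := (1 : ℝ))).indicator hHo.measurableSet).smul
        measurable_id).aestronglyMeasurable ?_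
    filter_upwards [ae_restrict_mem Metric.isOpen_ball.measurableSet] with y hy
    rw [norm_smul]
    have h1 : ‖y‖ ≤ 1 := (mem_ball_zero_iff.1 hy).le
    have h2 : ‖H.indicator (fun _ => (1 : ℝ)) y‖ ≤ 1 :=
      (norm_indicator_le_norm_self _ _).trans (by simp)
    nlinarith [norm_nonneg y, norm_nonneg (H.indicator (fun _ => (1 : ℝ)) y)]
  set h := ∫ y in Metric.ball (0 : Vec n) 1, F y with hh
  let R := (ℝ ∙ ν).reflection
  have hRν : R ν = ν := Submodule.reflection_mem_subspace_eq_self (Submodule.mem_span_singleton_self ν)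
  have hRinner : ∀ y, inner ℝ (R y) ν = inner ℝ y ν := by
    intro y
    conv_lhs => rw [← hRν]
    exact R.inner_map_map y ν
  have hRF : ∀ y, F (R y) = R (F y) := by
    intro y
    have : R y ∈ H ↔ y ∈ H := by
      change inner ℝ (R y) ν < 0 ↔ inner ℝ y ν < 0
      rw [hRinner]
    by_cases hy : y ∈ H
    · simp [hF, hy, this.2 hy]
    · have hy' : R y ∉ H := fun h => hy (this.1 h)
      simp [hF, hy, hy']
  have hRh : R h = h := by
    have h1 : ∫ y in R ⁻¹' Metric.ball (0 : Vec n) 1, F (R y) = h :=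
      R.measurePreserving.setIntegral_preimage_emb R.toHomeomorph.measurableEmbedding F _
    have h2 : R ⁻¹' Metric.ball (0 : Vec n) 1 = Metric.ball 0 1 := by
      ext y; simp
    rw [h2] at h1
    simp only [hRF] at h1
    have h3 := (R.toContinuousLinearEquiv : Vec n →L[ℝ] Vec n).integral_comp_comm hFi
    exact h3.symm.trans h1
  have hspan : h ∈ (ℝ ∙ ν) := Submodule.reflection_eq_self_iff h |>.1 hRh
  obtain ⟨a, ha⟩ := Submodule.mem_span_singleton.1 hspan
  have hint : inner ℝ ν h = a := by
    rw [← ha, inner_smul_right, real_inner_self_eq_norm_sq, hν]; ring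
  have hint2 : ∫ y in Metric.ball (0 : Vec n) 1, inner ℝ ν (F y) = a := by
    rw [← hint]
    exact (innerSL ℝ ν).integral_comp_comm hFi
  have hle : ∀ y, inner ℝ ν (F y) ≤ 0 := by
    intro y
    by_cases hy : y ∈ H
    · simp only [hF, hy, indicator_of_mem, one_smul]
      rw [real_inner_comm]
      exact le_of_lt hy
    · simp [hF, hy]
  have hFi2 : IntegrableOn (fun y => inner ℝ ν (F y)) (Metric.ball 0 1) :=
    (innerSL ℝ ν).integrable_comp hFi
  have ha0 : a ≤ 0 := by
    rw [← hint2]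
    exact integral_nonpos hle
  refine ⟨-a, ?_, by rw [neg_neg, ha]⟩
  rw [Left.neg_pos_iff]
  refine lt_of_le_of_ne ha0 fun h0 => ?_
  have h1 : ∫ y in Metric.ball (0 : Vec n) 1, -inner ℝ ν (F y) = 0 := by
    rw [integral_neg, hint2, h0, neg_zero]
  rw [integral_eq_zero_iff_of_nonneg (fun y => neg_nonneg.2 (hle y)) hFi2.neg] at h1
  have h2 : (volume : Measure (Vec n)).restrict (Metric.ball 0 1) H = 0 := by
    refine measure_mono_null (fun y hy => ?_) (ae_iff.1 h1)
    change ¬ (-inner ℝ ν (F y) = 0)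
    simp only [hF, hy, indicator_of_mem, one_smul]
    rw [real_inner_comm]
    have : inner ℝ y ν < 0 := hy
    linarith
  rw [Measure.restrict_apply hHo.measurableSet] at h2
  refine ((hHo.inter Metric.isOpen_ball).measure_pos volume ⟨(-(1 / 2) : ℝ) • ν, ?_, ?_⟩).ne' h2
  · change inner ℝ ((-(1 / 2) : ℝ) • ν) ν < 0
    rw [real_inner_smul_left, real_inner_self_eq_norm_sq, hν]
    norm_num
  · rw [mem_ball_zero_iff, norm_smul, hν]
    norm_num

/-- The exterior normal agrees with a measurable function wherever it exists. -/
theorem exists_measurable_eq_outerNormal {n : ℕ} {Ω : Set (Vec n)} (hΩ : MeasurableSet Ω) :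
    ∃ N : Vec n → Vec n, Measurable N ∧ ∀ x, HasOuterNormal Ω x → N x = outerNormal Ω x := by
  -- The moments point inwards; normalising and changing the sign gives measurable functions that
  -- converge to the normal wherever it exists.
  obtain ⟨f, hf⟩ : ∃ f : ℕ → Vec n → Vec n, f = fun (j : ℕ) x =>
    -(‖blowUpMoment Ω (1 / ((j : ℝ) + 1)) x‖⁻¹ • blowUpMoment Ω (1 / ((j : ℝ) + 1)) x) := ⟨_, rfl⟩
  have hfm : ∀ j, Measurable (f j) := fun j => by
    have := measurable_blowUpMoment hΩ (1 / ((j : ℝ) + 1))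
    rw [hf]
    exact (this.norm.inv.smul this).neg
  have hlim : ∀ x, HasOuterNormal Ω x → Tendsto (fun j => f j x) atTop (𝓝 (outerNormal Ω x)) := by
    intro x hx
    have hn := hx.isOuterNormal
    obtain ⟨c, hc, hceq⟩ := halfBall_moment_eq hn.1
    have hlim := tendsto_blowUpMoment hΩ hn
    rw [hceq] at hlim
    have hnorm : ‖-c • outerNormal Ω x‖ = c := by
      rw [norm_smul, hn.1, norm_neg, Real.norm_eq_abs, abs_of_pos hc, mul_one]
    have h2 := ((hlim.norm.inv₀ (by rw [hnorm]; exact hc.ne')).smul hlim).neg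
    have h3 : -(‖-c • outerNormal Ω x‖⁻¹ • (-c • outerNormal Ω x)) = outerNormal Ω x := by
      rw [hnorm, smul_smul, mul_neg, inv_mul_cancel₀ hc.ne', neg_one_smul, neg_neg]
    rw [h3] at h2
    rw [hf]
    exact h2
  have hD : MeasurableSet {x | ∃ l, Tendsto (fun j => f j x) atTop (𝓝 l)} :=
    measurableSet_exists_tendsto hfm
  choose! l hl using fun x (hx : x ∈ {x | ∃ l, Tendsto (fun j => f j x) atTop (𝓝 l)}) => hx
  -- Off the measurable set of convergence the approximations are replaced by zero, so that they
  -- converge everywhere and the limit is measurable.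
  refine ⟨indicator {x | ∃ l, Tendsto (fun j => f j x) atTop (𝓝 l)} l,
    measurable_of_tendsto_metrizable (fun j => (hfm j).indicator hD)
      (tendsto_pi_nhds.2 fun x => ?_), fun x hx => ?_⟩
  · by_cases hx : x ∈ {x | ∃ l, Tendsto (fun j => f j x) atTop (𝓝 l)}
    · simp only [indicator_of_mem hx]
      exact hl x hx
    · simp only [indicator_of_notMem hx]
      exact tendsto_const_nhds
  · have hx' : x ∈ {x | ∃ l, Tendsto (fun j => f j x) atTop (𝓝 l)} := ⟨_, hlim x hx⟩
    rw [indicator_of_mem hx']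
    exact tendsto_nhds_unique (hl x hx') (hlim x hx)

/-- The exterior normal is measurable with respect to every measure for which it exists almost
everywhere. -/
theorem aemeasurable_outerNormal {n : ℕ} {Ω : Set (Vec n)} (hΩ : MeasurableSet Ω)
    {μ : Measure (Vec n)} (hμ : ∀ᵐ x ∂μ, HasOuterNormal Ω x) : AEMeasurable (outerNormal Ω) μ := by
  obtain ⟨N, hN, h⟩ := exists_measurable_eq_outerNormal hΩ
  exact ⟨N, hN, hμ.mono fun x hx => (h x hx).symm⟩

/-! ### Integrals against the normal and the global divergence theorem -/

section Domain

variable {n : ℕ} {Ω : Set (Vec n)} (hΩo : IsOpen Ω) (hΩb : Bornology.IsBounded Ω)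
  (hΩl : HasLipschitzBoundary Ω)

theorem ae_mem_frontier : ∀ᵐ x ∂surfaceMeasure Ω, x ∈ frontier Ω := surfaceMeasure_compl_frontier

include hΩo hΩb hΩl

theorem isFiniteMeasure_surfaceMeasure : IsFiniteMeasure (surfaceMeasure Ω) :=
  ⟨surfaceMeasure_univ_lt_top hΩo hΩb hΩl⟩

theorem aemeasurable_outerNormal_surfaceMeasure :
    AEMeasurable (outerNormal Ω) (surfaceMeasure Ω) :=
  aemeasurable_outerNormal hΩo.measurableSet (ae_hasOuterNormal hΩo hΩb hΩl)

/-- A continuous function is integrable over the boundary against a component of the normal. -/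
theorem integrable_mul_inner_outerNormal {φ : Vec n → ℝ} (hφ : Continuous φ) (u : Vec n) :
    Integrable (fun x => φ x * inner ℝ (outerNormal Ω x) u) (surfaceMeasure Ω) := by
  have := isFiniteMeasure_surfaceMeasure hΩo hΩb hΩl
  obtain ⟨C, hC⟩ := (isCompact_frontier_of_isBounded hΩb).exists_bound_of_continuousOn
    hφ.continuousOn
  have hm : AEStronglyMeasurable (fun x => inner ℝ (outerNormal Ω x) u) (surfaceMeasure Ω) :=
    ((aemeasurable_outerNormal_surfaceMeasure hΩo hΩb hΩl).inner_const (c := u)).aestronglyMeasurable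
  refine Integrable.of_bound (C := C * ‖u‖) (hφ.aestronglyMeasurable.mul hm) ?_
  filter_upwards [ae_mem_frontier] with x hx
  rw [norm_mul]
  have h1 := hC x hx
  have h2 : ‖inner ℝ (outerNormal Ω x) u‖ ≤ ‖u‖ :=
    (norm_inner_le_norm _ _).trans (by nlinarith [norm_outerNormal_le Ω x, norm_nonneg u])
  exact mul_le_mul h1 h2 (norm_nonneg _) ((norm_nonneg _).trans h1)

omit hΩb in
-- At an interior point both sides vanish for test functions supported in a ball inside `Ω`; at a
-- boundary point a chart applies.
theorem exists_ball_setIntegral_fderiv {x₀ : Vec n} (hx₀ : x₀ ∈ closure Ω) : ∃ r > 0,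
    ∀ φ : Vec n → ℝ, ContDiff ℝ 1 φ → HasCompactSupport φ → tsupport φ ⊆ Metric.ball x₀ r →
      ∀ u, ∫ x in Ω, fderiv ℝ φ x u
        = ∫ x, φ x * inner ℝ (outerNormal Ω x) u ∂surfaceMeasure Ω := by
  by_cases hx : x₀ ∈ Ω
  · obtain ⟨r, hr, hball⟩ := Metric.isOpen_iff.1 hΩo x₀ hx
    refine ⟨r, hr, fun φ hφ hφc hφs u => ?_⟩
    rw [setIntegral_fderiv_eq_zero hφ hφc (hφs.trans hball), integral_eq_zero_of_ae]
    filter_upwards [ae_mem_frontier] with x hxf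
    have hxΩ : x ∉ Ω := fun h => hxf.2 (by rwa [hΩo.interior_eq])
    rw [image_eq_zero_of_notMem_tsupport fun h => hxΩ (hball (hφs h)), zero_mul]
    rfl
  · have hxf : x₀ ∈ frontier Ω := ⟨hx₀, by rwa [hΩo.interior_eq]⟩
    obtain ⟨r, hr, -, -, h⟩ := exists_chart hΩo hΩl hxf
    exact ⟨r, hr, h⟩

/-- The divergence theorem on a bounded Lipschitz domain. -/
theorem setIntegral_fderiv_eq_integral_outerNormal {φ : Vec n → ℝ} (hφ : ContDiff ℝ 1 φ)
    (u : Vec n) :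
    ∫ x in Ω, fderiv ℝ φ x u = ∫ x, φ x * inner ℝ (outerNormal Ω x) u ∂surfaceMeasure Ω := by
  have hcl : IsCompact (closure Ω) := hΩb.isCompact_closure
  have hex : ∀ x : Vec n, ∃ r > 0, x ∈ closure Ω → ∀ φ : Vec n → ℝ, ContDiff ℝ 1 φ →
      HasCompactSupport φ → tsupport φ ⊆ Metric.ball x r → ∀ u, ∫ x in Ω, fderiv ℝ φ x u
        = ∫ x, φ x * inner ℝ (outerNormal Ω x) u ∂surfaceMeasure Ω := by
    intro x
    by_cases hx : x ∈ closure Ω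
    · obtain ⟨r, hr, h⟩ := exists_ball_setIntegral_fderiv hΩo hΩl hx
      exact ⟨r, hr, fun _ => h⟩
    · exact ⟨1, one_pos, fun h => absurd h hx⟩
  choose r hr h using hex
  obtain ⟨J, _, c, χ, hcS, hχ, hχc, hχs, -, -, hsum⟩ :=
    exists_smooth_partition hcl (r := r) fun x _ => hr x
  have hφj : ∀ j, ContDiff ℝ 1 fun x => χ j x * φ x := fun j =>
    ((hχ j).of_le (by exact_mod_cast le_top)).mul hφ
  have hφjc : ∀ j, HasCompactSupport fun x => χ j x * φ x := fun j => (hχc j).mul_right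
  have hφjs : ∀ j, tsupport (fun x => χ j x * φ x) ⊆ Metric.ball (c j) (r (c j)) := fun j =>
    (tsupport_mul_subset_left (f := χ j) (g := φ)).trans (hχs j)
  have hj := fun j => h (c j) (hcS j) _ (hφj j) (hφjc j) (hφjs j) u
  have h1 : ∫ x in Ω, fderiv ℝ φ x u = ∫ x in Ω, ∑ j, fderiv ℝ (fun x => χ j x * φ x) x u := by
    refine setIntegral_congr_fun hΩo.measurableSet fun x hx => ?_
    -- The partition sums to one only on the closure of `Ω`; differentiation is legitimate because
    -- `Ω` is open.
    have heq : φ =ᶠ[𝓝 x] fun x => ∑ j, χ j x * φ x := by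
      filter_upwards [hΩo.mem_nhds hx] with y hy
      rw [← Finset.sum_mul, hsum y (subset_closure hy), one_mul]
    have hd : fderiv ℝ φ x = ∑ j, fderiv ℝ (fun x => χ j x * φ x) x := by
      rw [heq.fderiv_eq, fderiv_fun_sum fun j _ => (hφj j).differentiable one_ne_zero x]
    simp only [hd, sum_apply]
  rw [h1, integral_finsetSum]
  · simp only [hj]
    rw [← integral_finsetSum]
    · refine integral_congr_ae ?_
      filter_upwards [ae_mem_frontier] with x hx
      rw [← Finset.sum_mul, ← Finset.sum_mul, hsum x hx.1, one_mul]
    · exact fun j _ => integrable_mul_inner_outerNormal hΩo hΩb hΩl (hφj j).continuous u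
  · intro j _
    have hc : Continuous fun x => fderiv ℝ (fun x => χ j x * φ x) x u :=
      ((hφj j).continuous_fderiv one_ne_zero).clm_apply continuous_const
    exact (hc.integrable_of_hasCompactSupport ((hφjc j).fderiv_apply (𝕜 := ℝ) u)).integrableOn

end Domain

/-! ### Identification of measures by smooth test functions -/

/-- Two finite measures agree on an open set if they agree on the smooth functions with compact
support in this set, possibly after multiplication with a vector field of norm one. -/
theorem restrict_eq_of_forall_integral_smul_eq {n m : ℕ} {μ ν : Measure (Vec n)}
    [IsFiniteMeasure μ] [IsFiniteMeasure ν] {U : Set (Vec n)} (hU : IsOpen U)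
    {f : Vec n → Vec m} (hf : AEMeasurable f (μ + ν)) (hf1 : ∀ᵐ x ∂(μ + ν), ‖f x‖ = 1)
    (h : ∀ φ : Vec n → ℝ, ContDiff ℝ ∞ φ → HasCompactSupport φ → tsupport φ ⊆ U →
      ∫ x, φ x • f x ∂μ = ∫ x, φ x • f x ∂ν) : μ.restrict U = ν.restrict U := by
  -- Both measures get densities with respect to their sum. The test functions identify the
  -- densities multiplied by `f`, and the factor cancels since `f` does not vanish.
  obtain ⟨ρ, hρ⟩ : ∃ ρ, ρ = μ + ν := ⟨_, rfl⟩
  rw [← hρ] at hf hf1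
  have hμρ : μ ≪ ρ := hρ ▸ Measure.absolutelyContinuous_of_le (Measure.le_add_right le_rfl)
  have hνρ : ν ≪ ρ := hρ ▸ Measure.absolutelyContinuous_of_le (Measure.le_add_left le_rfl)
  have : IsFiniteMeasure ρ := by rw [hρ]; infer_instance
  have : μ.HaveLebesgueDecomposition ρ := Measure.haveLebesgueDecomposition_of_sigmaFinite μ ρ
  have : ν.HaveLebesgueDecomposition ρ := Measure.haveLebesgueDecomposition_of_sigmaFinite ν ρ
  have hIμ : Integrable (fun x => (μ.rnDeriv ρ x).toReal) ρ := Measure.integrable_toReal_rnDeriv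
  have hIν : Integrable (fun x => (ν.rnDeriv ρ x).toReal) ρ := Measure.integrable_toReal_rnDeriv
  have hIμf : Integrable (fun x => (μ.rnDeriv ρ x).toReal • f x) ρ :=
    hIμ.smul_bdd 1 hf.aestronglyMeasurable (hf1.mono fun x hx => hx.le)
  have hIνf : Integrable (fun x => (ν.rnDeriv ρ x).toReal • f x) ρ :=
    hIν.smul_bdd 1 hf.aestronglyMeasurable (hf1.mono fun x hx => hx.le)
  have hae := hU.ae_eq_zero_of_integral_contDiff_smul_eq_zero
    (f := fun x => (μ.rnDeriv ρ x).toReal • f x - (ν.rnDeriv ρ x).toReal • f x)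
    ((hIμf.sub hIνf).locallyIntegrable.locallyIntegrableOn U)
    (fun φ hφ hφc hφU => by
      have h1 := integral_rnDeriv_smul hμρ (f := fun x => φ x • f x)
      have h2 := integral_rnDeriv_smul hνρ (f := fun x => φ x • f x)
      obtain ⟨C, hC⟩ := hφc.exists_bound_of_continuous hφ.continuous
      have h3 : Integrable (fun x => φ x • (μ.rnDeriv ρ x).toReal • f x) ρ :=
        hIμf.bdd_smul C hφ.continuous.aestronglyMeasurable (Eventually.of_forall hC)
      have h4 : Integrable (fun x => φ x • (ν.rnDeriv ρ x).toReal • f x) ρ :=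
        hIνf.bdd_smul C hφ.continuous.aestronglyMeasurable (Eventually.of_forall hC)
      simp only [smul_sub]
      rw [integral_sub h3 h4, sub_eq_zero]
      simp only [smul_comm (φ _)]
      rw [h1, h2, h φ hφ hφc hφU])
  have heq : μ.rnDeriv ρ =ᵐ[ρ.restrict U] ν.rnDeriv ρ := by
    rw [EventuallyEq, ae_restrict_iff' hU.measurableSet]
    filter_upwards [hae, hf1, μ.rnDeriv_lt_top ρ, ν.rnDeriv_lt_top ρ] with x hx h1 h2 h3 hxU
    have hfx : f x ≠ 0 := norm_ne_zero_iff.1 (by rw [h1]; exact one_ne_zero)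
    exact (ENNReal.toReal_eq_toReal_iff' h2.ne h3.ne).1
      (smul_left_injective ℝ hfx (sub_eq_zero.1 (hx hxU)))
  rw [← Measure.withDensity_rnDeriv_eq μ ρ hμρ, ← Measure.withDensity_rnDeriv_eq ν ρ hνρ,
    restrict_withDensity hU.measurableSet, restrict_withDensity hU.measurableSet]
  exact withDensity_congr_ae heq

/-! ### Measures with vanishing gradient -/

/-- The derivative of `t ↦ ∫ φ (x - t a) dρ` is an integral of the kind assumed to vanish, as long
as all the translates are supported in `U`. -/
theorem integral_comp_sub_eq_of_integral_fderiv_eq_zero {n : ℕ} {ρ : Measure (Vec n)}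
    [IsFiniteMeasure ρ] {U : Set (Vec n)}
    (h : ∀ φ : Vec n → ℝ, ContDiff ℝ ∞ φ → HasCompactSupport φ → tsupport φ ⊆ U → ∀ u,
      ∫ x, fderiv ℝ φ x u ∂ρ = 0) {φ : Vec n → ℝ} (hφ : ContDiff ℝ ∞ φ)
    (hφc : HasCompactSupport φ) {a : Vec n}
    (ha : ∀ t ∈ Icc (0 : ℝ) 1, ∀ x ∈ tsupport φ, x + t • a ∈ U) :
    ∫ x, φ (x - a) ∂ρ = ∫ x, φ x ∂ρ := by
  have hφ1 : ContDiff ℝ 1 φ := hφ.of_le (by exact_mod_cast le_top)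
  have hd : Differentiable ℝ φ := hφ1.differentiable one_ne_zero
  have hcd : Continuous fun x => fderiv ℝ φ x := hφ1.continuous_fderiv one_ne_zero
  obtain ⟨C, hC⟩ := hφc.exists_bound_of_continuous hφ.continuous
  obtain ⟨D, hD⟩ := (hφc.fderiv (𝕜 := ℝ)).exists_bound_of_continuous hcd
  have hderiv : ∀ t : ℝ, HasDerivAt (fun t : ℝ => ∫ x, φ (x - t • a) ∂ρ)
      (∫ x, -fderiv ℝ φ (x - t • a) a ∂ρ) t := by
    intro t
    refine (hasDerivAt_integral_of_dominated_loc_of_deriv_le (𝕜 := ℝ) (μ := ρ) (x₀ := t)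
      (F := fun (s : ℝ) x => φ (x - s • a)) (F' := fun (s : ℝ) x => -fderiv ℝ φ (x - s • a) a)
      (bound := fun _ => D * ‖a‖)
      (s := univ) univ_mem ?_ ?_ ?_ ?_ (integrable_const (μ := ρ) (D * ‖a‖)) ?_).2
    · exact Eventually.of_forall fun t =>
        (hφ.continuous.comp (by fun_prop : Continuous fun x => x - t • a)).aestronglyMeasurable
    · have hc : Continuous fun x => φ (x - t • a) := hφ.continuous.comp (by fun_prop)
      have h1 : Integrable (fun x => φ (x - t • a)) ρ :=
        Integrable.of_bound (C := C) hc.aestronglyMeasurable (Eventually.of_forall fun x => hC _)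
      exact h1
    · have hc : Continuous fun x => -fderiv ℝ φ (x - t • a) a :=
        ((hcd.comp (by fun_prop : Continuous fun x => x - t • a)).clm_apply continuous_const).neg
      exact hc.aestronglyMeasurable
    · refine Eventually.of_forall fun x s _ => ?_
      rw [norm_neg]
      exact ((fderiv ℝ φ (x - s • a)).le_opNorm a).trans
        (mul_le_mul_of_nonneg_right (hD _) (norm_nonneg a))
    · refine Eventually.of_forall fun x s _ => ?_
      have h1 : HasDerivAt (fun s : ℝ => x - s • a) (-a) s := by
        simpa using ((hasDerivAt_id s).smul_const a).const_sub x
      have h2 := (hd (x - s • a)).hasFDerivAt.comp_hasDerivAt s h1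
      simpa [Function.comp_def] using h2
  have hzero : ∀ t ∈ Icc (0 : ℝ) 1, ∫ x, -fderiv ℝ φ (x - t • a) a ∂ρ = 0 := by
    intro t ht
    have hcomp : tsupport (fun x => φ (x - t • a)) ⊆ U := by
      have h1 : tsupport (fun x => φ (x - t • a)) ⊆ (fun x => x - t • a) ⁻¹' tsupport φ :=
        tsupport_comp_subset_preimage φ (by fun_prop)
      intro x hx
      have := ha t ht _ (h1 hx)
      simpa using this
    have h2 := h (fun x => φ (x - t • a)) (hφ.comp (by fun_prop))
      (hφc.comp_homeomorph (Homeomorph.subRight (t • a))) hcomp a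
    have h3 : ∀ x, fderiv ℝ (fun x => φ (x - t • a)) x = fderiv ℝ φ (x - t • a) := fun x =>
      fderiv_comp_sub (f := φ) (t • a)
    simp only [h3] at h2
    rw [integral_neg, h2, neg_zero]
  have hconst := constant_of_has_deriv_right_zero
    (f := fun t : ℝ => ∫ x, φ (x - t • a) ∂ρ) (a := 0) (b := 1)
    (fun t _ => (hderiv t).continuousAt.continuousWithinAt)
    (fun t ht => by
      have := (hderiv t).hasDerivWithinAt (s := Ici t)
      rwa [hzero t ⟨ht.1, ht.2.le⟩] at this) 1 (right_mem_Icc.2 zero_le_one)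
  simpa using hconst

/-- A local version of the uniqueness of Haar measure: translation invariance and two applications
of Fubini to the products of `φ` with a bump `η` exchange the roles of `ρ` and Lebesgue measure.
Supports of radius `r` moved by at most `r` stay within `2 r < 3 r`. -/
theorem exists_integral_eq_mul_of_integral_fderiv_eq_zero {n : ℕ} {ρ : Measure (Vec n)}
    [IsFiniteMeasure ρ] {x₀ : Vec n} {r : ℝ} (hr : 0 < r)
    (h : ∀ φ : Vec n → ℝ, ContDiff ℝ ∞ φ → HasCompactSupport φ →
      tsupport φ ⊆ Metric.ball x₀ (3 * r) → ∀ u, ∫ x, fderiv ℝ φ x u ∂ρ = 0) :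
    ∃ c : ℝ, 0 ≤ c ∧ ∀ φ : Vec n → ℝ, ContDiff ℝ ∞ φ → HasCompactSupport φ →
      tsupport φ ⊆ Metric.ball x₀ r → ∫ x, φ x ∂ρ = ∫ x, c * φ x := by
  have htrans : ∀ φ : Vec n → ℝ, ContDiff ℝ ∞ φ → HasCompactSupport φ →
      tsupport φ ⊆ Metric.closedBall x₀ r → ∀ a : Vec n, ‖a‖ ≤ r →
        ∫ x, φ (x - a) ∂ρ = ∫ x, φ x ∂ρ := by
    intro φ hφ hφc hφs a ha
    refine integral_comp_sub_eq_of_integral_fderiv_eq_zero h hφ hφc fun t ht x hx => ?_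
    have h1 := mem_closedBall_iff_norm.1 (hφs hx)
    rw [mem_ball_iff_norm]
    calc ‖x + t • a - x₀‖ = ‖(x - x₀) + t • a‖ := by congr 1; abel
      _ ≤ ‖x - x₀‖ + ‖t • a‖ := norm_add_le _ _
      _ ≤ r + 1 * r := by
          rw [norm_smul, Real.norm_eq_abs, abs_of_nonneg ht.1]
          gcongr
          exact ht.2
      _ < 3 * r := by linarith
  let b : ContDiffBump (0 : Vec n) := ⟨r / 2, r, by linarith, by linarith⟩
  let η : Vec n → ℝ := b.normed volume
  have hη : ContDiff ℝ ∞ η := b.contDiff_normed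
  have hηc : HasCompactSupport η := b.hasCompactSupport_normed
  have hη0 : ∀ x, r < ‖x‖ → η x = 0 := by
    intro x hx
    have : x ∉ Function.support (b.normed volume) := by
      rw [b.support_normed_eq, mem_ball_zero_iff]
      exact not_lt.2 hx.le
    simpa using this
  -- The constant is the `ρ`-integral of a bump of mass one at `x₀`; by invariance its centre may be
  -- moved over the whole ball.
  refine ⟨∫ s, η (s - x₀) ∂ρ, integral_nonneg fun s => b.nonneg_normed _, fun φ hφ hφc hφs => ?_⟩
  have hint : Integrable (fun q : Vec n × Vec n => η q.1 * φ (q.2 - q.1)) (volume.prod ρ) := by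
    obtain ⟨C, hC⟩ := hφc.exists_bound_of_continuous hφ.continuous
    have h1 : Integrable (fun q : Vec n × Vec n => η q.1) (volume.prod ρ) :=
      (hη.continuous.integrable_of_hasCompactSupport hηc).comp_fst ρ
    exact h1.mul_bdd (c := C) (hφ.continuous.comp
      (by fun_prop : Continuous fun q : Vec n × Vec n => q.2 - q.1)).aestronglyMeasurable
      (Eventually.of_forall fun q => hC _)
  have hint2 : Integrable (fun q : Vec n × Vec n => φ q.1 * η (q.2 - q.1)) (volume.prod ρ) := by
    obtain ⟨C, hC⟩ := hηc.exists_bound_of_continuous hη.continuous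
    have h1 : Integrable (fun q : Vec n × Vec n => φ q.1) (volume.prod ρ) :=
      (hφ.continuous.integrable_of_hasCompactSupport hφc).comp_fst ρ
    exact h1.mul_bdd (c := C) (hη.continuous.comp
      (by fun_prop : Continuous fun q : Vec n × Vec n => q.2 - q.1)).aestronglyMeasurable
      (Eventually.of_forall fun q => hC _)
  calc ∫ x, φ x ∂ρ = ∫ x, η x * ∫ s, φ s ∂ρ := by
        rw [integral_mul_const, b.integral_normed, one_mul]
    _ = ∫ x, ∫ s, η x * φ (s - x) ∂ρ := by
        refine integral_congr_ae (Eventually.of_forall fun x => ?_)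
        simp only [integral_const_mul]
        by_cases hx : ‖x‖ ≤ r
        · rw [htrans φ hφ hφc (hφs.trans Metric.ball_subset_closedBall) x hx]
        · rw [hη0 x (not_le.1 hx), zero_mul, zero_mul]
    _ = ∫ s, (∫ x, η x * φ (s - x)) ∂ρ := integral_integral_swap hint
    _ = ∫ s, (∫ x, φ x * η (s - x)) ∂ρ := by
        refine integral_congr_ae (Eventually.of_forall fun s => ?_)
        have := integral_sub_left_eq_self (fun x => φ x * η (s - x)) volume s
        simp only [sub_sub_cancel] at this
        change ∫ x, η x * φ (s - x) = ∫ x, φ x * η (s - x)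
        rw [← this]
        simp only [mul_comm]
    _ = ∫ x, ∫ s, φ x * η (s - x) ∂ρ := (integral_integral_swap hint2).symm
    _ = ∫ x, (∫ s, η (s - x₀) ∂ρ) * φ x := by
        refine integral_congr_ae (Eventually.of_forall fun x => ?_)
        simp only [integral_const_mul]
        by_cases hx : x ∈ tsupport φ
        · have hxr := mem_ball_iff_norm.1 (hφs hx)
          have h1 := htrans (fun s => η (s - x₀)) (hη.comp (by fun_prop))
            (hηc.comp_homeomorph (Homeomorph.subRight x₀)) (by
              refine closure_minimal (fun s hs => ?_) Metric.isClosed_closedBall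
              rw [mem_closedBall_iff_norm]
              by_contra hlt
              exact hs (hη0 _ (not_le.1 hlt))) (x - x₀) hxr.le
          simp only [sub_sub, sub_add_cancel] at h1
          rw [h1, mul_comm]
        · rw [image_eq_zero_of_notMem_tsupport hx, zero_mul, mul_zero]

theorem inner_stdVec {n : ℕ} (x : Vec n) (k : Fin n) : inner ℝ x (stdVec k) = x k := by
  rw [EuclideanSpace.inner_single_right]
  simp

theorem exists_restrict_ball_eq_smul_volume {n : ℕ} {ρ : Measure (Vec n)}
    [IsFiniteMeasure ρ] {x₀ : Vec n} {r : ℝ} (hr : 0 < r)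
    (h : ∀ φ : Vec n → ℝ, ContDiff ℝ ∞ φ → HasCompactSupport φ →
      tsupport φ ⊆ Metric.ball x₀ (3 * r) → ∀ u, ∫ x, fderiv ℝ φ x u ∂ρ = 0) :
    ∃ c : ℝ≥0, ρ.restrict (Metric.ball x₀ r) = (c • volume).restrict (Metric.ball x₀ r) := by
  obtain ⟨c, hc, h⟩ := exists_integral_eq_mul_of_integral_fderiv_eq_zero hr h
  lift c to ℝ≥0 using hc
  refine ⟨c, ?_⟩
  have hfin : IsFiniteMeasure (volume.restrict (Metric.ball x₀ r)) :=
    ⟨by rw [Measure.restrict_apply_univ]; exact measure_ball_lt_top⟩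
  -- Scalar test functions are the case of a constant unit field with values in `ℝ¹`.
  have h1 := restrict_eq_of_forall_integral_smul_eq (μ := ρ)
    (ν := c • volume.restrict (Metric.ball x₀ r)) (U := Metric.ball x₀ r)
    Metric.isOpen_ball (f := fun _ => (stdVec 0 : Vec 1)) aemeasurable_const
    (Eventually.of_forall fun x => by simp) fun φ hφ hφc hφs => by
      rw [integral_smul_const, integral_smul_const, h φ hφ hφc hφs, integral_smul_nnreal_measure,
        setIntegral_eq_integral_of_forall_compl_eq_zero, integral_const_mul]
      · rfl
      · exact fun x hx => image_eq_zero_of_notMem_tsupport fun hx' => hx (hφs hx')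
  rw [h1, Measure.restrict_smul, Measure.restrict_smul,
    Measure.restrict_restrict measurableSet_ball, inter_self]

/-- A finite measure with vanishing gradient on a connected open set is a multiple of the Lebesgue
measure there. -/
theorem exists_restrict_eq_smul_volume {n : ℕ} {ρ : Measure (Vec n)} [IsFiniteMeasure ρ]
    {Ω : Set (Vec n)} (hΩo : IsOpen Ω) (hΩc : IsPreconnected Ω)
    (h : ∀ φ : Vec n → ℝ, ContDiff ℝ ∞ φ → HasCompactSupport φ → tsupport φ ⊆ Ω → ∀ u,
      ∫ x, fderiv ℝ φ x u ∂ρ = 0) :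
    ∃ c : ℝ≥0, ρ.restrict Ω = (c • volume).restrict Ω := by
  rcases Ω.eq_empty_or_nonempty with rfl | ⟨x₁, hx₁⟩
  · exact ⟨0, by simp⟩
  have hloc : ∀ x : Ω, ∃ (r : ℝ) (c : ℝ≥0), 0 < r ∧
      ρ.restrict (Metric.ball (x : Vec n) r) = (c • volume).restrict (Metric.ball (x : Vec n) r) := by
    rintro ⟨x, hx⟩
    obtain ⟨r, hr, hball⟩ := Metric.isOpen_iff.1 hΩo x hx
    obtain ⟨c, hc⟩ := exists_restrict_ball_eq_smul_volume (ρ := ρ) (x₀ := x) (r := r / 3)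
      (by positivity) fun φ hφ hφc hφs => h φ hφ hφc
        (hφs.trans (by rw [mul_div_cancel₀ _ (three_ne_zero)]; exact hball))
    exact ⟨r / 3, c, by positivity, hc⟩
  choose r c hr hc using hloc
  -- Nearby balls overlap in a nonempty open set of finite positive volume, which forces equal
  -- constants.
  have hlc : IsLocallyConstant c := by
    rw [IsLocallyConstant.iff_eventually_eq]
    intro x
    have hev : ∀ᶠ y : Ω in 𝓝 x, (y : Vec n) ∈ Metric.ball (x : Vec n) (r x) :=
      continuous_subtype_val.continuousAt.eventually_mem (Metric.ball_mem_nhds _ (hr x))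
    filter_upwards [hev] with y hy
    obtain ⟨W, hW⟩ : ∃ W, W = Metric.ball (x : Vec n) (r x) ∩ Metric.ball (y : Vec n) (r y) :=
      ⟨_, rfl⟩
    have hWo : IsOpen W := hW ▸ Metric.isOpen_ball.inter Metric.isOpen_ball
    have hWne : W.Nonempty := ⟨y, hW ▸ ⟨hy, Metric.mem_ball_self (hr y)⟩⟩
    have hWx : W ⊆ Metric.ball (x : Vec n) (r x) := hW ▸ inter_subset_left
    have hWy : W ⊆ Metric.ball (y : Vec n) (r y) := hW ▸ inter_subset_right
    have h1 := congrArg (fun ν => ν W) (hc x)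
    have h2 := congrArg (fun ν => ν W) (hc y)
    simp only [Measure.restrict_apply hWo.measurableSet, inter_eq_left.2 hWx,
      inter_eq_left.2 hWy] at h1 h2
    rw [h1] at h2
    have hpos := (hWo.measure_pos volume hWne).ne'
    have hfin : volume W ≠ ⊤ := ((measure_mono hWx).trans_lt measure_ball_lt_top).ne
    have h3 : (c x : ℝ≥0∞) * volume W = c y * volume W := h2
    exact_mod_cast ((ENNReal.mul_left_inj hpos hfin).1 h3).symm
  have : PreconnectedSpace Ω := Subtype.preconnectedSpace hΩc
  have hconst : ∀ x, c x = c ⟨x₁, hx₁⟩ := fun x => hlc.apply_eq_of_preconnectedSpace _ _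
  refine ⟨c ⟨x₁, hx₁⟩, ?_⟩
  obtain ⟨t, htc, ht⟩ := TopologicalSpace.countable_cover_nhds
    (f := fun x : Ω => Subtype.val ⁻¹' Metric.ball (x : Vec n) (r x))
    fun x => continuous_subtype_val.continuousAt.preimage_mem_nhds (Metric.ball_mem_nhds _ (hr x))
  refine Measure.restrict_congr_mono (t := ⋃ x ∈ t, Metric.ball (x : Vec n) (r x)) ?_ ?_
  · intro x hx
    have : (⟨x, hx⟩ : Ω) ∈ ⋃ x ∈ t, Subtype.val ⁻¹' Metric.ball (x : Vec n) (r x) := ht ▸ mem_univ _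
    simpa only [mem_iUnion, mem_preimage] using this
  · rw [Measure.restrict_biUnion_congr htc]
    intro x _
    rw [hc x, hconst x]

/-- A measure on a connected open set with vanishing gradient and the
mass of the Lebesgue measure is the Lebesgue measure. -/
theorem eq_restrict_volume_of_integral_fderiv_eq_zero {n : ℕ} {ρ : Measure (Vec n)}
    [IsFiniteMeasure ρ] {Ω : Set (Vec n)} (hΩo : IsOpen Ω) (hΩc : IsConnected Ω)
    (hρ : ∀ᵐ x ∂ρ, x ∈ Ω) (hmass : ρ univ = volume Ω)
    (h : ∀ φ : Vec n → ℝ, ContDiff ℝ ∞ φ → HasCompactSupport φ → tsupport φ ⊆ Ω → ∀ u,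
      ∫ x, fderiv ℝ φ x u ∂ρ = 0) :
    ρ = volume.restrict Ω := by
  obtain ⟨c, hc⟩ := exists_restrict_eq_smul_volume hΩo hΩc.isPreconnected h
  rw [Measure.restrict_eq_self_of_ae_mem hρ, Measure.restrict_smul] at hc
  have h1 : volume Ω = c * volume Ω := by
    have := congrArg (fun ν => ν univ) hc
    simp only [hmass, Measure.smul_apply, Measure.restrict_apply_univ] at this
    exact this
  have hpos := (hΩo.measure_pos volume hΩc.nonempty).ne'
  have hfin : volume Ω ≠ ⊤ := hmass ▸ measure_ne_top ρ univ
  have h2 : (1 : ℝ≥0∞) * volume Ω = c * volume Ω := by rw [one_mul, ← h1]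
  have h3 : (1 : ℝ≥0) = c := by exact_mod_cast (ENNReal.mul_left_inj hpos hfin).1 h2
  rw [hc, ← h3, one_smul]

/-- The surface measure is the only measure on the boundary for which the divergence theorem
holds. Here `N` is a measurable version of the exterior normal. -/
theorem eq_surfaceMeasure {n : ℕ} {Ω : Set (Vec n)} (hΩo : IsOpen Ω)
    (hΩb : Bornology.IsBounded Ω) (hΩl : HasLipschitzBoundary Ω) {N : Vec n → Vec n}
    (hN : Measurable N) (hNo : ∀ x, HasOuterNormal Ω x → N x = outerNormal Ω x)
    {β : Measure (Vec n)} [IsFiniteMeasure β] (hβ : ∀ᵐ x ∂β, ‖N x‖ = 1)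
    (h : ∀ φ : Vec n → ℝ, ContDiff ℝ ∞ φ → HasCompactSupport φ → ∀ k,
      ∫ x in Ω, fderiv ℝ φ x (stdVec k) = ∫ x, φ x * N x k ∂β) :
    β = surfaceMeasure Ω := by
  have := isFiniteMeasure_surfaceMeasure hΩo hΩb hΩl
  have hσ : ∀ᵐ x ∂surfaceMeasure Ω, ‖N x‖ = 1 :=
    (ae_hasOuterNormal hΩo hΩb hΩl).mono fun x hx => by rw [hNo x hx, hx.isOuterNormal.1]
  have hcomp : ∀ (τ : Measure (Vec n)) [IsFiniteMeasure τ], (∀ᵐ x ∂τ, ‖N x‖ = 1) →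
      ∀ φ : Vec n → ℝ, Continuous φ → HasCompactSupport φ → ∀ k : Fin n,
      (∫ x, φ x • N x ∂τ) k = ∫ x, φ x * N x k ∂τ := by
    intro τ _ hτ φ hφ hφc k
    obtain ⟨C, hC⟩ := hφc.exists_bound_of_continuous hφ
    have hint : Integrable (fun x => φ x • N x) τ := by
      refine Integrable.of_bound (C := C) (hφ.aestronglyMeasurable.smul
        hN.aestronglyMeasurable) (hτ.mono fun x hx => ?_)
      rw [norm_smul, hx, mul_one]
      exact hC x
    exact ((EuclideanSpace.proj (𝕜 := ℝ) k).integral_comp_comm hint).symm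
  -- The divergence theorem says that `β` and the surface measure give the same integrals against
  -- the field `N`, which has length one for both.
  have := restrict_eq_of_forall_integral_smul_eq (μ := β) (ν := surfaceMeasure Ω) isOpen_univ
    hN.aemeasurable (ae_add_measure_iff.2 ⟨hβ, hσ⟩) fun φ hφ hφc _ => by
      ext k
      rw [hcomp β hβ φ hφ.continuous hφc, hcomp _ hσ φ hφ.continuous
        hφc, ← h φ hφ hφc k, setIntegral_fderiv_eq_integral_outerNormal hΩo hΩb hΩl
        (hφ.of_le (by exact_mod_cast le_top))]
      refine integral_congr_ae ((ae_hasOuterNormal hΩo hΩb hΩl).mono fun x hx => ?_)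
      simp only [inner_stdVec, hNo x hx]
  simpa using this

/-! ### Mollification -/

/-- Translations are continuous in `L¹`. -/
theorem tendsto_lintegral_translate {n : ℕ} {F : Type*} [NormedAddCommGroup F]
    {Y : Vec n → F} (hY : Integrable Y) :
    Tendsto (fun a => ∫⁻ x, ‖Y (x - a) - Y x‖ₑ) (𝓝 0) (𝓝 0) := by
  have hYL : MemLp Y 1 := memLp_one_iff_integrable.2 hY
  have : Fact ((1 : ℝ≥0∞) ≠ ⊤) := ⟨ENNReal.one_ne_top⟩
  let y := hYL.toLp Y
  have h1 : Tendsto (fun a : Vec n => (DomAddAct.mk (-a)) +ᵥ y) (𝓝 0) (𝓝 y) := by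
    have hc : Continuous fun a : Vec n => (DomAddAct.mk (-a)) +ᵥ y :=
      (DomAddAct.continuous_mk.comp continuous_neg).vadd continuous_const
    have := hc.tendsto 0
    simpa using this
  have h2 : Tendsto (fun a : Vec n => ‖((DomAddAct.mk (-a)) +ᵥ y) - y‖ₑ) (𝓝 0) (𝓝 0) := by
    have := (h1.sub_const y).enorm
    simpa using this
  refine h2.congr fun a => ?_
  rw [Lp.enorm_def, eLpNorm_one_eq_lintegral_enorm]
  refine lintegral_congr_ae ?_
  have h3 : (fun x => y (-a + x)) =ᵐ[volume] fun x => Y (-a + x) :=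
    (quasiMeasurePreserving_add_left volume (-a)).ae_eq_comp hYL.coeFn_toLp
  filter_upwards [Lp.coeFn_sub ((DomAddAct.mk (-a)) +ᵥ y) y, hYL.coeFn_toLp, h3,
    DomAddAct.vadd_Lp_ae_eq (DomAddAct.mk (-a)) y] with x h4 h5 h6 h7
  rw [h4, Pi.sub_apply, h7]
  rw [Equiv.symm_apply_apply, vadd_eq_add]
  rw [h6, h5, neg_add_eq_sub]

open scoped Convolution

/-- The mollification `x ↦ ∫ ρ (x - s) • Y s`. -/
noncomputable def mollify {n : ℕ} {F : Type*} [NormedAddCommGroup F] [NormedSpace ℝ F]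
    (ρ : Vec n → ℝ) (Y : Vec n → F) : Vec n → F :=
  Y ⋆[(ContinuousLinearMap.lsmul ℝ ℝ).flip, volume] ρ

section Mollify

variable {n : ℕ} {F : Type*} [NormedAddCommGroup F] [NormedSpace ℝ F]
  {ρ : Vec n → ℝ} {Y : Vec n → F}

theorem mollify_apply (ρ : Vec n → ℝ) (Y : Vec n → F) (x : Vec n) :
    mollify ρ Y x = ∫ s, ρ (x - s) • Y s := rfl

theorem contDiff_mollify (hρ : ContDiff ℝ ∞ ρ) (hρc : HasCompactSupport ρ) (hY : Integrable Y) :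
    ContDiff ℝ ∞ (mollify ρ Y) :=
  hρc.contDiff_convolution_right _ hY.locallyIntegrable hρ

theorem fderiv_mollify (hρ : ContDiff ℝ ∞ ρ) (hρc : HasCompactSupport ρ) (hY : Integrable Y)
    (x u : Vec n) :
    fderiv ℝ (mollify ρ Y) x u = ∫ s, fderiv ℝ ρ (x - s) u • Y s := by
  have hρ1 : ContDiff ℝ 1 ρ := hρ.of_le (by exact_mod_cast le_top)
  have h := hρc.hasFDerivAt_convolution_right (ContinuousLinearMap.lsmul ℝ ℝ).flip
    (f := Y) hY.locallyIntegrable hρ1 x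
  rw [mollify, h.fderiv, convolution_precompR_apply _ hY.locallyIntegrable
    (hρc.fderiv (𝕜 := ℝ)) (hρ1.continuous_fderiv one_ne_zero)]
  rfl

/-- The error is an average, with weight `ρ`, of the translation differences `Y (· - a) - Y`, so
Fubini bounds its norm by the largest of theirs. -/
theorem lintegral_mollify_sub_le [CompleteSpace F] (hρ : Continuous ρ) (hρc : HasCompactSupport ρ)
    (hρ0 : ∀ x, 0 ≤ ρ x) (hρ1 : ∫ x, ρ x = 1) (hY : Integrable Y) {η : ℝ≥0∞}
    (hη : ∀ a, ρ a ≠ 0 → ∫⁻ x, ‖Y (x - a) - Y x‖ₑ ≤ η) :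
    ∫⁻ x, ‖mollify ρ Y x - Y x‖ₑ ≤ η := by
  have hint : Integrable ρ := hρ.integrable_of_hasCompactSupport hρc
  have hρl : ∫⁻ a, ‖ρ a‖ₑ = 1 := by
    have h1 := ofReal_integral_eq_lintegral_ofReal hint (Eventually.of_forall hρ0)
    rw [hρ1, ENNReal.ofReal_one] at h1
    rw [h1]
    exact lintegral_congr fun a => Real.enorm_of_nonneg (hρ0 a)
  have hpt : ∀ x, ‖mollify ρ Y x - Y x‖ₑ ≤ ∫⁻ a, ‖ρ a‖ₑ * ‖Y (x - a) - Y x‖ₑ := by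
    intro x
    have h1 : mollify ρ Y x = ∫ a, ρ a • Y (x - a) := by
      rw [mollify_apply, ← integral_sub_left_eq_self (fun s => ρ (x - s) • Y s) volume x]
      simp only [sub_sub_cancel]
    obtain ⟨C, hC⟩ := hρc.exists_bound_of_continuous hρ
    have h2 : Integrable fun a => ρ a • Y (x - a) :=
      (hY.comp_sub_left x).bdd_smul C hρ.aestronglyMeasurable (Eventually.of_forall hC)
    have h3 : mollify ρ Y x - Y x = ∫ a, ρ a • (Y (x - a) - Y x) := by
      simp only [smul_sub]
      rw [integral_sub h2 (hint.smul_const _), integral_smul_const, hρ1, one_smul, h1]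
    rw [h3]
    refine (enorm_integral_le_lintegral_enorm _).trans_eq ?_
    simp only [enorm_smul]
  have hYm : AEStronglyMeasurable (fun q : Vec n × Vec n => Y (q.1 - q.2)) (volume.prod volume) :=
    hY.aestronglyMeasurable.comp_quasiMeasurePreserving (quasiMeasurePreserving_sub volume volume)
  have hm : AEMeasurable (fun q : Vec n × Vec n => ‖ρ q.2‖ₑ * ‖Y (q.1 - q.2) - Y q.1‖ₑ)
      (volume.prod volume) :=
    (hρ.comp continuous_snd).aemeasurable.enorm.mul (hYm.sub hY.aestronglyMeasurable.comp_fst).enorm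
  calc ∫⁻ x, ‖mollify ρ Y x - Y x‖ₑ
      ≤ ∫⁻ x, ∫⁻ a, ‖ρ a‖ₑ * ‖Y (x - a) - Y x‖ₑ := lintegral_mono hpt
    _ = ∫⁻ a, ∫⁻ x, ‖ρ a‖ₑ * ‖Y (x - a) - Y x‖ₑ := lintegral_lintegral_swap hm
    _ = ∫⁻ a, ‖ρ a‖ₑ * ∫⁻ x, ‖Y (x - a) - Y x‖ₑ := by
        simp only [lintegral_const_mul' _ _ enorm_ne_top]
    _ ≤ ∫⁻ a, ‖ρ a‖ₑ * η := by
        refine lintegral_mono fun a => ?_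
        by_cases ha : ρ a = 0
        · simp [ha]
        · exact mul_le_mul_right (hη a ha) _
    _ = η := by
        rw [lintegral_mul_const _ (by fun_prop), hρl, one_mul]

end Mollify

/-! ### The cone property of Lipschitz domains -/

/-- Translations in a direction close to that of the graph move the closure of the domain into
the domain. -/
theorem exists_cone {n : ℕ} {Ω : Set (Vec n)} (hΩo : IsOpen Ω) (hΩl : HasLipschitzBoundary Ω)
    {x₀ : Vec n} (hx₀ : x₀ ∈ closure Ω) : ∃ (v : Vec n) (r δ : ℝ), 0 < r ∧ 0 < δ ∧
      ∀ x ∈ closure Ω, ∀ ε ∈ Ioo 0 δ, ∀ t ∈ Metric.ball (ε • v) (ε * δ),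
        x - t ∈ Metric.ball x₀ r → x - t ∈ Ω := by
  by_cases hx : x₀ ∈ Ω
  · obtain ⟨r, hr, hball⟩ := Metric.isOpen_iff.1 hΩo x₀ hx
    -- At an interior point no direction is needed: the ball already lies in `Ω`.
    exact ⟨0, r, 1, hr, one_pos, fun x _ ε _ t _ h => hball h⟩
  obtain ⟨v, γ, K, r, hv, hγ, hγv, hr, hΩ⟩ := hΩl x₀ ⟨hx₀, by rwa [hΩo.interior_eq]⟩
  have hle : ∀ x ∈ closure Ω, x ∈ Metric.ball x₀ r → inner ℝ v x ≤ γ x := by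
    intro x hx hxr
    have h1 : x ∈ closure (Ω ∩ Metric.ball x₀ r) := by
      rw [inter_comm]
      exact Metric.isOpen_ball.inter_closure ⟨hxr, hx⟩
    refine closure_minimal (s := Ω ∩ Metric.ball x₀ r) (t := {x | inner ℝ v x ≤ γ x}) ?_
      (isClosed_le (by fun_prop) hγ.continuous) h1
    exact fun y hy => ((hΩ y hy.2).1 hy.1).le
  -- The first condition makes the descent, at least `ε (1 - δ)`, exceed the possible change `K ε δ`
  -- of `γ`. The second keeps `x` in the chart when `x - t` is in the half ball.
  obtain ⟨δ, hδ0, hδK, hδr⟩ : ∃ δ : ℝ, 0 < δ ∧ (K + 1) * δ < 1 ∧ δ * (1 + δ) < r / 2 := by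
    have h1 : ∀ᶠ δ : ℝ in 𝓝 0, (K + 1) * δ < 1 :=
      (by fun_prop : Continuous fun δ : ℝ => (K + 1) * δ).continuousAt.eventually_lt_const (by simp)
    have h2 : ∀ᶠ δ : ℝ in 𝓝 0, δ * (1 + δ) < r / 2 :=
      (by fun_prop : Continuous fun δ : ℝ => δ * (1 + δ)).continuousAt.eventually_lt_const
        (by simpa using hr)
    obtain ⟨δ, ⟨h3, h4⟩, h5⟩ := (((h1.and h2).filter_mono nhdsWithin_le_nhds).and
      (self_mem_nhdsWithin (s := Ioi (0 : ℝ)))).exists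
    exact ⟨δ, h5, h3, h4⟩
  refine ⟨v, r / 2, δ, by positivity, hδ0, fun x hxc ε hε t ht hxt => ?_⟩
  rw [mem_ball_iff_norm] at ht hxt
  have htn : ‖t‖ < r / 2 := by
    have h1 : ‖t‖ ≤ ‖t - ε • v‖ + ‖ε • v‖ := by
      simpa using norm_add_le (t - ε • v) (ε • v)
    rw [norm_smul, hv, mul_one, Real.norm_eq_abs, abs_of_pos hε.1] at h1
    nlinarith [hε.1, hε.2]
  have hxr : x ∈ Metric.ball x₀ r := by
    rw [mem_ball_iff_norm]
    calc ‖x - x₀‖ = ‖(x - t - x₀) + t‖ := by congr 1; abel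
      _ ≤ ‖x - t - x₀‖ + ‖t‖ := norm_add_le _ _
      _ < r := by linarith
  have hxtr : x - t ∈ Metric.ball x₀ r := by rw [mem_ball_iff_norm]; linarith
  rw [hΩ _ hxtr]
  have h1 := hle x hxc hxr
  have h2 : γ (x - t) = γ (x - (t - ε • v)) := by
    rw [← hγv (x - t) ε]
    congr 1
    abel
  have h3 : γ x - K * ‖t - ε • v‖ ≤ γ (x - t) := by
    have h4 := hγ.dist_le_mul x (x - (t - ε • v))
    rw [Real.dist_eq, dist_eq_norm, sub_sub_cancel, ← h2] at h4
    linarith [le_abs_self (γ x - γ (x - t))]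
  have h4 : inner ℝ v t = ε + inner ℝ v (t - ε • v) := by
    rw [inner_sub_right, real_inner_smul_right, real_inner_self_eq_norm_sq, hv]
    ring
  have h5 : -‖t - ε • v‖ ≤ inner ℝ v (t - ε • v) := by
    have := abs_real_inner_le_norm v (t - ε • v)
    rw [hv, one_mul] at this
    exact (abs_le.1 this).1
  rw [inner_sub_right]
  have h6 : (K : ℝ) * ‖t - ε • v‖ ≤ K * (ε * δ) := mul_le_mul_of_nonneg_left ht.le K.2
  nlinarith [hε.1]

/-! ### Density of smooth functions in `W^{1,1}` -/

theorem IntegrableOn.continuous_smul {n : ℕ} {F : Type*} [NormedAddCommGroup F] [NormedSpace ℝ F]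
    {Ω : Set (Vec n)} {y : Vec n → F} (hy : IntegrableOn y Ω) {φ : Vec n → ℝ} (hφ : Continuous φ)
    (hφc : HasCompactSupport φ) : IntegrableOn (fun x => φ x • y x) Ω := by
  obtain ⟨C, hC⟩ := hφc.exists_bound_of_continuous hφ
  exact Integrable.bdd_smul hy C hφ.aestronglyMeasurable (Eventually.of_forall hC)

/-- Extension by zero usually destroys the weak derivative at the boundary. Here the support of `ρ`
is shifted so that `s ↦ ρ (x - s) χ s` is supported in `Ω`; it is then an admissible test function,
and the extension is never felt. -/
theorem fderiv_mollify_of_isWeakDeriv {n m : ℕ} {Ω : Set (Vec n)} (hΩo : IsOpen Ω)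
    {y : Vec n → Vec m} {z : Vec n → Mat m n} (hy : IntegrableOn y Ω)
    (hz : ∀ k, IntegrableOn (fun x => z x k) Ω) (hw : IsWeakDeriv Ω y z) {χ ρ : Vec n → ℝ}
    (hχ : ContDiff ℝ ∞ χ) (hχc : HasCompactSupport χ) (hρ : ContDiff ℝ ∞ ρ)
    (hρc : HasCompactSupport ρ) {x : Vec n}
    (hx : ∀ t ∈ tsupport ρ, x - t ∈ tsupport χ → x - t ∈ Ω) (k : Fin n) :
    fderiv ℝ (mollify ρ (Ω.indicator fun s => χ s • y s)) x (stdVec k) =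
      mollify ρ (Ω.indicator fun s => fderiv ℝ χ s (stdVec k) • y s + χ s • z s k) x := by
  have hχ1 : ContDiff ℝ 1 χ := hχ.of_le (by exact_mod_cast le_top)
  have hρ1 : ContDiff ℝ 1 ρ := hρ.of_le (by exact_mod_cast le_top)
  have hρx : ContDiff ℝ ∞ fun s => ρ (x - s) := hρ.comp (by fun_prop)
  have hρx1 : ContDiff ℝ 1 fun s => ρ (x - s) := hρ1.comp (by fun_prop)
  have hρd : Continuous fun s => fderiv ℝ ρ (x - s) (stdVec k) :=
    ((hρ1.continuous_fderiv one_ne_zero).comp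
      (by fun_prop : Continuous fun s => x - s)).clm_apply continuous_const
  have hχd : Continuous fun s => fderiv ℝ χ s (stdVec k) :=
    (hχ1.continuous_fderiv one_ne_zero).clm_apply continuous_const
  have hχdc : HasCompactSupport fun s => fderiv ℝ χ s (stdVec k) := hχc.fderiv_apply (𝕜 := ℝ) _
  have hd : ∀ s, fderiv ℝ (fun s => ρ (x - s) * χ s) s (stdVec k)
      = ρ (x - s) * fderiv ℝ χ s (stdVec k) - fderiv ℝ ρ (x - s) (stdVec k) * χ s := by
    intro s
    have h1 : HasFDerivAt (fun s => ρ (x - s)) (-fderiv ℝ ρ (x - s)) s := by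
      have h2 := (hρ1.differentiable one_ne_zero (x - s)).hasFDerivAt.comp s
        ((hasFDerivAt_id s).const_sub x)
      simpa [Function.comp_def] using h2
    have h3 : HasFDerivAt (fun s => ρ (x - s) * χ s) _ s :=
      h1.mul (hχ1.differentiable one_ne_zero s).hasFDerivAt
    rw [h3.fderiv]
    simp
    ring
  have hts : tsupport (fun s => ρ (x - s) * χ s) ⊆ Ω := by
    intro s hs
    have h1 : s ∈ tsupport χ := tsupport_mul_subset_right (f := fun s => ρ (x - s)) (g := χ) hs
    have h2 : s ∈ tsupport fun s => ρ (x - s) :=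
      tsupport_mul_subset_left (f := fun s => ρ (x - s)) (g := χ) hs
    have h3 : x - s ∈ tsupport ρ :=
      tsupport_comp_subset_preimage ρ (by fun_prop : Continuous fun s => x - s) h2
    have := hx _ h3
    rw [sub_sub_cancel] at this
    exact this h1
  have hweak := hw (fun s => ρ (x - s) * χ s) (hρx.mul hχ) hχc.mul_left hts k
  have hI1 : IntegrableOn (fun s => (ρ (x - s) * fderiv ℝ χ s (stdVec k)) • y s) Ω :=
    IntegrableOn.continuous_smul hy (hρx.continuous.mul hχd) hχdc.mul_left
  have hI2 : IntegrableOn (fun s => (fderiv ℝ ρ (x - s) (stdVec k) * χ s) • y s) Ω :=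
    IntegrableOn.continuous_smul hy (hρd.mul hχ1.continuous) hχc.mul_left
  have hI3 : IntegrableOn (fun s => (ρ (x - s) * χ s) • z s k) Ω :=
    IntegrableOn.continuous_smul (hz k) (hρx.continuous.mul hχ1.continuous) hχc.mul_left
  simp only [hd, sub_smul] at hweak
  rw [integral_sub hI1 hI2] at hweak
  have hYi : Integrable (Ω.indicator fun s => χ s • y s) :=
    (integrable_indicator_iff hΩo.measurableSet).2
      (IntegrableOn.continuous_smul hy hχ1.continuous hχc)
  rw [fderiv_mollify hρ hρc hYi, mollify_apply]
  have e1 : ∀ s, fderiv ℝ ρ (x - s) (stdVec k) • Ω.indicator (fun s => χ s • y s) s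
      = Ω.indicator (fun s => (fderiv ℝ ρ (x - s) (stdVec k) * χ s) • y s) s := by
    intro s
    by_cases hs : s ∈ Ω <;> simp [hs, mul_smul]
  have e2 : ∀ s, ρ (x - s) • Ω.indicator
      (fun s => fderiv ℝ χ s (stdVec k) • y s + χ s • z s k) s
      = Ω.indicator (fun s => (ρ (x - s) * fderiv ℝ χ s (stdVec k)) • y s
        + (ρ (x - s) * χ s) • z s k) s := by
    intro s
    by_cases hs : s ∈ Ω <;> simp [hs, mul_smul]
  simp only [e1, e2]
  rw [integral_indicator hΩo.measurableSet, integral_indicator hΩo.measurableSet,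
    integral_add hI1 hI3]
  have aux : ∀ a b c : Vec m, a - b = -c → b = a + c := fun a b c h => by
    rw [← neg_neg c, ← h]
    abel
  exact aux _ _ _ hweak

/-- Local approximation by smooth functions, near a point where the cone property holds. -/
theorem exists_contDiff_approx_of_cone {n m : ℕ} {Ω : Set (Vec n)} (hΩo : IsOpen Ω)
    {y : Vec n → Vec m} {z : Vec n → Mat m n} (hy : IntegrableOn y Ω)
    (hz : ∀ k, IntegrableOn (fun x => z x k) Ω) (hw : IsWeakDeriv Ω y z)
    {x₀ v : Vec n} {r δ : ℝ} (hδ : 0 < δ)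
    (hcone : ∀ x ∈ closure Ω, ∀ ε ∈ Ioo 0 δ, ∀ t ∈ Metric.ball (ε • v) (ε * δ),
        x - t ∈ Metric.ball x₀ r → x - t ∈ Ω)
    {χ : Vec n → ℝ} (hχ : ContDiff ℝ ∞ χ) (hχc : HasCompactSupport χ)
    (hχs : tsupport χ ⊆ Metric.ball x₀ r) {η : ℝ≥0∞} (hη : 0 < η) :
    ∃ f : Vec n → Vec m, ContDiff ℝ ∞ f ∧ ∫⁻ x in Ω, ‖f x - χ x • y x‖ₑ ≤ η ∧
      ∀ k, ∫⁻ x in Ω, ‖fderiv ℝ f x (stdVec k)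
        - (fderiv ℝ χ x (stdVec k) • y x + χ x • z x k)‖ₑ ≤ η := by
  have hχ1 : ContDiff ℝ 1 χ := hχ.of_le (by exact_mod_cast le_top)
  obtain ⟨Y, hY⟩ : ∃ Y, Y = Ω.indicator fun s => χ s • y s := ⟨_, rfl⟩
  obtain ⟨Z, hZ⟩ : ∃ Z : Fin n → Vec n → Vec m, Z = fun k =>
    Ω.indicator fun s => fderiv ℝ χ s (stdVec k) • y s + χ s • z s k := ⟨_, rfl⟩
  have hYi : Integrable Y := by
    rw [hY, integrable_indicator_iff hΩo.measurableSet]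
    exact IntegrableOn.continuous_smul hy hχ1.continuous hχc
  have hZi : ∀ k, Integrable (Z k) := by
    intro k
    simp only [hZ]
    rw [integrable_indicator_iff hΩo.measurableSet]
    refine Integrable.add (IntegrableOn.continuous_smul hy ?_ (hχc.fderiv_apply (𝕜 := ℝ) _))
      (IntegrableOn.continuous_smul (hz k) hχ1.continuous hχc)
    exact (hχ1.continuous_fderiv one_ne_zero).clm_apply continuous_const
  have hev : ∀ᶠ a : Vec n in 𝓝 0, (∫⁻ x, ‖Y (x - a) - Y x‖ₑ ≤ η) ∧
      ∀ k, ∫⁻ x, ‖Z k (x - a) - Z k x‖ₑ ≤ η :=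
    (((tendsto_lintegral_translate hYi).eventually_lt_const hη).mono fun _ h => h.le).and
      (eventually_all.2 fun k =>
        ((tendsto_lintegral_translate (hZi k)).eventually_lt_const hη).mono fun _ h => h.le)
  obtain ⟨κ, hκ, hball⟩ := Metric.eventually_nhds_iff_ball.1 hev
  -- The bump will live in the ball about `ε v` of radius `ε δ`: the cone property holds there, and
  -- the last bound places it within `κ` of the origin, where translations are harmless.
  obtain ⟨ε, hε0, hεδ, hεκ⟩ : ∃ ε : ℝ, 0 < ε ∧ ε < δ ∧ ε * (‖v‖ + δ) < κ := by
    have hN : 0 < ‖v‖ + δ := by positivity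
    refine ⟨min (δ / 2) (κ / (2 * (‖v‖ + δ))), by positivity,
      (min_le_left _ _).trans_lt (by linarith), ?_⟩
    calc min (δ / 2) (κ / (2 * (‖v‖ + δ))) * (‖v‖ + δ)
        ≤ κ / (2 * (‖v‖ + δ)) * (‖v‖ + δ) := by gcongr; exact min_le_right _ _
      _ = κ / 2 := by field_simp
      _ < κ := by linarith
  have hεδ0 : 0 < ε * δ := by positivity
  let b : ContDiffBump (ε • v) := ⟨ε * δ / 4, ε * δ / 2, by linarith, by linarith⟩
  obtain ⟨ρ, hρdef⟩ : ∃ ρ, ρ = b.normed volume := ⟨_, rfl⟩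
  have hρ : ContDiff ℝ ∞ ρ := hρdef ▸ b.contDiff_normed
  have hρc : HasCompactSupport ρ := hρdef ▸ b.hasCompactSupport_normed
  have hρ0 : ∀ x, 0 ≤ ρ x := fun x => hρdef ▸ b.nonneg_normed x
  have hρ1 : ∫ x, ρ x = 1 := hρdef ▸ b.integral_normed
  have hρs : tsupport ρ ⊆ Metric.ball (ε • v) (ε * δ) := by
    rw [hρdef, b.tsupport_normed_eq]
    exact Metric.closedBall_subset_ball (by change ε * δ / 2 < ε * δ; linarith)
  have hρκ : ∀ a, ρ a ≠ 0 → a ∈ Metric.ball (0 : Vec n) κ := by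
    intro a ha
    have h1 := mem_ball_iff_norm.1 (hρs (subset_tsupport ρ ha))
    rw [mem_ball_zero_iff]
    calc ‖a‖ ≤ ‖a - ε • v‖ + ‖ε • v‖ := by simpa using norm_add_le (a - ε • v) (ε • v)
      _ ≤ ε * δ + ε * ‖v‖ := by
          rw [norm_smul, Real.norm_eq_abs, abs_of_pos hε0]
          linarith
      _ < κ := by linarith
  refine ⟨mollify ρ Y, contDiff_mollify hρ hρc hYi, ?_, fun k => ?_⟩
  · refine le_trans ?_ (lintegral_mollify_sub_le hρ.continuous hρc hρ0 hρ1 hYi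
      fun a ha => (hball a (hρκ a ha)).1)
    refine (setLIntegral_congr_fun hΩo.measurableSet fun x hx => ?_).trans_le
      (setLIntegral_le_lintegral Ω _)
    simp only [hY, indicator_of_mem hx]
  · refine le_trans ?_ (lintegral_mollify_sub_le hρ.continuous hρc hρ0 hρ1 (hZi k)
      fun a ha => (hball a (hρκ a ha)).2 k)
    refine (setLIntegral_congr_fun hΩo.measurableSet fun x hx => ?_).trans_le
      (setLIntegral_le_lintegral Ω _)
    have h1 := fderiv_mollify_of_isWeakDeriv hΩo hy hz hw hχ hχc hρ hρc (x := x)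
      (fun t ht hxt => hcone x (subset_closure hx) ε ⟨hε0, hεδ⟩ t (hρs ht) (hχs hxt)) k
    simp only [hY, hZ, indicator_of_mem hx] at h1 ⊢
    rw [h1]

/-- Functions in `W^{1,1}` of a bounded Lipschitz domain can be approximated by functions that are
smooth on the whole space. -/
theorem exists_contDiff_approx {n m : ℕ} {Ω : Set (Vec n)} (hΩo : IsOpen Ω)
    (hΩb : Bornology.IsBounded Ω) (hΩl : HasLipschitzBoundary Ω)
    {y : Vec n → Vec m} {z : Vec n → Mat m n} (hy : IntegrableOn y Ω)
    (hz : ∀ k, IntegrableOn (fun x => z x k) Ω) (hw : IsWeakDeriv Ω y z) {η : ℝ≥0∞} (hη : 0 < η) :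
    ∃ f : Vec n → Vec m, ContDiff ℝ ∞ f ∧ ∫⁻ x in Ω, ‖f x - y x‖ₑ ≤ η ∧
      ∀ k, ∫⁻ x in Ω, ‖fderiv ℝ f x (stdVec k) - z x k‖ₑ ≤ η := by
  have hex : ∀ x : Vec n, ∃ (v : Vec n) (r δ : ℝ), 0 < r ∧ 0 < δ ∧ (x ∈ closure Ω →
      ∀ x' ∈ closure Ω, ∀ ε ∈ Ioo 0 δ, ∀ t ∈ Metric.ball (ε • v) (ε * δ),
        x' - t ∈ Metric.ball x r → x' - t ∈ Ω) := by
    intro x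
    by_cases hx : x ∈ closure Ω
    · obtain ⟨v, r, δ, hr, hδ, h⟩ := exists_cone hΩo hΩl hx
      exact ⟨v, r, δ, hr, hδ, fun _ => h⟩
    · exact ⟨0, 1, 1, one_pos, one_pos, fun h => absurd h hx⟩
  choose v r δ hr hδ hcone using hex
  obtain ⟨J, _, c, χ, hcS, hχ, hχc, hχs, -, -, hsum⟩ :=
    exists_smooth_partition hΩb.isCompact_closure (r := r) fun x _ => hr x
  have hη' : 0 < η / (Fintype.card J + 1) :=
    ENNReal.div_pos hη.ne' (by exact_mod_cast ENNReal.natCast_ne_top (Fintype.card J + 1))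
  choose f hf hf0 hf1 using fun j => exists_contDiff_approx_of_cone hΩo hy hz hw (hδ (c j))
    (hcone (c j) (hcS j)) (hχ j) (hχc j) (hχs j) hη'
  have hχ1 : ∀ j, ContDiff ℝ 1 (χ j) := fun j => (hχ j).of_le (by exact_mod_cast le_top)
  have hfd1 : ∀ j, ContDiff ℝ 1 (f j) := fun j => (hf j).of_le (by exact_mod_cast le_top)
  have hcard : ∑ _j : J, η / (Fintype.card J + 1) ≤ η := by
    rw [Finset.sum_const, Finset.card_univ, nsmul_eq_mul]
    calc (Fintype.card J : ℝ≥0∞) * (η / (Fintype.card J + 1))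
        ≤ (Fintype.card J + 1) * (η / (Fintype.card J + 1)) := by gcongr; exact le_self_add
      _ ≤ η := ENNReal.mul_div_le
  have key : ∀ (g : J → Vec n → Vec m) (G : Vec n → Vec m),
      (∀ j, AEStronglyMeasurable (g j) (volume.restrict Ω)) → (∀ x ∈ Ω, G x = ∑ j, g j x) →
      (∀ j, ∫⁻ x in Ω, ‖g j x‖ₑ ≤ η / (Fintype.card J + 1)) → ∫⁻ x in Ω, ‖G x‖ₑ ≤ η := by
    intro g G hg hG hle
    calc ∫⁻ x in Ω, ‖G x‖ₑ = ∫⁻ x in Ω, ‖∑ j, g j x‖ₑ :=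
          setLIntegral_congr_fun hΩo.measurableSet fun x hx => by simp only [hG x hx]
      _ ≤ ∫⁻ x in Ω, ∑ j, ‖g j x‖ₑ := lintegral_mono fun x => enorm_sum_le _ _
      _ = ∑ j, ∫⁻ x in Ω, ‖g j x‖ₑ := lintegral_finsetSum' _ fun j _ => (hg j).enorm
      _ ≤ _ := (Finset.sum_le_sum fun j _ => hle j).trans hcard
  have hcd : ∀ j k, Continuous fun x => fderiv ℝ (χ j) x (stdVec k) := fun j k =>
    ((hχ1 j).continuous_fderiv one_ne_zero).clm_apply continuous_const
  refine ⟨fun x => ∑ j, f j x, ContDiff.sum fun j _ => hf j, ?_, fun k => ?_⟩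
  · refine key (fun j x => f j x - χ j x • y x) _ (fun j => ?_) (fun x hx => ?_) hf0
    · exact (hf j).continuous.aestronglyMeasurable.sub
        (IntegrableOn.continuous_smul hy (hχ j).continuous (hχc j)).aestronglyMeasurable
    · rw [Finset.sum_sub_distrib, ← Finset.sum_smul, hsum x (subset_closure hx), one_smul]
  · refine key (fun j x => fderiv ℝ (f j) x (stdVec k)
      - (fderiv ℝ (χ j) x (stdVec k) • y x + χ j x • z x k)) _ (fun j => ?_) (fun x hx => ?_)
      fun j => hf1 j k
    · have h1 : Continuous fun x => fderiv ℝ (f j) x (stdVec k) :=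
        ((hfd1 j).continuous_fderiv one_ne_zero).clm_apply continuous_const
      exact h1.aestronglyMeasurable.sub
        ((IntegrableOn.continuous_smul hy (hcd j k)
          ((hχc j).fderiv_apply (𝕜 := ℝ) _)).aestronglyMeasurable.add
        (IntegrableOn.continuous_smul (hz k) (hχ j).continuous (hχc j)).aestronglyMeasurable)
    · have h1 : fderiv ℝ (fun x => ∑ j, f j x) x (stdVec k)
          = ∑ j, fderiv ℝ (f j) x (stdVec k) := by
        rw [fderiv_fun_sum fun j _ => (hfd1 j).differentiable one_ne_zero x, sum_apply]
      -- The partition is constant near `x`, so the product rule terms with derivatives of the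
      -- cut-offs cancel.
      have h2 : ∑ j, fderiv ℝ (χ j) x (stdVec k) = 0 := by
        have h3 : (fun x => ∑ j, χ j x) =ᶠ[𝓝 x] fun _ => 1 := by
          filter_upwards [hΩo.mem_nhds hx] with x' hx' using hsum x' (subset_closure hx')
        have h4 := h3.fderiv_eq (𝕜 := ℝ)
        rw [fderiv_fun_sum fun j _ => (hχ1 j).differentiable one_ne_zero x] at h4
        rw [← sum_apply, h4]
        simp
      rw [h1, Finset.sum_sub_distrib, Finset.sum_add_distrib, ← Finset.sum_smul, ← Finset.sum_smul,
        h2, hsum x (subset_closure hx), zero_smul, one_smul, zero_add]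

/-! ### The trace inequality -/

/-- Otherwise `w = v - (δ / 2) ν` would still be a direction of the cone with `⟪w, ν⟫ < 0`: the cone
property puts `x - ε w` into `Ω`, while the normal keeps it out for small `ε`. -/
theorem le_inner_of_cone {n : ℕ} {Ω : Set (Vec n)} {x₀ v x ν : Vec n} {r δ : ℝ} (hδ : 0 < δ)
    (hcone : ∀ x ∈ closure Ω, ∀ ε ∈ Ioo 0 δ, ∀ t ∈ Metric.ball (ε • v) (ε * δ),
        x - t ∈ Metric.ball x₀ r → x - t ∈ Ω)
    (hx : x ∈ closure Ω) (hxr : x ∈ Metric.ball x₀ r) (hν : IsOuterNormal Ω x ν) :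
    δ / 2 ≤ inner ℝ v ν := by
  by_contra! hlt
  obtain ⟨w, hw⟩ : ∃ w, w = v - (δ / 2) • ν := ⟨_, rfl⟩
  have hwν : inner ℝ w ν < 0 := by
    rw [hw, inner_sub_left, real_inner_smul_left, real_inner_self_eq_norm_sq, hν.1]
    linarith
  have hwv : ‖w - v‖ < δ := by
    rw [hw, sub_sub_cancel_left, norm_neg, norm_smul, hν.1, Real.norm_eq_abs,
      abs_of_pos (by positivity)]
    linarith
  obtain ⟨ε', hε', hε'w⟩ : ∃ ε' : ℝ, 0 < ε' ∧ ε' * ‖w‖ < -inner ℝ w ν := by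
    refine ⟨-inner ℝ w ν / (2 * (‖w‖ + 1)), div_pos (by linarith) (by positivity), ?_⟩
    rw [div_mul_eq_mul_div, div_lt_iff₀ (by positivity)]
    nlinarith [norm_nonneg w]
  have hcont : Tendsto (fun ε : ℝ => x - ε • w) (𝓝[>] 0) (𝓝 x) := by
    have h1 : Continuous fun ε : ℝ => x - ε • w := by fun_prop
    have h2 := h1.tendsto 0
    simp only [zero_smul, sub_zero] at h2
    exact h2.mono_left nhdsWithin_le_nhds
  obtain ⟨ε, ⟨⟨h1, h2⟩, hε0⟩, hεδ⟩ := (((hcont.eventually (hν.2 ε' hε')).and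
    (hcont.eventually (Metric.isOpen_ball.mem_nhds hxr))).and
    (self_mem_nhdsWithin (s := Ioi (0 : ℝ)))).and
    (nhdsWithin_le_nhds (Iio_mem_nhds hδ)) |>.exists
  have hε0 : 0 < ε := hε0
  refine h1.2 ?_ (hcone x hx ε ⟨hε0, hεδ⟩ (ε • w) ?_ h2)
  · rw [sub_sub_cancel_left, norm_neg, inner_neg_left, real_inner_smul_left, norm_smul,
      Real.norm_eq_abs, abs_of_pos hε0]
    nlinarith
  · rw [mem_ball_iff_norm, ← smul_sub, norm_smul, Real.norm_eq_abs, abs_of_pos hε0]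
    exact mul_lt_mul_of_pos_left hwv hε0

theorem integrableOn_of_continuous {n : ℕ} {F : Type*} [NormedAddCommGroup F] {Ω : Set (Vec n)}
    (hΩb : Bornology.IsBounded Ω) {f : Vec n → F} (hf : Continuous f) : IntegrableOn f Ω :=
  (hf.continuousOn.integrableOn_compact hΩb.isCompact_closure).mono_set subset_closure

theorem integrable_surfaceMeasure_of_continuous {n : ℕ} {F : Type*} [NormedAddCommGroup F]
    {Ω : Set (Vec n)} (hΩo : IsOpen Ω) (hΩb : Bornology.IsBounded Ω)
    (hΩl : HasLipschitzBoundary Ω) {f : Vec n → F} (hf : Continuous f) :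
    Integrable f (surfaceMeasure Ω) := by
  have := isFiniteMeasure_surfaceMeasure hΩo hΩb hΩl
  obtain ⟨C, hC⟩ := (isCompact_frontier_of_isBounded hΩb).exists_bound_of_continuousOn
    hf.continuousOn
  exact Integrable.of_bound (C := C) hf.aestronglyMeasurable
    (ae_mem_frontier.mono fun x hx => hC x hx)

theorem apply_eq_sum_stdVec {n : ℕ} {F : Type*} [NormedAddCommGroup F] [NormedSpace ℝ F]
    (A : Vec n →L[ℝ] F) (u : Vec n) : A u = ∑ k, u k • A (stdVec k) := by
  have h : u = ∑ k, u k • (stdVec k : Vec n) := by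
    ext i
    simp [Finset.sum_apply, Pi.single_apply]
  conv_lhs => rw [h]
  simp only [map_sum, map_smul]

theorem norm_apply_le_sum_stdVec {n : ℕ} {F : Type*} [NormedAddCommGroup F] [NormedSpace ℝ F]
    (A : Vec n →L[ℝ] F) (u : Vec n) : ‖A u‖ ≤ ‖u‖ * ∑ k, ‖A (stdVec k)‖ := by
  rw [apply_eq_sum_stdVec, Finset.mul_sum]
  refine (norm_sum_le _ _).trans (Finset.sum_le_sum fun k _ => ?_)
  rw [norm_smul]
  exact mul_le_mul_of_nonneg_right (PiLp.norm_apply_le u k) (norm_nonneg _)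

section SqrtNorm

variable {n m : ℕ} {f : Vec n → Vec m} {s : ℝ}

theorem contDiff_sqrt_norm (hf : ContDiff ℝ 1 f) (hs : 0 < s) :
    ContDiff ℝ 1 fun x => √(s ^ 2 + ‖f x‖ ^ 2) :=
  (contDiff_const.add (hf.norm_sq ℝ)).sqrt fun x => by positivity

/-- A `C¹` substitute for `‖f‖`, whose derivative is bounded by that of `f` uniformly in `s`. -/
theorem abs_fderiv_sqrt_norm_le (hf : ContDiff ℝ 1 f) (hs : 0 < s) (x u : Vec n) :
    |fderiv ℝ (fun x => √(s ^ 2 + ‖f x‖ ^ 2)) x u| ≤ ‖fderiv ℝ f x u‖ := by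
  have h1 : HasFDerivAt (fun x => s ^ 2 + ‖f x‖ ^ 2) _ x :=
    ((hf.differentiable one_ne_zero x).hasFDerivAt.norm_sq).const_add (s ^ 2)
  have h0 : 0 < s ^ 2 + ‖f x‖ ^ 2 := by positivity
  have h2 : HasFDerivAt (fun x => √(s ^ 2 + ‖f x‖ ^ 2)) _ x := h1.sqrt h0.ne'
  rw [h2.fderiv]
  have hS : 0 < √(s ^ 2 + ‖f x‖ ^ 2) := Real.sqrt_pos.2 h0
  have hfS : ‖f x‖ ≤ √(s ^ 2 + ‖f x‖ ^ 2) := Real.le_sqrt_of_sq_le (by nlinarith)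
  have h3 := abs_real_inner_le_norm (f x) (fderiv ℝ f x u)
  simp only [smul_apply, ContinuousLinearMap.comp_apply, innerSL_apply_apply,
    smul_eq_mul, nsmul_eq_mul]
  rw [abs_mul, abs_of_pos (by positivity), div_mul_eq_mul_div, one_mul, div_le_iff₀ (by positivity)]
  have h4 : |((2 : ℕ) : ℝ) * inner ℝ (f x) (fderiv ℝ f x u)|
      = 2 * |inner ℝ (f x) (fderiv ℝ f x u)| := by
    rw [abs_mul]
    norm_num
  rw [h4]
  nlinarith [norm_nonneg (fderiv ℝ f x u)]

end SqrtNorm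

/-- Boundary values of smooth functions are controlled by the norm in `W^{1,1}`. -/
theorem exists_integral_norm_le {n : ℕ} {Ω : Set (Vec n)} (m : ℕ) (hΩo : IsOpen Ω)
    (hΩb : Bornology.IsBounded Ω) (hΩl : HasLipschitzBoundary Ω) :
    ∃ C : ℝ, 0 ≤ C ∧ ∀ f : Vec n → Vec m, ContDiff ℝ 1 f → ∫ x, ‖f x‖ ∂surfaceMeasure Ω ≤
      C * ((∫ x in Ω, ‖f x‖) + ∑ k, ∫ x in Ω, ‖fderiv ℝ f x (stdVec k)‖) := by
  have hex : ∀ x : Vec n, ∃ (v : Vec n) (r δ : ℝ), 0 < r ∧ 0 < δ ∧ (x ∈ closure Ω →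
      ∀ x' ∈ closure Ω, ∀ ε ∈ Ioo 0 δ, ∀ t ∈ Metric.ball (ε • v) (ε * δ),
        x' - t ∈ Metric.ball x r → x' - t ∈ Ω) := by
    intro x
    by_cases hx : x ∈ closure Ω
    · obtain ⟨v, r, δ, hr, hδ, h⟩ := exists_cone hΩo hΩl hx
      exact ⟨v, r, δ, hr, hδ, fun _ => h⟩
    · exact ⟨0, 1, 1, one_pos, one_pos, fun h => absurd h hx⟩
  choose v r δ hr hδ hcone using hex
  obtain ⟨J, _, c, χ, hcS, hχ, hχc, hχs, hχ0, hχle, hsum⟩ :=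
    exists_smooth_partition hΩb.isCompact_closure (r := r) fun x _ => hr x
  have hχ1 : ∀ j, ContDiff ℝ 1 (χ j) := fun j => (hχ j).of_le (by exact_mod_cast le_top)
  -- Scaled such that `⟪𝐧, u j⟫ ≥ 1` at the boundary points in the support of `χ j` where the normal
  -- exists.
  obtain ⟨u, hu⟩ : ∃ u : J → Vec n, u = fun j => (2 / δ (c j)) • v (c j) := ⟨_, rfl⟩
  have hD : ∀ j, ∃ D, ∀ x, ‖fderiv ℝ (χ j) x (u j)‖ ≤ D := fun j =>
    ((hχc j).fderiv_apply (𝕜 := ℝ) (u j)).exists_bound_of_continuous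
      (((hχ1 j).continuous_fderiv one_ne_zero).clm_apply continuous_const)
  choose D hD using hD
  have hD0 : ∀ j, 0 ≤ D j := fun j => (norm_nonneg _).trans (hD j 0)
  obtain ⟨C, hC⟩ : ∃ C, C = ∑ j, (D j + ‖u j‖) := ⟨_, rfl⟩
  have hC0 : 0 ≤ C := hC ▸ Finset.sum_nonneg fun j _ => add_nonneg (hD0 j) (norm_nonneg _)
  refine ⟨C, hC0, fun f hf => ?_⟩
  have hfd : ∀ k, Continuous fun x => fderiv ℝ f x (stdVec k) := fun k =>
    (hf.continuous_fderiv one_ne_zero).clm_apply continuous_const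
  obtain ⟨S, hS⟩ : ∃ S, S = ∑ k, ∫ x in Ω, ‖fderiv ℝ f x (stdVec k)‖ := ⟨_, rfl⟩
  have hSi : ∫ x in Ω, ∑ k, ‖fderiv ℝ f x (stdVec k)‖ = S := by
    rw [hS, integral_finsetSum]
    exact fun k _ => integrableOn_of_continuous hΩb (hfd k).norm
  -- The divergence theorem is applied to the fields `χ j √(s² + ‖f‖²) u j`, whose total flux
  -- dominates the boundary integral of `‖f‖`; afterwards `s → 0`.
  have key : ∀ s : ℝ, 0 < s → ∫ x, ‖f x‖ ∂surfaceMeasure Ω ≤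
      C * (s * volume.real Ω + (∫ x in Ω, ‖f x‖) + S) := by
    intro s hs
    obtain ⟨h, hh⟩ : ∃ h : Vec n → ℝ, h = fun x => √(s ^ 2 + ‖f x‖ ^ 2) := ⟨_, rfl⟩
    have hh1 : ContDiff ℝ 1 h := hh ▸ contDiff_sqrt_norm hf hs
    have hh0 : ∀ x, 0 ≤ h x := fun x => hh ▸ Real.sqrt_nonneg _
    have hfh : ∀ x, ‖f x‖ ≤ h x := fun x => by
      rw [hh]
      exact Real.le_sqrt_of_sq_le (by nlinarith)
    have hhf : ∀ x, h x ≤ s + ‖f x‖ := fun x => by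
      rw [hh]
      exact Real.sqrt_le_iff.2 ⟨by positivity, by nlinarith [norm_nonneg (f x)]⟩
    have hprod : ∀ j, ContDiff ℝ 1 fun x => χ j x * h x := fun j => (hχ1 j).mul hh1
    have hbd : ∀ j x, fderiv ℝ (fun x => χ j x * h x) x (u j) ≤
        D j * h x + ‖u j‖ * ∑ k, ‖fderiv ℝ f x (stdVec k)‖ := by
      intro j x
      have h1 : HasFDerivAt (fun x => χ j x * h x) _ x :=
        ((hχ1 j).differentiable one_ne_zero x).hasFDerivAt.mul
          (hh1.differentiable one_ne_zero x).hasFDerivAt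
      rw [h1.fderiv]
      simp only [add_apply, smul_apply, smul_eq_mul]
      have h2 : fderiv ℝ h x (u j) ≤ ‖u j‖ * ∑ k, ‖fderiv ℝ f x (stdVec k)‖ := by
        refine (le_abs_self _).trans ?_
        rw [hh]
        exact (abs_fderiv_sqrt_norm_le hf hs x (u j)).trans (norm_apply_le_sum_stdVec _ _)
      have h3 : fderiv ℝ (χ j) x (u j) ≤ D j := (le_abs_self _).trans (hD j x)
      have h4 : 0 ≤ ‖u j‖ * ∑ k, ‖fderiv ℝ f x (stdVec k)‖ := by positivity
      nlinarith [hχ0 j x, hχle j x, hh0 x]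
    have h1 : ∫ x, ‖f x‖ ∂surfaceMeasure Ω ≤
        ∫ x, ∑ j, (χ j x * h x) * inner ℝ (outerNormal Ω x) (u j) ∂surfaceMeasure Ω := by
      refine integral_mono_ae (integrable_surfaceMeasure_of_continuous hΩo hΩb hΩl
        hf.continuous.norm) (integrable_finsetSum _ fun j _ =>
          integrable_mul_inner_outerNormal hΩo hΩb hΩl (hprod j).continuous (u j)) ?_
      filter_upwards [ae_mem_frontier, ae_hasOuterNormal hΩo hΩb hΩl] with x hxf hxn
      have h2 : ∀ j, χ j x * h x ≤ (χ j x * h x) * inner ℝ (outerNormal Ω x) (u j) := by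
        intro j
        by_cases hxj : x ∈ tsupport (χ j)
        · have h3 := le_inner_of_cone (hδ (c j)) (hcone (c j) (hcS j)) hxf.1 (hχs j hxj)
            hxn.isOuterNormal
          have h4 : 1 ≤ inner ℝ (outerNormal Ω x) (u j) := by
            rw [hu, real_inner_smul_right, real_inner_comm]
            have := hδ (c j)
            calc (1 : ℝ) = 2 / δ (c j) * (δ (c j) / 2) := by field_simp
              _ ≤ _ := by gcongr
          exact le_mul_of_one_le_right (mul_nonneg (hχ0 j x) (hh0 x)) h4
        · rw [image_eq_zero_of_notMem_tsupport hxj]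
          simp
      calc ‖f x‖ ≤ h x := hfh x
        _ = ∑ j, χ j x * h x := by rw [← Finset.sum_mul, hsum x hxf.1, one_mul]
        _ ≤ _ := Finset.sum_le_sum fun j _ => h2 j
    have h2 : ∀ j, ∫ x, (χ j x * h x) * inner ℝ (outerNormal Ω x) (u j) ∂surfaceMeasure Ω ≤
        (D j + ‖u j‖) * (s * volume.real Ω + (∫ x in Ω, ‖f x‖) + S) := by
      intro j
      rw [← setIntegral_fderiv_eq_integral_outerNormal hΩo hΩb hΩl (hprod j)]
      have hIh : IntegrableOn h Ω := integrableOn_of_continuous hΩb hh1.continuous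
      have hIs : IntegrableOn (fun x => ∑ k, ‖fderiv ℝ f x (stdVec k)‖) Ω :=
        integrableOn_of_continuous hΩb (continuous_finsetSum _ fun k _ => (hfd k).norm)
      have hIf : IntegrableOn (fun x => ‖f x‖) Ω := integrableOn_of_continuous hΩb hf.continuous.norm
      have hI1 : IntegrableOn (fun _ => s) Ω := integrableOn_of_continuous hΩb continuous_const
      have h3 : ∫ x in Ω, fderiv ℝ (fun x => χ j x * h x) x (u j) ≤
          ∫ x in Ω, (D j * h x + ‖u j‖ * ∑ k, ‖fderiv ℝ f x (stdVec k)‖) := by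
        refine integral_mono (integrableOn_of_continuous hΩb
          (((hprod j).continuous_fderiv one_ne_zero).clm_apply continuous_const))
          ((hIh.const_mul _).add (hIs.const_mul _)) fun x => hbd j x
      have h4 : ∫ x in Ω, h x ≤ s * volume.real Ω + ∫ x in Ω, ‖f x‖ := by
        refine (integral_mono hIh (hI1.add hIf) hhf).trans_eq ?_
        change ∫ x in Ω, (s + ‖f x‖) = _
        rw [integral_add hI1 hIf, setIntegral_const, smul_eq_mul, mul_comm]
      rw [integral_add (hIh.const_mul _) (hIs.const_mul _), integral_const_mul, integral_const_mul,
        hSi] at h3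
      have hS0 : 0 ≤ S := hS ▸ Finset.sum_nonneg fun k _ => integral_nonneg fun x => norm_nonneg _
      have h5 : 0 ≤ ∫ x in Ω, h x := integral_nonneg hh0
      have h6 := mul_le_mul_of_nonneg_left (h4.trans (le_add_of_nonneg_right hS0)) (hD0 j)
      have h7 : S ≤ s * volume.real Ω + (∫ x in Ω, ‖f x‖) + S := by linarith
      have h8 := mul_le_mul_of_nonneg_left h7 (norm_nonneg (u j))
      linarith
    refine h1.trans ?_
    rw [integral_finsetSum _ fun j _ =>
      integrable_mul_inner_outerNormal hΩo hΩb hΩl (hprod j).continuous (u j), hC, Finset.sum_mul]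
    exact Finset.sum_le_sum fun j _ => h2 j
  rw [← hS]
  have hlim : Tendsto (fun s : ℝ => C * (s * volume.real Ω + (∫ x in Ω, ‖f x‖) + S)) (𝓝[>] 0)
      (𝓝 (C * ((∫ x in Ω, ‖f x‖) + S))) := by
    have h1 : Continuous fun s : ℝ => C * (s * volume.real Ω + (∫ x in Ω, ‖f x‖) + S) := by
      fun_prop
    have h2 := h1.tendsto 0
    rw [zero_mul, zero_add] at h2
    exact h2.mono_left nhdsWithin_le_nhds
  exact ge_of_tendsto hlim (mem_of_superset self_mem_nhdsWithin fun s hs => key s hs)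

/-! ### Traces and the Gauss–Green formula -/

/-- The boundary estimate, for lower integrals. -/
theorem exists_lintegral_enorm_le {n : ℕ} {Ω : Set (Vec n)} (m : ℕ) (hΩo : IsOpen Ω)
    (hΩb : Bornology.IsBounded Ω) (hΩl : HasLipschitzBoundary Ω) :
    ∃ C : ℝ≥0, ∀ f : Vec n → Vec m, ContDiff ℝ 1 f → ∫⁻ x, ‖f x‖ₑ ∂surfaceMeasure Ω ≤
      C * ((∫⁻ x in Ω, ‖f x‖ₑ) + ∑ k, ∫⁻ x in Ω, ‖fderiv ℝ f x (stdVec k)‖ₑ) := by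
  obtain ⟨C, hC, h⟩ := exists_integral_norm_le m hΩo hΩb hΩl
  lift C to ℝ≥0 using hC
  refine ⟨C, fun f hf => ?_⟩
  have hfd : ∀ k, Continuous fun x => fderiv ℝ f x (stdVec k) := fun k =>
    (hf.continuous_fderiv one_ne_zero).clm_apply continuous_const
  have h1 := ENNReal.ofReal_le_ofReal (h f hf)
  rw [ENNReal.ofReal_mul C.coe_nonneg, ENNReal.ofReal_add (integral_nonneg fun _ => norm_nonneg _)
    (Finset.sum_nonneg fun k _ => integral_nonneg fun _ => norm_nonneg _),
    ENNReal.ofReal_sum_of_nonneg fun k _ => integral_nonneg fun _ => norm_nonneg _,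
    ofReal_integral_norm_eq_lintegral_enorm
      (integrable_surfaceMeasure_of_continuous hΩo hΩb hΩl hf.continuous),
    ofReal_integral_norm_eq_lintegral_enorm (integrableOn_of_continuous hΩb hf.continuous)] at h1
  simp only [fun k => ofReal_integral_norm_eq_lintegral_enorm
    (integrableOn_of_continuous hΩb (hfd k)), ENNReal.ofReal_coe_nnreal] at h1
  exact h1

theorem tendsto_integral_smul {α E : Type*} [MeasurableSpace α] {μ : Measure α}
    [NormedAddCommGroup E] [NormedSpace ℝ E] {f : ℕ → α → E} {g : α → E} {ψ : α → ℝ} {C : ℝ}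
    (hψ : AEStronglyMeasurable ψ μ) (hψC : ∀ᵐ x ∂μ, ‖ψ x‖ ≤ C) (hf : ∀ j, Integrable (f j) μ)
    (hg : Integrable g μ)
    (h : Tendsto (fun j => eLpNorm (fun x => f j x - g x) 1 μ) atTop (𝓝 0)) :
    Tendsto (fun j => ∫ x, ψ x • f j x ∂μ) atTop (𝓝 (∫ x, ψ x • g x ∂μ)) := by
  refine tendsto_integral_of_L1' _ (hg.bdd_smul C hψ hψC).aestronglyMeasurable
    (Eventually.of_forall fun j => (hf j).bdd_smul C hψ hψC) ?_
  have h1 : Tendsto (fun j => ENNReal.ofReal C * eLpNorm (fun x => f j x - g x) 1 μ) atTop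
      (𝓝 0) := by
    have := ENNReal.Tendsto.const_mul h (Or.inr (ENNReal.ofReal_ne_top (r := C)))
    rwa [mul_zero] at this
  refine tendsto_of_tendsto_of_tendsto_of_le_of_le tendsto_const_nhds h1 (fun _ => zero_le)
    fun j => eLpNorm_le_mul_eLpNorm_of_ae_le_mul ?_ 1
  filter_upwards [hψC] with x hx
  change ‖ψ x • f j x - ψ x • g x‖ ≤ _
  rw [← smul_sub, norm_smul]
  exact mul_le_mul_of_nonneg_right hx (norm_nonneg _)

theorem integral_euclidean_apply {α : Type*} [MeasurableSpace α] {μ : Measure α} {m : ℕ}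
    {f : α → Vec m} (hf : Integrable f μ) (i : Fin m) : (∫ x, f x ∂μ) i = ∫ x, f x i ∂μ :=
  ((EuclideanSpace.proj (𝕜 := ℝ) i).integral_comp_comm hf).symm

section Trace

variable {n m : ℕ} {Ω : Set (Vec n)} (hΩo : IsOpen Ω) (hΩb : Bornology.IsBounded Ω)
  (hΩl : HasLipschitzBoundary Ω)

include hΩo hΩb hΩl

theorem aestronglyMeasurable_mul_outerNormal {φ : Vec n → ℝ} (hφ : Continuous φ) (k : Fin n) :
    AEStronglyMeasurable (fun x => φ x * outerNormal Ω x k) (surfaceMeasure Ω) := by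
  have h := (integrable_mul_inner_outerNormal hΩo hΩb hΩl hφ (stdVec k)).aestronglyMeasurable
  simpa only [inner_stdVec] using h

omit hΩo hΩl in
theorem exists_norm_mul_outerNormal_le {φ : Vec n → ℝ} (hφ : Continuous φ) (k : Fin n) :
    ∃ C, ∀ᵐ x ∂surfaceMeasure Ω, ‖φ x * outerNormal Ω x k‖ ≤ C := by
  obtain ⟨C, hC⟩ := (isCompact_frontier_of_isBounded hΩb).exists_bound_of_continuousOn
    hφ.continuousOn
  refine ⟨C * 1, ae_mem_frontier.mono fun x hx => ?_⟩
  rw [norm_mul]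
  exact mul_le_mul (hC x hx) ((PiLp.norm_apply_le _ k).trans (norm_outerNormal_le Ω x))
    (norm_nonneg _) ((norm_nonneg _).trans (hC x hx))

/-- The Gauss–Green formula for functions that are smooth up to the boundary. -/
theorem integral_fderiv_smul_add_eq {φ : Vec n → ℝ} (hφ : ContDiff ℝ 1 φ) {f : Vec n → Vec m}
    (hf : ContDiff ℝ 1 f) (k : Fin n) :
    (∫ x in Ω, fderiv ℝ φ x (stdVec k) • f x) + ∫ x in Ω, φ x • fderiv ℝ f x (stdVec k) =
      ∫ x, (φ x * outerNormal Ω x k) • f x ∂surfaceMeasure Ω := by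
  have hφd : Continuous fun x => fderiv ℝ φ x (stdVec k) :=
    (hφ.continuous_fderiv one_ne_zero).clm_apply continuous_const
  have hfd : Continuous fun x => fderiv ℝ f x (stdVec k) :=
    (hf.continuous_fderiv one_ne_zero).clm_apply continuous_const
  have hI1 : IntegrableOn (fun x => fderiv ℝ φ x (stdVec k) • f x) Ω :=
    integrableOn_of_continuous hΩb (hφd.smul hf.continuous)
  have hI2 : IntegrableOn (fun x => φ x • fderiv ℝ f x (stdVec k)) Ω :=
    integrableOn_of_continuous hΩb (hφ.continuous.smul hfd)
  obtain ⟨C, hC⟩ := exists_norm_mul_outerNormal_le (Ω := Ω) hΩb hφ.continuous k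
  have hI3 : Integrable (fun x => (φ x * outerNormal Ω x k) • f x) (surfaceMeasure Ω) :=
    (integrable_surfaceMeasure_of_continuous hΩo hΩb hΩl hf.continuous).bdd_smul C
      (aestronglyMeasurable_mul_outerNormal hΩo hΩb hΩl hφ.continuous k) hC
  have hI4 : IntegrableOn (fun x => fderiv ℝ φ x (stdVec k) • f x
      + φ x • fderiv ℝ f x (stdVec k)) Ω := hI1.add hI2
  rw [← integral_add hI1 hI2]
  ext i
  rw [integral_euclidean_apply hI4, integral_euclidean_apply hI3]
  have hfi : ContDiff ℝ 1 fun x => f x i := (EuclideanSpace.proj (𝕜 := ℝ) i).contDiff.comp hf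
  have h1 := setIntegral_fderiv_eq_integral_outerNormal hΩo hΩb hΩl (hφ.mul hfi) (stdVec k)
  simp only [inner_stdVec] at h1
  refine Eq.trans ?_ (h1.trans ?_)
  · refine integral_congr_ae (Eventually.of_forall fun x => ?_)
    have h2 : HasFDerivAt (fun x => f x i) _ x := (EuclideanSpace.proj (𝕜 := ℝ) i).hasFDerivAt.comp x
      (hf.differentiable one_ne_zero x).hasFDerivAt
    have h3 : HasFDerivAt (fun x => φ x * f x i) _ x :=
      (hφ.differentiable one_ne_zero x).hasFDerivAt.mul h2
    change _ = fderiv ℝ (fun x => φ x * f x i) x (stdVec k)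
    rw [h3.fderiv]
    simp
    ring
  · refine integral_congr_ae (Eventually.of_forall fun x => ?_)
    simp
    ring

/-- The Gauss–Green formula for limits of smooth functions. -/
theorem integral_fderiv_smul_add_eq_of_tendsto {y g : Vec n → Vec m} {z : Vec n → Mat m n}
    (hy : IntegrableOn y Ω) (hz : ∀ k, IntegrableOn (fun x => z x k) Ω)
    (hg : Integrable g (surfaceMeasure Ω)) {f : ℕ → Vec n → Vec m} (hf : ∀ j, ContDiff ℝ ∞ (f j))
    (hfy : Tendsto (fun j => eLpNorm (fun x => f j x - y x) 1 (volume.restrict Ω)) atTop (𝓝 0))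
    (hfz : ∀ k, Tendsto (fun j => eLpNorm (fun x => fderiv ℝ (f j) x (stdVec k) - z x k) 1
        (volume.restrict Ω)) atTop (𝓝 0))
    (hfg : Tendsto (fun j => eLpNorm (fun x => f j x - g x) 1 (surfaceMeasure Ω)) atTop (𝓝 0))
    {φ : Vec n → ℝ} (hφ : ContDiff ℝ ∞ φ) (k : Fin n) :
    (∫ x in Ω, fderiv ℝ φ x (stdVec k) • y x) + ∫ x in Ω, φ x • z x k =
      ∫ x, (φ x * outerNormal Ω x k) • g x ∂surfaceMeasure Ω := by
  have hφ1 : ContDiff ℝ 1 φ := hφ.of_le (by exact_mod_cast le_top)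
  have hf1 : ∀ j, ContDiff ℝ 1 (f j) := fun j => (hf j).of_le (by exact_mod_cast le_top)
  have hφd : Continuous fun x => fderiv ℝ φ x (stdVec k) :=
    (hφ1.continuous_fderiv one_ne_zero).clm_apply continuous_const
  have hfd : ∀ j, Continuous fun x => fderiv ℝ (f j) x (stdVec k) := fun j =>
    ((hf1 j).continuous_fderiv one_ne_zero).clm_apply continuous_const
  have hbd : ∀ ψ : Vec n → ℝ, Continuous ψ → ∃ C, ∀ᵐ x ∂volume.restrict Ω, ‖ψ x‖ ≤ C := by
    intro ψ hψ
    obtain ⟨C, hC⟩ := hΩb.isCompact_closure.exists_bound_of_continuousOn hψ.continuousOn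
    exact ⟨C, (ae_restrict_mem hΩo.measurableSet).mono fun x hx => hC x (subset_closure hx)⟩
  obtain ⟨C₁, hC₁⟩ := hbd _ hφd
  obtain ⟨C₂, hC₂⟩ := hbd _ hφ1.continuous
  obtain ⟨C₃, hC₃⟩ := exists_norm_mul_outerNormal_le (Ω := Ω) hΩb hφ1.continuous k
  have h1 := tendsto_integral_smul hφd.aestronglyMeasurable hC₁
    (fun j => integrableOn_of_continuous hΩb (hf1 j).continuous) hy hfy
  have h2 := tendsto_integral_smul hφ1.continuous.aestronglyMeasurable hC₂
    (fun j => integrableOn_of_continuous hΩb (hfd j)) (hz k) (hfz k)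
  have h3 := tendsto_integral_smul
    (aestronglyMeasurable_mul_outerNormal hΩo hΩb hΩl hφ1.continuous k) hC₃
    (fun j => integrable_surfaceMeasure_of_continuous hΩo hΩb hΩl (hf1 j).continuous) hg hfg
  refine tendsto_nhds_unique (h1.add h2) (h3.congr fun j => ?_)
  exact (integral_fderiv_smul_add_eq hΩo hΩb hΩl hφ1 (hf1 j) k).symm

/-- Boundary values are determined by the Gauss–Green formula. -/
theorem ae_eq_of_integral_outerNormal_smul_eq {g g' : Vec n → Vec m}
    (hg : Integrable g (surfaceMeasure Ω)) (hg' : Integrable g' (surfaceMeasure Ω))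
    (h : ∀ φ : Vec n → ℝ, ContDiff ℝ ∞ φ → HasCompactSupport φ → ∀ k,
      ∫ x, (φ x * outerNormal Ω x k) • g x ∂surfaceMeasure Ω
        = ∫ x, (φ x * outerNormal Ω x k) • g' x ∂surfaceMeasure Ω) :
    g =ᵐ[surfaceMeasure Ω] g' := by
  have := isFiniteMeasure_surfaceMeasure hΩo hΩb hΩl
  have hk : ∀ k, ∀ᵐ x ∂surfaceMeasure Ω, outerNormal Ω x k • (g x - g' x) = 0 := by
    intro k
    have hm : AEStronglyMeasurable (fun x => outerNormal Ω x k) (surfaceMeasure Ω) := by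
      simpa using aestronglyMeasurable_mul_outerNormal hΩo hΩb hΩl
        (continuous_const (y := (1 : ℝ))) k
    have hint : Integrable (fun x => outerNormal Ω x k • (g x - g' x)) (surfaceMeasure Ω) :=
      (hg.sub hg').bdd_smul 1 hm (Eventually.of_forall fun x =>
        (PiLp.norm_apply_le _ k).trans (norm_outerNormal_le Ω x))
    refine ae_eq_zero_of_integral_contDiff_smul_eq_zero hint.locallyIntegrable
      fun φ hφ hφc => ?_
    obtain ⟨C, hC⟩ := exists_norm_mul_outerNormal_le (Ω := Ω) hΩb hφ.continuous k
    have hmφ := aestronglyMeasurable_mul_outerNormal hΩo hΩb hΩl hφ.continuous k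
    have h1 := h φ hφ hφc k
    have hI1 : Integrable (fun x => (φ x * outerNormal Ω x k) • g x) (surfaceMeasure Ω) :=
      hg.bdd_smul C hmφ hC
    have hI2 : Integrable (fun x => (φ x * outerNormal Ω x k) • g' x) (surfaceMeasure Ω) :=
      hg'.bdd_smul C hmφ hC
    rw [← sub_eq_zero, ← integral_sub hI1 hI2] at h1
    simpa only [smul_smul, smul_sub] using h1
  filter_upwards [ae_all_iff.2 hk, ae_hasOuterNormal hΩo hΩb hΩl] with x hx hn
  -- Each component of the normal annihilates `g - g'`, and at least one of them is not zero.
  have hne : outerNormal Ω x ≠ 0 := norm_ne_zero_iff.1 (by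
    rw [hn.isOuterNormal.1]
    exact one_ne_zero)
  by_contra hgg
  refine hne ?_
  ext k
  exact (smul_eq_zero.1 (hx k)).resolve_right (sub_ne_zero.2 hgg)

/-- A function on the boundary for which the Gauss–Green formula holds is the trace. -/
theorem isTrace_of_integral_eq {p : ℝ≥0∞} (hp : 1 ≤ p) {y g : Vec n → Vec m} {z : Vec n → Mat m n}
    (hy : IntegrableOn y Ω) (hz : ∀ k, IntegrableOn (fun x => z x k) Ω)
    (hw : IsWeakDeriv Ω y z) (hg : MemLp g p (surfaceMeasure Ω))
    (hGG : ∀ φ : Vec n → ℝ, ContDiff ℝ ∞ φ → HasCompactSupport φ → ∀ k,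
      (∫ x in Ω, fderiv ℝ φ x (stdVec k) • y x) + ∫ x in Ω, φ x • z x k =
        ∫ x, (φ x * outerNormal Ω x k) • g x ∂surfaceMeasure Ω) :
    IsTrace Ω p y z g := by
  have := isFiniteMeasure_surfaceMeasure hΩo hΩb hΩl
  have hgi : Integrable g (surfaceMeasure Ω) := hg.integrable hp
  obtain ⟨C, hC⟩ := exists_lintegral_enorm_le m hΩo hΩb hΩl
  -- In the trace inequality for a difference of two approximations there are `n + 1` terms of size
  -- at most `2 η N`; dividing by `D` makes the result less than `2⁻ᴺ`.
  obtain ⟨D, hD⟩ : ∃ D : ℝ≥0, D = 2 * C * (n + 1) + 1 := ⟨_, rfl⟩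
  obtain ⟨η, hη⟩ : ∃ η : ℕ → ℝ≥0∞, η = fun j => (((1 / 2 : ℝ≥0) ^ j / D : ℝ≥0) : ℝ≥0∞) :=
    ⟨_, rfl⟩
  have hη0 : ∀ j, 0 < η j := fun j => by
    rw [hη]
    have : 0 < D := by rw [hD]; positivity
    exact ENNReal.coe_pos.2 (by positivity)
  have hηlim : Tendsto η atTop (𝓝 0) := by
    rw [hη, ← ENNReal.coe_zero, ENNReal.tendsto_coe]
    have := (tendsto_pow_atTop_nhds_zero_of_lt_one (r := (1 / 2 : ℝ≥0)) zero_le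
      (by rw [div_lt_one (by norm_num)]; norm_num)).div_const D
    simpa using this
  have hηanti : Antitone η := by
    intro a b hab
    rw [hη]
    refine ENNReal.coe_le_coe.2 (div_le_div_of_nonneg_right ?_ zero_le)
    exact pow_le_pow_of_le_one zero_le (by norm_num) hab
  choose f hf hf0 hf1 using fun j => exists_contDiff_approx hΩo hΩb hΩl hy hz hw (hη0 j)
  have hfd1 : ∀ j, ContDiff ℝ 1 (f j) := fun j => (hf j).of_le (by exact_mod_cast le_top)
  have hfy : Tendsto (fun j => eLpNorm (fun x => f j x - y x) 1 (volume.restrict Ω)) atTop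
      (𝓝 0) := by
    refine tendsto_of_tendsto_of_tendsto_of_le_of_le tendsto_const_nhds hηlim (fun _ => zero_le)
      fun j => ?_
    rw [eLpNorm_one_eq_lintegral_enorm]
    exact hf0 j
  have hfz : ∀ k, Tendsto (fun j => eLpNorm (fun x => fderiv ℝ (f j) x (stdVec k) - z x k) 1
      (volume.restrict Ω)) atTop (𝓝 0) := by
    intro k
    refine tendsto_of_tendsto_of_tendsto_of_le_of_le tendsto_const_nhds hηlim (fun _ => zero_le)
      fun j => ?_
    rw [eLpNorm_one_eq_lintegral_enorm]
    exact hf1 j k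
  have htri : ∀ (N : ℕ) (u v w : Vec n → Vec m), AEStronglyMeasurable u (volume.restrict Ω) →
      AEStronglyMeasurable w (volume.restrict Ω) → ∫⁻ x in Ω, ‖u x - w x‖ₑ ≤ η N →
      ∫⁻ x in Ω, ‖v x - w x‖ₑ ≤ η N → ∫⁻ x in Ω, ‖u x - v x‖ₑ ≤ 2 * η N := by
    intro N u v w hu hw h1 h2
    rw [two_mul]
    refine le_trans ?_ (add_le_add h1 h2)
    have hm : AEMeasurable (fun x => ‖u x - w x‖ₑ) (volume.restrict Ω) := (hu.sub hw).enorm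
    rw [← lintegral_add_left' hm]
    refine lintegral_mono fun x => ?_
    rw [← sub_sub_sub_cancel_right (u x) (v x) (w x)]
    exact enorm_sub_le
  have hcauchy : ∀ N a b : ℕ, N ≤ a → N ≤ b →
      eLpNorm (f a - f b) 1 (surfaceMeasure Ω) < ((1 / 2 : ℝ≥0) ^ N : ℝ≥0) := by
    intro N a b ha hb
    have h1 := hC (fun x => f a x - f b x) ((hfd1 a).sub (hfd1 b))
    have h2 : ∫⁻ x in Ω, ‖f a x - f b x‖ₑ ≤ 2 * η N := htri N _ _ y
      (hf a).continuous.aestronglyMeasurable hy.aestronglyMeasurable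
      ((hf0 a).trans (hηanti ha)) ((hf0 b).trans (hηanti hb))
    have h3 : ∀ k, ∫⁻ x in Ω, ‖fderiv ℝ (fun x => f a x - f b x) x (stdVec k)‖ₑ ≤ 2 * η N := by
      intro k
      have h4 : ∀ x, fderiv ℝ (fun x => f a x - f b x) x (stdVec k)
          = fderiv ℝ (f a) x (stdVec k) - fderiv ℝ (f b) x (stdVec k) := fun x => by
        rw [fderiv_fun_sub ((hfd1 a).differentiable one_ne_zero x)
          ((hfd1 b).differentiable one_ne_zero x)]
        rfl
      simp only [h4]
      have hc : Continuous fun x => fderiv ℝ (f a) x (stdVec k) :=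
        ((hfd1 a).continuous_fderiv one_ne_zero).clm_apply continuous_const
      exact htri N _ _ (fun x => z x k) hc.aestronglyMeasurable (hz k).aestronglyMeasurable
        ((hf1 a k).trans (hηanti ha)) ((hf1 b k).trans (hηanti hb))
    rw [eLpNorm_one_eq_lintegral_enorm]
    refine (h1.trans (mul_le_mul_right (add_le_add h2 (Finset.sum_le_sum fun k _ => h3 k)) _)).trans_lt ?_
    rw [Finset.sum_const, Finset.card_univ, Fintype.card_fin, nsmul_eq_mul, hη]
    have h5 : C * (2 * ((1 / 2 : ℝ≥0) ^ N / D) + n * (2 * ((1 / 2 : ℝ≥0) ^ N / D)))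
        < (1 / 2 : ℝ≥0) ^ N := by
      have hD0 : 0 < D := by rw [hD]; positivity
      have h6 : C * (2 * ((1 / 2 : ℝ≥0) ^ N / D) + n * (2 * ((1 / 2 : ℝ≥0) ^ N / D)))
          = (1 / 2 : ℝ≥0) ^ N * (2 * C * (n + 1)) / D := by
        field_simp
        ring
      rw [h6, div_lt_iff₀ hD0]
      refine mul_lt_mul_of_pos_left ?_ (by positivity)
      rw [hD]
      exact lt_add_one _
    beta_reduce
    exact_mod_cast h5
  -- The boundary values of the approximations are Cauchy in `L¹`, with summable bounds, and have a
  -- limit `g'`.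
  obtain ⟨g', hg', hlim⟩ := Lp.cauchy_complete_eLpNorm le_rfl
    (fun j => memLp_one_iff_integrable.2
      (integrable_surfaceMeasure_of_continuous hΩo hΩb hΩl (hf j).continuous))
    (B := fun N => ((1 / 2 : ℝ≥0) ^ N : ℝ≥0)) (by
      rw [ENNReal.tsum_coe_ne_top_iff_summable]
      exact NNReal.summable_geometric (by rw [div_lt_one (by norm_num)]; norm_num)) hcauchy
  have hg'i := memLp_one_iff_integrable.1 hg'
  -- Both satisfy the Gauss–Green formula with the same `y` and `z`, `g'` as a limit of smooth
  -- functions.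
  have hgg : g =ᵐ[surfaceMeasure Ω] g' := by
    refine ae_eq_of_integral_outerNormal_smul_eq hΩo hΩb hΩl hgi hg'i fun φ hφ hφc k => ?_
    rw [← hGG φ hφ hφc k]
    exact integral_fderiv_smul_add_eq_of_tendsto hΩo hΩb hΩl hy hz hg'i hf hfy hfz hlim hφ k
  refine ⟨hg, f, hf, hfy, hfz, hlim.congr fun j => eLpNorm_congr_ae ?_⟩
  filter_upwards [hgg] with x hx
  rw [Pi.sub_apply, hx]

end Trace

/-! ### Push-forwards -/

/-- Adapted to data that are Borel only on the carrying set `S` and arbitrary elsewhere. -/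
theorem ae_map_of_ae_of_measurableSet {α γ : Type*} [MeasurableSpace α] [MeasurableSpace γ]
    {ν : Measure α} {T : α → γ} (hT : AEMeasurable T ν) {S : Set γ} (hS : MeasurableSet S)
    {q : γ → Prop} (hq : MeasurableSet {w : S | q w}) (hTS : ∀ᵐ x ∂ν, T x ∈ S)
    (h : ∀ᵐ x ∂ν, q (T x)) : ∀ᵐ w ∂ν.map T, q w := by
  have hm : MeasurableSet {w | w ∈ S ∧ q w} := by
    have := hS.subtype_image hq
    convert this using 1
    ext w
    constructor
    · rintro ⟨h1, h2⟩
      exact ⟨⟨w, h1⟩, h2, rfl⟩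
    · rintro ⟨⟨w, h1⟩, h2, rfl⟩
      exact ⟨h1, h2⟩
  exact ((ae_map_iff hT hm).2 (hTS.and h)).mono fun w hw => hw.2

theorem extIntegral_restrict_map {α γ : Type*} [MeasurableSpace α] [MeasurableSpace γ]
    {ν : Measure α} {T : α → γ} (hT : AEMeasurable T ν) {S : Set γ} (hS : MeasurableSet S)
    {F : γ → ℝ} (hF : Measurable (S.domRestrict F)) (hTS : ∀ᵐ x ∂ν, T x ∈ S) :
    extIntegral ((ν.map T).restrict S) F = extIntegral ν (fun x => F (T x)) := by
  have hS' : ∀ᵐ w ∂ν.map T, w ∈ S := (ae_map_iff hT hS).2 hTS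
  rw [Measure.restrict_eq_self_of_ae_mem hS',
    extIntegral_map hT (aemeasurable_of_measurable_domRestrict hS hF hS')]

theorem isCompact_support_map {α γ : Type*} [MeasurableSpace α] [TopologicalSpace γ] [T2Space γ]
    [MeasurableSpace γ] [OpensMeasurableSpace γ] {ν : Measure α} {T : α → γ}
    (hT : AEMeasurable T ν) {K : Set γ} (hK : IsCompact K) (h : ∀ᵐ x ∂ν, T x ∈ K) :
    IsCompact (ν.map T).support :=
  hK.of_isClosed_subset Measure.isClosed_support
    (Measure.support_subset_of_isClosed hK.isClosed ((ae_map_iff hT hK.measurableSet).2 h))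

theorem MemLp.exists_ae_norm_le {α E : Type*} [MeasurableSpace α] [NormedAddCommGroup E]
    {ν : Measure α} {f : α → E} (hf : MemLp f ⊤ ν) : ∃ C : ℝ, ∀ᵐ x ∂ν, ‖f x‖ ≤ C := by
  have h1 := hf.2
  rw [eLpNorm_exponent_top] at h1
  refine ⟨(eLpNormEssSup f ν).toReal, (ae_le_eLpNormEssSup (f := f) (μ := ν)).mono fun x hx => ?_⟩
  rw [← toReal_enorm]
  exact ENNReal.toReal_mono h1.ne hx

theorem MemLp.lintegral_rpow_enorm_lt_top {α E : Type*} [MeasurableSpace α] [NormedAddCommGroup E]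
    {ν : Measure α} {f : α → E} {p : ℝ≥0∞} (hf : MemLp f p ν) (hp : 1 ≤ p) (hp' : p ≠ ⊤) :
    ∫⁻ x, ‖f x‖ₑ ^ p.toReal ∂ν < ⊤ :=
  (eLpNorm_lt_top_iff_lintegral_rpow_enorm_lt_top (zero_lt_one.trans_le hp).ne' hp').1 hf.2

section Vector

variable {n m : ℕ} {Ω : Set (Vec n)}

/-- The Gauss–Green formula, tested with vector fields. -/
theorem integral_inner_add_eq (hΩo : IsOpen Ω) (hΩb : Bornology.IsBounded Ω)
    (hΩl : HasLipschitzBoundary Ω) {y g : Vec n → Vec m} {z : Vec n → Mat m n}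
    (hy : IntegrableOn y Ω) (hz : ∀ k, IntegrableOn (fun x => z x k) Ω)
    (hg : Integrable g (surfaceMeasure Ω))
    (hGG : ∀ φ : Vec n → ℝ, ContDiff ℝ ∞ φ → ∀ k,
      (∫ x in Ω, fderiv ℝ φ x (stdVec k) • y x) + ∫ x in Ω, φ x • z x k =
        ∫ x, (φ x * outerNormal Ω x k) • g x ∂surfaceMeasure Ω)
    {φ₁ : Vec n → ℝ} {φ₂ : Vec n → Vec m} (hφ₁ : ContDiff ℝ ∞ φ₁) (hφ₂ : ContDiff ℝ ∞ φ₂)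
    (k : Fin n) :
    ∫ x in Ω, (fderiv ℝ φ₁ x (stdVec k) + inner ℝ (y x) (fderiv ℝ φ₂ x (stdVec k))
        + inner ℝ (φ₂ x) (z x k))
      = ∫ x, (φ₁ x + inner ℝ (g x) (φ₂ x)) * outerNormal Ω x k ∂surfaceMeasure Ω := by
  have hφ₁' : ContDiff ℝ 1 φ₁ := hφ₁.of_le (by exact_mod_cast le_top)
  have hφ₂' : ContDiff ℝ 1 φ₂ := hφ₂.of_le (by exact_mod_cast le_top)
  have hc1 : Continuous fun x => fderiv ℝ φ₁ x (stdVec k) :=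
    (hφ₁'.continuous_fderiv one_ne_zero).clm_apply continuous_const
  have hφi : ∀ i, ContDiff ℝ ∞ fun x => φ₂ x i := fun i =>
    (EuclideanSpace.proj (𝕜 := ℝ) i).contDiff.comp hφ₂
  have hφi' : ∀ i, ContDiff ℝ 1 fun x => φ₂ x i := fun i =>
    (EuclideanSpace.proj (𝕜 := ℝ) i).contDiff.comp hφ₂'
  have hd : ∀ i x, fderiv ℝ (fun x => φ₂ x i) x (stdVec k) = fderiv ℝ φ₂ x (stdVec k) i := by
    intro i x
    have h2 : HasFDerivAt (fun x => φ₂ x i) _ x :=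
      (EuclideanSpace.proj (𝕜 := ℝ) i).hasFDerivAt.comp x
        (hφ₂'.differentiable one_ne_zero x).hasFDerivAt
    rw [h2.fderiv]
    rfl
  have hbd : ∀ ψ : Vec n → ℝ, Continuous ψ → ∃ C, ∀ᵐ x ∂volume.restrict Ω, ‖ψ x‖ ≤ C := by
    intro ψ hψ
    obtain ⟨C, hC⟩ := hΩb.isCompact_closure.exists_bound_of_continuousOn hψ.continuousOn
    exact ⟨C, (ae_restrict_mem hΩo.measurableSet).mono fun x hx => hC x (subset_closure hx)⟩
  have hsm : ∀ (ψ : Vec n → ℝ) (u : Vec n → Vec m), Continuous ψ → IntegrableOn u Ω →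
      IntegrableOn (fun x => ψ x • u x) Ω := by
    intro ψ u hψ hu
    obtain ⟨C, hC⟩ := hbd ψ hψ
    exact Integrable.bdd_smul hu C hψ.aestronglyMeasurable hC
  have hdc : ∀ i, Continuous fun x => fderiv ℝ (fun x => φ₂ x i) x (stdVec k) := fun i =>
    ((hφi' i).continuous_fderiv one_ne_zero).clm_apply continuous_const
  have hI0 : IntegrableOn (fun x => fderiv ℝ φ₁ x (stdVec k)) Ω :=
    integrableOn_of_continuous hΩb hc1
  have hI1 : ∀ i, IntegrableOn (fun x => fderiv ℝ (fun x => φ₂ x i) x (stdVec k) * y x i) Ω :=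
    fun i => (hsm _ _ (hdc i) hy).eval_piLp i
  have hI2 : ∀ i, IntegrableOn (fun x => φ₂ x i * z x k i) Ω :=
    fun i => (hsm _ _ (hφi i).continuous (hz k)).eval_piLp i
  have hJ0 : Integrable (fun x => φ₁ x * outerNormal Ω x k) (surfaceMeasure Ω) := by
    have := integrable_mul_inner_outerNormal hΩo hΩb hΩl hφ₁.continuous (stdVec k)
    simpa only [inner_stdVec] using this
  have hJv : ∀ i, Integrable (fun x => (φ₂ x i * outerNormal Ω x k) • g x) (surfaceMeasure Ω) := by
    intro i
    obtain ⟨C, hC⟩ := exists_norm_mul_outerNormal_le (Ω := Ω) hΩb (hφi i).continuous k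
    exact hg.bdd_smul C
      (aestronglyMeasurable_mul_outerNormal hΩo hΩb hΩl (hφi i).continuous k) hC
  have hJ : ∀ i, Integrable (fun x => (φ₂ x i * outerNormal Ω x k) * g x i) (surfaceMeasure Ω) :=
    fun i => (hJv i).eval_piLp i
  have hI12 : ∀ i, IntegrableOn (fun x => fderiv ℝ (fun x => φ₂ x i) x (stdVec k) * y x i
      + φ₂ x i * z x k i) Ω := fun i => (hI1 i).add (hI2 i)
  have hcomp : ∀ i, ∫ x in Ω, fderiv ℝ (fun x => φ₂ x i) x (stdVec k) * y x i
      + φ₂ x i * z x k i = ∫ x, (φ₂ x i * outerNormal Ω x k) * g x i ∂surfaceMeasure Ω := by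
    intro i
    have h1 := congrArg (fun v : Vec m => v i) (hGG _ (hφi i) k)
    simp only [PiLp.add_apply, integral_euclidean_apply (hsm _ _ (hdc i) hy),
      integral_euclidean_apply (hsm _ _ (hφi i).continuous (hz k)),
      integral_euclidean_apply (hJv i), PiLp.smul_apply, smul_eq_mul] at h1
    rw [integral_add (hI1 i) (hI2 i)]
    exact h1
  have hdiv : ∫ x in Ω, fderiv ℝ φ₁ x (stdVec k)
      = ∫ x, φ₁ x * outerNormal Ω x k ∂surfaceMeasure Ω := by
    have := setIntegral_fderiv_eq_integral_outerNormal hΩo hΩb hΩl hφ₁' (stdVec k)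
    simpa only [inner_stdVec] using this
  have e1 : ∀ x, fderiv ℝ φ₁ x (stdVec k) + inner ℝ (y x) (fderiv ℝ φ₂ x (stdVec k))
        + inner ℝ (φ₂ x) (z x k) = fderiv ℝ φ₁ x (stdVec k)
        + ∑ i, (fderiv ℝ (fun x => φ₂ x i) x (stdVec k) * y x i + φ₂ x i * z x k i) := by
    intro x
    simp only [PiLp.inner_apply, hd, Finset.sum_add_distrib, ← add_assoc]
    simp [mul_comm]
  have e2 : ∀ x, (φ₁ x + inner ℝ (g x) (φ₂ x)) * outerNormal Ω x k = φ₁ x * outerNormal Ω x k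
      + ∑ i, (φ₂ x i * outerNormal Ω x k) * g x i := by
    intro x
    rw [add_mul, PiLp.inner_apply, Finset.sum_mul]
    congr 1
    refine Finset.sum_congr rfl fun i _ => ?_
    simp
    ring
  simp only [e1, e2]
  rw [integral_add hI0 (integrable_finsetSum _ fun i _ => hI12 i),
    integral_add hJ0 (integrable_finsetSum _ fun i _ => hJ i), hdiv,
    integral_finsetSum _ fun i _ => hI12 i, integral_finsetSum _ fun i _ => hJ i]
  congr 1
  exact Finset.sum_congr rfl fun i _ => hcomp i

end Vector

/-! ### Occupation measures of Sobolev functions -/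

namespace Problem

variable {n m : ℕ} {I : Type*} {P : Problem n m I}

theorem measurableSet_bulk (hΩo : IsOpen P.Ω) (hYc : IsClosed P.Y) (hZc : IsClosed P.Z) :
    MeasurableSet P.bulk :=
  hΩo.measurableSet.prod (hYc.measurableSet.prod hZc.measurableSet)

theorem measurableSet_bdry (hYc : IsClosed P.Y) : MeasurableSet P.bdry :=
  isClosed_frontier.measurableSet.prod hYc.measurableSet

theorem measurableSet_constraints {γ : Type*} [MeasurableSpace γ] {S : Set γ} {A B : γ → ℝ}
    (hA : Measurable (S.domRestrict A)) (hB : Measurable (S.domRestrict B)) :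
    MeasurableSet {w : S | A w = 0 ∧ B w ≤ 0} :=
  (hA (measurableSet_singleton 0)).inter (hB measurableSet_Iic)

/-- The occupation measures of a feasible function are feasible for the relaxation. -/
theorem relaxedFeasible_map (hp : 1 ≤ P.p) (hΩo : IsOpen P.Ω)
    (hΩb : Bornology.IsBounded P.Ω) (hΩl : HasLipschitzBoundary P.Ω)
    (hYc : IsClosed P.Y) (hZc : IsClosed P.Z)
    (hAm : ∀ i, Measurable (P.bulk.domRestrict (P.A i)))
    (hBm : ∀ i, Measurable (P.bulk.domRestrict (P.B i)))
    (hCm : ∀ i, Measurable (P.bulk.domRestrict (P.C i)))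
    (hAbm : ∀ i, Measurable (P.bdry.domRestrict (P.A_bd i)))
    (hBbm : ∀ i, Measurable (P.bdry.domRestrict (P.B_bd i)))
    (hCbm : ∀ i, Measurable (P.bdry.domRestrict (P.C_bd i)))
    {y : Vec n → Vec m} {z : Vec n → Mat m n} {g : Vec n → Vec m} (hf : P.Feasible y z g)
    (hT : AEMeasurable (fun x => (x, y x, z x)) (volume.restrict P.Ω))
    (hTb : AEMeasurable (fun x => (x, g x)) (surfaceMeasure P.Ω))
    (hTS : ∀ᵐ x ∂volume.restrict P.Ω, (x, y x, z x) ∈ P.bulk)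
    (hTbS : ∀ᵐ x ∂surfaceMeasure P.Ω, (x, g x) ∈ P.bdry) :
    P.RelaxedFeasible ((volume.restrict P.Ω).map fun x => (x, y x, z x))
      ((surfaceMeasure P.Ω).map fun x => (x, g x)) := by
  have hσfin := isFiniteMeasure_surfaceMeasure hΩo hΩb hΩl
  have hvfin : IsFiniteMeasure (volume.restrict P.Ω) :=
    ⟨by rw [Measure.restrict_apply_univ]; exact hΩb.measure_lt_top⟩
  have hbulk := measurableSet_bulk hΩo hYc hZc
  have hbdry := measurableSet_bdry (P := P) hYc
  obtain ⟨μ, hμ⟩ : ∃ μ, μ = (volume.restrict P.Ω).map fun x => (x, y x, z x) := ⟨_, rfl⟩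
  obtain ⟨μb, hμb⟩ : ∃ μb, μb = (surfaceMeasure P.Ω).map fun x => (x, g x) := ⟨_, rfl⟩
  have hμS : ∀ᵐ w ∂μ, w ∈ P.bulk := hμ ▸ (ae_map_iff hT hbulk).2 hTS
  have hμbS : ∀ᵐ w ∂μb, w ∈ P.bdry := hμb ▸ (ae_map_iff hTb hbdry).2 hTbS
  have hμr : μ.restrict P.bulk = μ := Measure.restrict_eq_self_of_ae_mem hμS
  have hμbr : μb.restrict P.bdry = μb := Measure.restrict_eq_self_of_ae_mem hμbS
  have hμbfst : μb.map Prod.fst = surfaceMeasure P.Ω := by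
    rw [hμb, AEMeasurable.map_map_of_aemeasurable measurable_fst.aemeasurable hTb]
    exact Measure.map_id
  have hy := hf.sobolev.memLp
  have hz := hf.sobolev.memLp_deriv
  have hg := hf.trace.1
  have hyi : IntegrableOn y P.Ω := hy.integrable hp
  have hzi : ∀ k, IntegrableOn (fun x => z x k) P.Ω := fun k => (hz k).integrable hp
  have hgi : Integrable g (surfaceMeasure P.Ω) := hg.integrable hp
  rw [← hμ, ← hμb]
  have hfin : IsFiniteMeasure μ := hμ ▸ inferInstance
  have hbfin : IsFiniteMeasure μb := hμb ▸ inferInstance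
  have hnb : ∀ᵐ w ∂μb, HasOuterNormal P.Ω w.1 :=
    ae_of_ae_map measurable_fst.aemeasurable (hμbfst ▸ ae_hasOuterNormal hΩo hΩb hΩl)
  refine ⟨⟨inferInstance, inferInstance, ?_, hμbS, ?_, ?_, ?_, hnb, ?_⟩, hμS, ?_, ?_, ?_, ?_⟩
  · exact hμS.mono fun w hw => ⟨subset_closure hw.1, hw.2⟩
  · rw [hμ, Measure.map_apply_of_aemeasurable hT MeasurableSet.univ, preimage_univ,
      Measure.restrict_apply_univ]
  · intro htop
    rw [htop] at hy hz hg
    obtain ⟨C, hC⟩ := MemLp.exists_ae_norm_le hy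
    choose D hD using fun k => MemLp.exists_ae_norm_le (hz k)
    obtain ⟨E, hE⟩ := MemLp.exists_ae_norm_le hg
    rw [hμ, hμb]
    constructor
    · refine isCompact_support_map hT (K := closure P.Ω ×ˢ Metric.closedBall (0 : Vec m) C ×ˢ
        Set.pi univ fun k => Metric.closedBall (0 : Vec m) (D k)) (hΩb.isCompact_closure.prod
          ((isCompact_closedBall _ _).prod
          (isCompact_univ_pi fun k => isCompact_closedBall _ _))) ?_
      filter_upwards [hTS, hC, ae_all_iff.2 hD] with x h1 h2 h3
      exact ⟨subset_closure h1.1, by simpa using h2, fun k _ => by simpa using h3 k⟩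
    · refine isCompact_support_map hTb (K := frontier P.Ω ×ˢ Metric.closedBall (0 : Vec m) E)
        ((isCompact_frontier_of_isBounded hΩb).prod (isCompact_closedBall _ _)) ?_
      filter_upwards [hTbS, hE] with x h1 h2
      exact ⟨h1.1, by simpa using h2⟩
  · intro htop
    have hm2 : Measurable fun w : Vec n × Vec m × Mat m n =>
        ‖w.2.1‖ₑ ^ P.p.toReal + ∑ k, ‖w.2.2 k‖ₑ ^ P.p.toReal := by fun_prop
    have hm3 : Measurable fun w : Vec n × Vec m => ‖w.2‖ₑ ^ P.p.toReal := by fun_prop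
    rw [hμr, hμbr, hμ, hμb, lintegral_map' hm2.aemeasurable hT, lintegral_map' hm3.aemeasurable hTb]
    refine ⟨?_, MemLp.lintegral_rpow_enorm_lt_top hg hp htop⟩
    rw [lintegral_add_left' (hy.1.enorm.pow_const _),
      lintegral_finsetSum' _ fun k _ => (hz k).1.enorm.pow_const _]
    exact ENNReal.add_lt_top.2 ⟨MemLp.lintegral_rpow_enorm_lt_top hy hp htop,
      ENNReal.sum_lt_top.2 fun k _ => MemLp.lintegral_rpow_enorm_lt_top (hz k) hp htop⟩
  · intro φ₁ φ₂ hφ₁ hφ₂ k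
    have hφ₁' : ContDiff ℝ 1 φ₁ := hφ₁.of_le (by exact_mod_cast le_top)
    have hφ₂' : ContDiff ℝ 1 φ₂ := hφ₂.of_le (by exact_mod_cast le_top)
    have hc1 : Continuous fun x => fderiv ℝ φ₁ x (stdVec k) :=
      (hφ₁'.continuous_fderiv one_ne_zero).clm_apply continuous_const
    have hc2 : Continuous fun x => fderiv ℝ φ₂ x (stdVec k) :=
      (hφ₂'.continuous_fderiv one_ne_zero).clm_apply continuous_const
    have hcont : Continuous fun w : Vec n × Vec m × Mat m n => fderiv ℝ φ₁ w.1 (stdVec k)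
          + inner ℝ w.2.1 (fderiv ℝ φ₂ w.1 (stdVec k) : Vec m)
          + inner ℝ (φ₂ w.1) (w.2.2 k) := by
      have hc3 := hφ₂.continuous
      exact ((hc1.comp continuous_fst).add (continuous_snd.fst.inner (hc2.comp continuous_fst))).add
        ((hc3.comp continuous_fst).inner ((continuous_apply k).comp continuous_snd.snd))
    have hmn : AEMeasurable (fun w : Vec n × Vec m => outerNormal P.Ω w.1 k) μb := by
      have h1 : AEMeasurable (outerNormal P.Ω) (μb.map Prod.fst) :=
        hμbfst ▸ aemeasurable_outerNormal_surfaceMeasure hΩo hΩb hΩl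
      exact (EuclideanSpace.proj (𝕜 := ℝ) k).continuous.measurable.comp_aemeasurable
        (h1.comp_measurable measurable_fst)
    have hmb : AEStronglyMeasurable (fun w : Vec n × Vec m =>
        (φ₁ w.1 + inner ℝ w.2 (φ₂ w.1)) * outerNormal P.Ω w.1 k) μb := by
      refine AEStronglyMeasurable.mul ?_ hmn.aestronglyMeasurable
      have hc3 := hφ₂.continuous
      have hc4 := hφ₁.continuous
      exact Continuous.aestronglyMeasurable ((hc4.comp continuous_fst).add
        (continuous_snd.inner (hc3.comp continuous_fst)))
    rw [hμr, hμbr]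
    rw [hμ, integral_map hT hcont.aestronglyMeasurable]
    rw [hμb] at hmb ⊢
    rw [integral_map hTb hmb]
    -- The smooth approximations in the definition of the trace carry the Gauss–Green formula over
    -- to `y`, `z` and `g`.
    obtain ⟨-, f, hfs, hfy, hfz, hfg⟩ := hf.trace
    exact integral_inner_add_eq hΩo hΩb hΩl hyi hzi hgi (fun φ hφ k =>
      integral_fderiv_smul_add_eq_of_tendsto hΩo hΩb hΩl hyi hzi hgi hfs hfy hfz hfg hφ k)
      hφ₁ hφ₂ k
  · intro i
    rw [hμ]
    exact ae_map_of_ae_of_measurableSet hT hbulk (measurableSet_constraints (hAm i) (hBm i)) hTS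
      (hf.pointwise i)
  · intro i
    rw [hμb]
    exact ae_map_of_ae_of_measurableSet hTb hbdry (measurableSet_constraints (hAbm i) (hBbm i)) hTbS
      (hf.pointwise_bdry i)
  · intro i
    rw [hμ, extIntegral_restrict_map hT hbulk (hCm i) hTS]
    exact hf.integral i
  · intro i
    rw [hμb, extIntegral_restrict_map hTb hbdry (hCbm i) hTbS]
    exact hf.integral_bdry i

/-- The relaxation does not exceed the original problem. -/
theorem MrAff_le_M (hp : 1 ≤ P.p) (hΩo : IsOpen P.Ω)
    (hΩb : Bornology.IsBounded P.Ω) (hΩl : HasLipschitzBoundary P.Ω)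
    (hYc : IsClosed P.Y) (hZc : IsClosed P.Z)
    (hLm : Measurable (P.bulk.domRestrict P.L))
    (hAm : ∀ i, Measurable (P.bulk.domRestrict (P.A i)))
    (hBm : ∀ i, Measurable (P.bulk.domRestrict (P.B i)))
    (hCm : ∀ i, Measurable (P.bulk.domRestrict (P.C i)))
    (hAbm : ∀ i, Measurable (P.bdry.domRestrict (P.A_bd i)))
    (hBbm : ∀ i, Measurable (P.bdry.domRestrict (P.B_bd i)))
    (hCbm : ∀ i, Measurable (P.bdry.domRestrict (P.C_bd i))) : P.MrAff ≤ P.M := by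
  refine le_iInf fun y => le_iInf fun z => le_iInf fun g => le_iInf fun hf => ?_
  have hT : AEMeasurable (fun x => (x, y x, z x)) (volume.restrict P.Ω) :=
    aemeasurable_id.prodMk (hf.sobolev.memLp.1.aemeasurable.prodMk
      (aemeasurable_pi_lambda _ fun k => (hf.sobolev.memLp_deriv k).1.aemeasurable))
  have hTb : AEMeasurable (fun x => (x, g x)) (surfaceMeasure P.Ω) :=
    aemeasurable_id.prodMk hf.trace.1.1.aemeasurable
  have hTS : ∀ᵐ x ∂volume.restrict P.Ω, (x, y x, z x) ∈ P.bulk := by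
    filter_upwards [ae_restrict_mem hΩo.measurableSet, hf.mem_bulk] with x h1 h2 using ⟨h1, h2⟩
  have hTbS : ∀ᵐ x ∂surfaceMeasure P.Ω, (x, g x) ∈ P.bdry := by
    filter_upwards [ae_mem_frontier, hf.mem_bdry] with x h1 h2 using ⟨h1, h2⟩
  have h := relaxedFeasible_map hp hΩo hΩb hΩl hYc hZc hAm hBm hCm hAbm hBbm hCbm hf hT hTb hTS hTbS
  have h1 : P.MrAff ≤ extIntegral (((volume.restrict P.Ω).map fun x => (x, y x, z x)).restrict
      P.bulk) P.L := iInf_le_of_le _ (iInf_le_of_le _ (iInf_le _ h))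
  rwa [extIntegral_restrict_map hT (measurableSet_bulk hΩo hYc hZc) hLm hTS] at h1

end Problem

/-! ### Linear integrals and `L^p` bounds for conditional means -/

section Disintegration

variable {α β : Type*} [MeasurableSpace α] [NormedAddCommGroup β] [NormedSpace ℝ β]
  [FiniteDimensional ℝ β] [MeasurableSpace β] [BorelSpace β] [StandardBorelSpace β]
  {μ : Measure (α × β)} [IsFiniteMeasure μ]

omit [BorelSpace β] in
theorem integral_smul_condMean {E : Type*} [NormedAddCommGroup E] [NormedSpace ℝ E]
    [CompleteSpace E] (hint : Integrable (fun w : α × β => w.2) μ) (ψ : α → ℝ) (l : β →L[ℝ] E)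
    (hI : Integrable (fun w : α × β => ψ w.1 • l w.2) μ) :
    ∫ w, ψ w.1 • l w.2 ∂μ = ∫ x, ψ x • l (condMean μ x) ∂μ.fst := by
  rw [← Measure.integral_condKernel hI]
  refine integral_congr_ae ?_
  filter_upwards [hint.condKernel_ae] with x hx
  rw [integral_smul, condMean, l.integral_comp_comm hx]

/-- For finite `p` this is Jensen's inequality for the moment; for `p = ⊤` a closed ball is convex
and so contains the means. -/
theorem memLp_condMean {E : Type*} [NormedAddCommGroup E] [NormedSpace ℝ E]
    [MeasurableSpace E] [BorelSpace E] [FiniteDimensional ℝ E]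
    (hint : Integrable (fun w : α × β => w.2) μ) (l : β →L[ℝ] E) {p : ℝ≥0∞} (hp : 1 ≤ p)
    (h : MemLp (fun w : α × β => l w.2) p μ) :
    MemLp (fun x => l (condMean μ x)) p μ.fst := by
  have hm : AEStronglyMeasurable (fun x => l (condMean μ x)) μ.fst :=
    l.continuous.comp_aestronglyMeasurable hint.1.integral_condKernel
  by_cases htop : p = ⊤
  · rw [htop] at h ⊢
    obtain ⟨C, hC⟩ := MemLp.exists_ae_norm_le h
    refine memLp_top_of_bound hm C
      (condMean_mem hint (p := fun w => ‖l w.2‖ ≤ C) hC (Eventually.of_forall fun x => ?_))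
    have h1 : {b | ‖l b‖ ≤ C} = l ⁻¹' Metric.closedBall 0 C := by
      ext b
      simp
    change Convex ℝ {b | ‖l b‖ ≤ C}
    rw [h1]
    exact (convex_closedBall 0 C).linear_preimage l.toLinearMap
  · have hp0 : p ≠ 0 := (zero_lt_one.trans_le hp).ne'
    have hp1 : 1 ≤ p.toReal := by
      rw [← ENNReal.toReal_one]
      exact ENNReal.toReal_mono htop hp
    exact ⟨hm, (eLpNorm_lt_top_iff_lintegral_rpow_enorm_lt_top hp0 htop).2
      ((lintegral_condMean_rpow_le hint l hp1).trans_lt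
        (MemLp.lintegral_rpow_enorm_lt_top h hp htop))⟩

end Disintegration

namespace Problem

variable {n m : ℕ} {I : Type*} {P : Problem n m I} {μ : Measure (Vec n × Vec m × Mat m n)}
  {μb : Measure (Vec n × Vec m)}

namespace IsAffOccupation

/-! ### Finiteness and integrability -/

theorem isFiniteMeasure (h : P.IsAffOccupation μ μb) (hΩb : Bornology.IsBounded P.Ω) :
    IsFiniteMeasure μ :=
  ⟨by rw [h.mass]; exact hΩb.measure_lt_top⟩

theorem restrict_bdry (h : P.IsAffOccupation μ μb) : μb.restrict P.bdry = μb :=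
  Measure.restrict_eq_self_of_ae_mem h.carrier_bdry

/-- The mass of `μb` is not prescribed. For `p = ⊤` its support is compact; otherwise the part with
`‖y‖ ≤ 1` lies over a compact set, and the moment bounds the mass of the rest. -/
theorem isFiniteMeasure_bdry (h : P.IsAffOccupation μ μb) (hΩb : Bornology.IsBounded P.Ω)
    (hp : 1 ≤ P.p) : IsFiniteMeasure μb := by
  have := h.radon_bdry
  by_cases htop : P.p = ⊤
  · refine ⟨?_⟩
    rw [← measure_add_measure_compl₀ (s := μb.support) Measure.nullMeasurableSet_support,
      Measure.measure_compl_support, add_zero]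
    exact (h.compact_support htop).2.measure_lt_top
  · have hmom := (h.moments htop).2
    rw [h.restrict_bdry] at hmom
    have hp1 : 0 < P.p.toReal := ENNReal.toReal_pos (zero_lt_one.trans_le hp).ne' htop
    obtain ⟨K, hK⟩ : ∃ K, K = frontier P.Ω ×ˢ Metric.closedBall (0 : Vec m) 1 := ⟨_, rfl⟩
    have hKc : IsCompact K :=
      hK ▸ (isCompact_frontier_of_isBounded hΩb).prod (isCompact_closedBall _ _)
    have h1 : μb Kᶜ ≤ ∫⁻ w, ‖w.2‖ₑ ^ P.p.toReal ∂μb := by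
      calc μb Kᶜ = ∫⁻ _ in Kᶜ, 1 ∂μb := by rw [setLIntegral_one]
        _ ≤ ∫⁻ w in Kᶜ, ‖w.2‖ₑ ^ P.p.toReal ∂μb := by
            refine setLIntegral_mono_ae (by fun_prop) ?_
            filter_upwards [h.carrier_bdry] with w hw hwK
            have h2 : 1 < ‖w.2‖ := by
              by_contra! hle
              exact hwK (hK ▸ ⟨hw.1, by simpa using hle⟩)
            refine ENNReal.one_le_rpow ?_ hp1
            rw [← ofReal_norm]
            exact ENNReal.one_le_ofReal.2 h2.le
        _ ≤ _ := setLIntegral_le_lintegral _ _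
    refine ⟨?_⟩
    rw [← measure_add_measure_compl hKc.measurableSet]
    exact ENNReal.add_lt_top.2 ⟨hKc.measure_lt_top, h1.trans_lt hmom⟩

theorem memLp_fst (h : P.IsAffOccupation μ μb) (hS : ∀ᵐ w ∂μ, w ∈ P.bulk) (hp : 1 ≤ P.p) :
    MemLp (fun w => w.2.1) P.p μ := by
  by_cases htop : P.p = ⊤
  · obtain ⟨C, hC⟩ := (h.compact_support htop).1.exists_bound_of_continuousOn
      (f := fun w : Vec n × Vec m × Mat m n => w.2.1) (by fun_prop)
    rw [htop]
    exact memLp_top_of_bound (by fun_prop) C (mem_of_superset Measure.support_mem_ae hC)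
  · have hmom := (h.moments htop).1
    rw [Measure.restrict_eq_self_of_ae_mem hS] at hmom
    refine ⟨by fun_prop, (eLpNorm_lt_top_iff_lintegral_rpow_enorm_lt_top
      (zero_lt_one.trans_le hp).ne' htop).2 (lt_of_le_of_lt (lintegral_mono fun w => ?_) hmom)⟩
    exact le_self_add

theorem memLp_snd (h : P.IsAffOccupation μ μb) (hS : ∀ᵐ w ∂μ, w ∈ P.bulk) (hp : 1 ≤ P.p)
    (k : Fin n) : MemLp (fun w => w.2.2 k) P.p μ := by
  by_cases htop : P.p = ⊤
  · obtain ⟨C, hC⟩ := (h.compact_support htop).1.exists_bound_of_continuousOn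
      (f := fun w : Vec n × Vec m × Mat m n => w.2.2 k) (by fun_prop)
    rw [htop]
    exact memLp_top_of_bound (by fun_prop) C (mem_of_superset Measure.support_mem_ae hC)
  · have hmom := (h.moments htop).1
    rw [Measure.restrict_eq_self_of_ae_mem hS] at hmom
    refine ⟨by fun_prop, (eLpNorm_lt_top_iff_lintegral_rpow_enorm_lt_top
      (zero_lt_one.trans_le hp).ne' htop).2 (lt_of_le_of_lt (lintegral_mono fun w => ?_) hmom)⟩
    exact (Finset.single_le_sum (f := fun k => ‖w.2.2 k‖ₑ ^ P.p.toReal) (fun _ _ => zero_le)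
      (Finset.mem_univ k)).trans le_add_self

theorem memLp_bdry (h : P.IsAffOccupation μ μb) (hp : 1 ≤ P.p) :
    MemLp (fun w => w.2) P.p μb := by
  by_cases htop : P.p = ⊤
  · obtain ⟨C, hC⟩ := (h.compact_support htop).2.exists_bound_of_continuousOn
      (f := fun w : Vec n × Vec m => w.2) (by fun_prop)
    rw [htop]
    exact memLp_top_of_bound (by fun_prop) C (mem_of_superset Measure.support_mem_ae hC)
  · have hmom := (h.moments htop).2
    rw [h.restrict_bdry] at hmom
    exact ⟨by fun_prop, (eLpNorm_lt_top_iff_lintegral_rpow_enorm_lt_top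
      (zero_lt_one.trans_le hp).ne' htop).2 hmom⟩

/-! ### Marginals -/

theorem integral_fderiv_fst_eq (h : P.IsAffOccupation μ μb) (hS : ∀ᵐ w ∂μ, w ∈ P.bulk)
    {φ : Vec n → ℝ} (hφ : ContDiff ℝ ∞ φ) (k : Fin n) :
    ∫ x, fderiv ℝ φ x (stdVec k) ∂μ.fst = ∫ w, φ w.1 * outerNormal P.Ω w.1 k ∂μb := by
  have h1 := h.liouville φ (fun _ => 0) hφ contDiff_const k
  rw [h.restrict_bdry, Measure.restrict_eq_self_of_ae_mem hS] at h1
  have hφ1 : ContDiff ℝ 1 φ := hφ.of_le (by exact_mod_cast le_top)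
  have hc : Continuous fun x => fderiv ℝ φ x (stdVec k) :=
    (hφ1.continuous_fderiv one_ne_zero).clm_apply continuous_const
  rw [Measure.fst, integral_map measurable_fst.aemeasurable hc.aestronglyMeasurable]
  simpa using h1

/-- For `φ₁` supported in `Ω` and `φ₂ = 0` the boundary term of the Liouville equation vanishes, so
the marginal has zero gradient. The mass condition fixes the remaining constant. -/
theorem fst_eq (h : P.IsAffOccupation μ μb) (hS : ∀ᵐ w ∂μ, w ∈ P.bulk)
    (hΩo : IsOpen P.Ω) (hΩc : IsConnected P.Ω) (hΩb : Bornology.IsBounded P.Ω) :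
    μ.fst = volume.restrict P.Ω := by
  have := h.isFiniteMeasure hΩb
  refine eq_restrict_volume_of_integral_fderiv_eq_zero hΩo hΩc ?_ ?_ fun φ hφ hφc hφs u => ?_
  · exact (ae_map_iff (p := fun x => x ∈ P.Ω) measurable_fst.aemeasurable
      hΩo.measurableSet).2 (hS.mono fun w hw => hw.1)
  · rw [Measure.fst_univ, h.mass]
  · have hφ1 : ContDiff ℝ 1 φ := hφ.of_le (by exact_mod_cast le_top)
    have hz : ∀ k, ∫ x, fderiv ℝ φ x (stdVec k) ∂μ.fst = 0 := by
      intro k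
      rw [h.integral_fderiv_fst_eq hS hφ k]
      refine integral_eq_zero_of_ae ?_
      filter_upwards [h.carrier_bdry] with w hw
      have hwΩ : w.1 ∉ P.Ω := fun hw' => hw.1.2 (by rwa [hΩo.interior_eq])
      rw [image_eq_zero_of_notMem_tsupport fun hw' => hwΩ (hφs hw'), zero_mul]
      rfl
    simp only [fun x => apply_eq_sum_stdVec (fderiv ℝ φ x) u, smul_eq_mul]
    rw [integral_finsetSum]
    · simp only [integral_const_mul, hz, mul_zero, Finset.sum_const_zero]
    · intro k _
      refine Integrable.const_mul ?_ _
      obtain ⟨C, hC⟩ := (hφc.fderiv_apply (𝕜 := ℝ) (stdVec k)).exists_bound_of_continuous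
        ((hφ1.continuous_fderiv one_ne_zero).clm_apply continuous_const)
      exact Integrable.of_bound (C := C) ((hφ1.continuous_fderiv one_ne_zero).clm_apply
        continuous_const).aestronglyMeasurable (Eventually.of_forall hC)

/-- Once the bulk marginal is Lebesgue measure, the Liouville equation with `φ₂ = 0` is the
divergence theorem for the marginal of `μb`, and this characterises the surface measure. -/
theorem fst_bdry_eq (h : P.IsAffOccupation μ μb) (hS : ∀ᵐ w ∂μ, w ∈ P.bulk) (hp : 1 ≤ P.p)
    (hΩo : IsOpen P.Ω) (hΩc : IsConnected P.Ω) (hΩb : Bornology.IsBounded P.Ω)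
    (hΩl : HasLipschitzBoundary P.Ω) :
    μb.fst = surfaceMeasure P.Ω := by
  have := h.isFiniteMeasure_bdry hΩb hp
  obtain ⟨N, hN, hNo⟩ := exists_measurable_eq_outerNormal hΩo.measurableSet
  refine eq_surfaceMeasure hΩo hΩb hΩl hN hNo ?_ fun φ hφ hφc k => ?_
  · refine (ae_map_iff (p := fun x => ‖N x‖ = 1) measurable_fst.aemeasurable
      (hN.norm (measurableSet_singleton (1 : ℝ)))).2 ?_
    filter_upwards [h.normal_ae] with w hw
    rw [hNo _ hw, hw.isOuterNormal.1]
  · have hm : Measurable fun x => φ x * N x k :=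
      hφ.continuous.measurable.mul
        ((EuclideanSpace.proj (𝕜 := ℝ) k).continuous.measurable.comp hN)
    rw [← h.fst_eq hS hΩo hΩc hΩb, h.integral_fderiv_fst_eq hS hφ k, Measure.fst,
      integral_map measurable_fst.aemeasurable hm.aestronglyMeasurable]
    refine integral_congr_ae ?_
    filter_upwards [h.normal_ae] with w hw
    rw [hNo _ hw]

end IsAffOccupation

end Problem

namespace Problem

variable {n m : ℕ} {I : Type*} {P : Problem n m I} {μ : Measure (Vec n × Vec m × Mat m n)}
  {μb : Measure (Vec n × Vec m)}

namespace IsAffOccupation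

theorem integrable_snd (h : P.IsAffOccupation μ μb) (hS : ∀ᵐ w ∂μ, w ∈ P.bulk) (hp : 1 ≤ P.p)
    (hΩb : Bornology.IsBounded P.Ω) : Integrable (fun w => w.2) μ := by
  have := h.isFiniteMeasure hΩb
  have h1 : Integrable (fun w => w.2.1) μ := (h.memLp_fst hS hp).integrable hp
  have h2 : Integrable (fun w => w.2.2) μ :=
    Integrable.of_eval fun k => (h.memLp_snd hS hp k).integrable hp
  exact h1.prodMk h2

theorem integrable_snd_bdry (h : P.IsAffOccupation μ μb) (hp : 1 ≤ P.p)
    (hΩb : Bornology.IsBounded P.Ω) : Integrable (fun w => w.2) μb := by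
  have := h.isFiniteMeasure_bdry hΩb hp
  exact (h.memLp_bdry hp).integrable hp

/-! ### The conditional means -/

/-- The Liouville equation, as a Gauss–Green formula for the conditional means. -/
theorem gaussGreen_condMean [IsFiniteMeasure μ] [IsFiniteMeasure μb]
    (h : P.IsAffOccupation μ μb) (hS : ∀ᵐ w ∂μ, w ∈ P.bulk) (hp : 1 ≤ P.p)
    (hΩo : IsOpen P.Ω) (hΩc : IsConnected P.Ω) (hΩb : Bornology.IsBounded P.Ω)
    (hΩl : HasLipschitzBoundary P.Ω) {φ : Vec n → ℝ} (hφ : ContDiff ℝ ∞ φ)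
    (hφc : HasCompactSupport φ) (k : Fin n) :
    (∫ x in P.Ω, fderiv ℝ φ x (stdVec k) • (condMean μ x).1)
      + ∫ x in P.Ω, φ x • (condMean μ x).2 k =
        ∫ x, (φ x * outerNormal P.Ω x k) • condMean μb x ∂surfaceMeasure P.Ω := by
  have hφ1 : ContDiff ℝ 1 φ := hφ.of_le (by exact_mod_cast le_top)
  have hcd : Continuous fun x => fderiv ℝ φ x (stdVec k) :=
    (hφ1.continuous_fderiv one_ne_zero).clm_apply continuous_const
  have hfst := h.fst_eq hS hΩo hΩc hΩb
  have hbfst := h.fst_bdry_eq hS hp hΩo hΩc hΩb hΩl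
  have hint := h.integrable_snd hS hp hΩb
  have hintb := h.integrable_snd_bdry hp hΩb
  obtain ⟨C, hC⟩ := hφc.exists_bound_of_continuous hφ.continuous
  obtain ⟨D, hD⟩ := (hφc.fderiv_apply (𝕜 := ℝ) (stdVec k)).exists_bound_of_continuous hcd
  let l₁ : Vec m × Mat m n →L[ℝ] Vec m := ContinuousLinearMap.fst ℝ (Vec m) (Mat m n)
  let l₂ : Vec m × Mat m n →L[ℝ] Vec m :=
    (ContinuousLinearMap.proj (R := ℝ) (φ := fun _ : Fin n => Vec m) k).comp
      (ContinuousLinearMap.snd ℝ (Vec m) (Mat m n))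
  have hI1 : Integrable (fun w => fderiv ℝ φ w.1 (stdVec k) • l₁ w.2) μ :=
    (l₁.integrable_comp hint).bdd_smul D
      (hcd.comp continuous_fst).aestronglyMeasurable (Eventually.of_forall fun w => hD w.1)
  have hI2 : Integrable (fun w => φ w.1 • l₂ w.2) μ :=
    (l₂.integrable_comp hint).bdd_smul C
      (hφ.continuous.comp continuous_fst).aestronglyMeasurable (Eventually.of_forall fun w => hC w.1)
  have hmn : AEMeasurable (fun w : Vec n × Vec m => outerNormal P.Ω w.1 k) μb := by
    have h1 : AEMeasurable (outerNormal P.Ω) μb.fst := by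
      rw [hbfst]
      exact aemeasurable_outerNormal_surfaceMeasure hΩo hΩb hΩl
    exact (EuclideanSpace.proj (𝕜 := ℝ) k).continuous.measurable.comp_aemeasurable
      (h1.comp_measurable measurable_fst)
  have hI3 : Integrable (fun w => (φ w.1 * outerNormal P.Ω w.1 k) •
      ContinuousLinearMap.id ℝ (Vec m) w.2) μb := by
    refine hintb.bdd_smul (C * 1) ((hφ.continuous.comp continuous_fst).aestronglyMeasurable.mul
      hmn.aestronglyMeasurable) (Eventually.of_forall fun w => ?_)
    rw [Pi.mul_apply, norm_mul]
    exact mul_le_mul (hC w.1) ((PiLp.norm_apply_le _ k).trans (norm_outerNormal_le _ _))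
      (norm_nonneg _) ((norm_nonneg _).trans (hC w.1))
  have e1 := integral_smul_condMean hint (fun x => fderiv ℝ φ x (stdVec k)) l₁ hI1
  have e2 := integral_smul_condMean hint φ l₂ hI2
  have e3 := integral_smul_condMean hintb (fun x => φ x * outerNormal P.Ω x k)
    (ContinuousLinearMap.id ℝ (Vec m)) hI3
  rw [hfst] at e1 e2
  rw [hbfst] at e3
  refine (congrArg₂ (· + ·) e1.symm e2.symm).trans (Eq.trans ?_ e3)

  have hI4 : Integrable (fun w => fderiv ℝ φ w.1 (stdVec k) • l₁ w.2 + φ w.1 • l₂ w.2) μ :=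
    hI1.add hI2
  rw [← integral_add hI1 hI2]
  ext i
  rw [integral_euclidean_apply hI4, integral_euclidean_apply hI3]
  -- Testing with `φ₁ = 0` and `φ₂ = φ eᵢ` selects the `i`-th component.
  have h1 := h.liouville (fun _ => 0) (fun x => φ x • stdVec i) contDiff_const
    (hφ.smul contDiff_const) k
  rw [h.restrict_bdry, Measure.restrict_eq_self_of_ae_mem hS] at h1
  refine Eq.trans (integral_congr_ae (Eventually.of_forall fun w => ?_)) (h1.trans
    (integral_congr_ae (Eventually.of_forall fun w => ?_)))
  · simp only [fderiv_smul_const (hφ1.differentiable one_ne_zero w.1),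
      ContinuousLinearMap.smulRight_apply, real_inner_smul_left, real_inner_smul_right,
      inner_stdVec, fderiv_fun_const]
    rw [real_inner_comm, inner_stdVec]
    simp [l₁, l₂]
  · simp only [real_inner_smul_right, inner_stdVec]
    simp
    ring

end IsAffOccupation

theorem convex_setOf_constraints {E : Type*} [NormedAddCommGroup E] [NormedSpace ℝ E] {S : Set E}
    {A B : E → ℝ} (hA : ∃ a : E →ᵃ[ℝ] ℝ, ∀ w ∈ S, A w = a w) (hB : ConvexOn ℝ S B) :
    Convex ℝ {w | w ∈ S ∧ A w = 0 ∧ B w ≤ 0} := by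
  obtain ⟨a, ha⟩ := hA
  have h1 : {w | w ∈ S ∧ A w = 0 ∧ B w ≤ 0} = {w ∈ S | B w ≤ 0} ∩ a ⁻¹' {0} := by
    ext w
    constructor
    · rintro ⟨h1, h2, h3⟩
      exact ⟨⟨h1, h3⟩, by rw [mem_preimage, ← ha w h1, h2]; rfl⟩
    · rintro ⟨⟨h1, h3⟩, h2⟩
      exact ⟨h1, (ha w h1).trans h2, h3⟩
  rw [h1]
  exact (hB.convex_le 0).inter ((convex_singleton 0).affine_preimage a)

/-- The conditional means of relaxed feasible measures are feasible for the original problem. -/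
theorem feasible_condMean [IsFiniteMeasure μ] [IsFiniteMeasure μb] (h : P.RelaxedFeasible μ μb)
    (hp : 1 ≤ P.p) (hΩo : IsOpen P.Ω) (hΩc : IsConnected P.Ω) (hΩb : Bornology.IsBounded P.Ω)
    (hΩl : HasLipschitzBoundary P.Ω) (hYc : IsClosed P.Y) (hYx : Convex ℝ P.Y)
    (hZc : IsClosed P.Z) (hZx : Convex ℝ P.Z)
    (hCm : ∀ i, Measurable (P.bulk.domRestrict (P.C i)))
    (hCbm : ∀ i, Measurable (P.bdry.domRestrict (P.C_bd i)))
    (hA : ∀ i, ∀ x ∈ P.Ω, ∃ a : (Vec m × Mat m n) →ᵃ[ℝ] ℝ, ∀ w ∈ P.Y ×ˢ P.Z, P.A i (x, w) = a w)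
    (hB : ∀ i, ∀ x ∈ P.Ω, ConvexOn ℝ (P.Y ×ˢ P.Z) (fun w => P.B i (x, w)))
    (hC : ∀ i, ∀ x ∈ P.Ω, ConvexOn ℝ (P.Y ×ˢ P.Z) (fun w => P.C i (x, w)))
    (hAb : ∀ i, ∀ x ∈ frontier P.Ω, ∃ a : Vec m →ᵃ[ℝ] ℝ, ∀ y ∈ P.Y, P.A_bd i (x, y) = a y)
    (hBb : ∀ i, ∀ x ∈ frontier P.Ω, ConvexOn ℝ P.Y (fun y => P.B_bd i (x, y)))
    (hCb : ∀ i, ∀ x ∈ frontier P.Ω, ConvexOn ℝ P.Y (fun y => P.C_bd i (x, y))) :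
    P.Feasible (fun x => (condMean μ x).1) (fun x => (condMean μ x).2) (condMean μb) := by
  have ho := h.occupation
  have hS := h.carrier_bulk
  have hfst := ho.fst_eq hS hΩo hΩc hΩb
  have hbfst := ho.fst_bdry_eq hS hp hΩo hΩc hΩb hΩl
  have hint := ho.integrable_snd hS hp hΩb
  have hintb := ho.integrable_snd_bdry hp hΩb
  have hxΩ : ∀ᵐ x ∂μ.fst, x ∈ P.Ω := hfst ▸ ae_restrict_mem hΩo.measurableSet
  have hxb : ∀ᵐ x ∂μb.fst, x ∈ frontier P.Ω := hbfst ▸ ae_mem_frontier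
  have hsec : ∀ x ∈ P.Ω, {b | (x, b) ∈ P.bulk} = P.Y ×ˢ P.Z := fun x hx => by
    ext b
    exact ⟨fun hb => hb.2, fun hb => ⟨hx, hb⟩⟩
  have hsecb : ∀ x ∈ frontier P.Ω, {b | (x, b) ∈ P.bdry} = P.Y := fun x hx => by
    ext b
    exact ⟨fun hb => hb.2, fun hb => ⟨hx, hb⟩⟩
  have hLp : MemLp (fun x => (condMean μ x).1) P.p μ.fst :=
    memLp_condMean hint (ContinuousLinearMap.fst ℝ (Vec m) (Mat m n)) hp (ho.memLp_fst hS hp)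
  have hLpd : ∀ k, MemLp (fun x => (condMean μ x).2 k) P.p μ.fst := fun k =>
    memLp_condMean hint ((ContinuousLinearMap.proj (R := ℝ) (φ := fun _ : Fin n => Vec m) k).comp
      (ContinuousLinearMap.snd ℝ (Vec m) (Mat m n))) hp (ho.memLp_snd hS hp k)
  have hLpb : MemLp (condMean μb) P.p μb.fst :=
    memLp_condMean hintb (ContinuousLinearMap.id ℝ (Vec m)) hp (ho.memLp_bdry hp)
  have hyi : Integrable (fun x => (condMean μ x).1) μ.fst := hLp.integrable hp
  have hzi : ∀ k, Integrable (fun x => (condMean μ x).2 k) μ.fst := fun k => (hLpd k).integrable hp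
  have hGG := fun φ hφ hφc k =>
    ho.gaussGreen_condMean hS hp hΩo hΩc hΩb hΩl (φ := φ) hφ hφc k
  rw [hfst] at hLp hyi
  simp only [hfst] at hLpd hzi
  rw [hbfst] at hLpb
  -- For test functions supported in `Ω` the boundary term drops out of the Gauss–Green formula.
  have hw : IsWeakDeriv P.Ω (fun x => (condMean μ x).1) (fun x => (condMean μ x).2) := by
    intro φ hφ hφc hφs k
    rw [eq_neg_iff_add_eq_zero, hGG φ hφ hφc k]
    refine integral_eq_zero_of_ae ?_
    filter_upwards [ae_mem_frontier] with x hx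
    have hxn : x ∉ P.Ω := fun hx' => hx.2 (by rwa [hΩo.interior_eq])
    rw [image_eq_zero_of_notMem_tsupport fun hx' => hxn (hφs hx'), zero_mul, zero_smul]
    rfl
  refine ⟨⟨hLp, hLpd, hw⟩, isTrace_of_integral_eq hΩo hΩb hΩl hp hyi hzi hw hLpb hGG,
    ?_, ?_, ?_, ?_, ?_, ?_⟩
  · rw [← hfst]
    refine (condMean_mem hint hS (hxΩ.mono fun x hx => ?_)).mono fun x hx => hx.2
    rw [hsec x hx]
    exact hYx.prod hZx
  · rw [← hbfst]
    refine (condMean_mem hintb ho.carrier_bdry (hxb.mono fun x hx => ?_)).mono fun x hx => hx.2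
    rw [hsecb x hx]
    exact hYx
  · intro i
    rw [← hfst]
    -- For fixed `i` and `x` the admissible `(y, z)` form a convex set, the intersection of a
    -- sublevel set with the zero set of an affine function, so it contains the mean.
    refine (condMean_mem hint (hS.and (h.support i)) (hxΩ.mono fun x hx => ?_)).mono
      fun x hx => hx.2
    convert convex_setOf_constraints (hA i x hx) (hB i x hx) using 1
    ext b
    exact and_congr_left fun _ => Set.ext_iff.1 (hsec x hx) b
  · intro i
    rw [← hbfst]
    refine (condMean_mem hintb (ho.carrier_bdry.and (h.support_bdry i))
      (hxb.mono fun x hx => ?_)).mono fun x hx => hx.2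
    convert convex_setOf_constraints (hAb i x hx) (hBb i x hx) using 1
    ext b
    exact and_congr_left fun _ => Set.ext_iff.1 (hsecb x hx) b
  · intro i
    rw [← hfst]
    refine (extIntegral_condMean_le hint (measurableSet_bulk hΩo hYc hZc) (hCm i) hS
      (hxΩ.mono fun x hx => ?_)).trans ?_
    · rw [hsec x hx]
      exact hC i x hx
    · have := h.integral i
      rwa [Measure.restrict_eq_self_of_ae_mem hS] at this
  · intro i
    rw [← hbfst]
    refine (extIntegral_condMean_le hintb (measurableSet_bdry hYc) (hCbm i) ho.carrier_bdry
      (hxb.mono fun x hx => ?_)).trans ?_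
    · rw [hsecb x hx]
      exact hCb i x hx
    · have := h.integral_bdry i
      rwa [ho.restrict_bdry] at this

end Problem

end OccRelax
-- The main theorem
open OccRelax in
theorem theorem1 {n m : ℕ} (hn : 1 ≤ n) {I : Type*} (P : Problem n m I)
    (hp : 1 ≤ P.p)
    -- the domain: bounded, open, connected, with Lipschitz boundary
    (hΩo : IsOpen P.Ω) (hΩc : IsConnected P.Ω) (hΩb : Bornology.IsBounded P.Ω)
    (hΩl : HasLipschitzBoundary P.Ω)
    -- the target sets are closed and convex
    (hYc : IsClosed P.Y) (hYx : Convex ℝ P.Y) (hZc : IsClosed P.Z) (hZx : Convex ℝ P.Z)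
    -- the data are Borel measurable
    (hLm : Measurable (P.bulk.domRestrict P.L))
    (hAm : ∀ i, Measurable (P.bulk.domRestrict (P.A i)))
    (hBm : ∀ i, Measurable (P.bulk.domRestrict (P.B i)))
    (hCm : ∀ i, Measurable (P.bulk.domRestrict (P.C i)))
    (hAbm : ∀ i, Measurable (P.bdry.domRestrict (P.A_bd i)))
    (hBbm : ∀ i, Measurable (P.bdry.domRestrict (P.B_bd i)))
    (hCbm : ∀ i, Measurable (P.bdry.domRestrict (P.C_bd i)))
    -- convexity in `(y, z)` for fixed `x ∈ Ω`
    (hL : ∀ x ∈ P.Ω, ConvexOn ℝ (P.Y ×ˢ P.Z) (fun w => P.L (x, w)))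
    (hA : ∀ i, ∀ x ∈ P.Ω, ∃ a : (Vec m × Mat m n) →ᵃ[ℝ] ℝ, ∀ w ∈ P.Y ×ˢ P.Z, P.A i (x, w) = a w)
    (hB : ∀ i, ∀ x ∈ P.Ω, ConvexOn ℝ (P.Y ×ˢ P.Z) (fun w => P.B i (x, w)))
    (hC : ∀ i, ∀ x ∈ P.Ω, ConvexOn ℝ (P.Y ×ˢ P.Z) (fun w => P.C i (x, w)))
    -- convexity in `y` for fixed `x ∈ ∂Ω`
    (hAb : ∀ i, ∀ x ∈ frontier P.Ω, ∃ a : Vec m →ᵃ[ℝ] ℝ, ∀ y ∈ P.Y, P.A_bd i (x, y) = a y)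
    (hBb : ∀ i, ∀ x ∈ frontier P.Ω, ConvexOn ℝ P.Y (fun y => P.B_bd i (x, y)))
    (hCb : ∀ i, ∀ x ∈ frontier P.Ω, ConvexOn ℝ P.Y (fun y => P.C_bd i (x, y))) :
    P.MrAff = P.M := by
  refine le_antisymm (P.MrAff_le_M hp hΩo hΩb hΩl hYc hZc hLm hAm hBm hCm hAbm hBbm hCbm) ?_
  refine le_iInf fun μ => le_iInf fun μb => le_iInf fun h => ?_
  have hμ := h.occupation.isFiniteMeasure hΩb
  have hμb := h.occupation.isFiniteMeasure_bdry hΩb hp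
  have hf := Problem.feasible_condMean h hp hΩo hΩc hΩb hΩl hYc hYx hZc hZx hCm hCbm hA hB hC
    hAb hBb hCb
  have hfst := h.occupation.fst_eq h.carrier_bulk hΩo hΩc hΩb
  have h1 : P.M ≤ extIntegral (volume.restrict P.Ω) fun x => P.L (x, condMean μ x) :=
    iInf_le_of_le _ (iInf_le_of_le _ (iInf_le_of_le _ (iInf_le _ hf)))
  refine h1.trans ?_
  rw [← hfst, Measure.restrict_eq_self_of_ae_mem h.carrier_bulk]
  -- Jensen's inequality for `L`: passing to conditional means does not increase the cost.
  refine extIntegral_condMean_le (h.occupation.integrable_snd h.carrier_bulk hp hΩb)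
    (Problem.measurableSet_bulk hΩo hYc hZc) hLm h.carrier_bulk ?_
  have hxΩ : ∀ᵐ x ∂μ.fst, x ∈ P.Ω := hfst ▸ ae_restrict_mem hΩo.measurableSet
  filter_upwards [hxΩ] with x hx
  have hsec : {b | (x, b) ∈ P.bulk} = P.Y ×ˢ P.Z := by
    ext b
    exact ⟨fun hb => hb.2, fun hb => ⟨hx, hb⟩⟩
  rw [hsec]
  exact hL x hx
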